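/- **Setting.** Let $d\ge 1$, $L_1,L_2>0$, $\Delta\ge 0$. Let $f:\mathbb R^d\to\mathbb R$ be twice differentiable with $\|\nabla f(x)-\nabla f(y)\|\le L_1\|x-y\|$ and $\|\nabla^2 f(x)-\nabla^2 f(y)\|_2\le L_2\|x-y\|$ for all $x,y$, and let $x_0$ satisfy $f(x_0)-f(x)\le\Delta$ for all $x$. A gradient of $f$ costs time $T_g$, a Hessian-vector product costs $T_h$, with $0\le T_g\le T_h$; other operations are free. Let $\mathrm{sign}(0)=1$ and $[t]_+=\max(t,0)$. **NCG step** $\mathrm{NCG}(x,\varepsilon,\delta)$. Draw a fresh $b$ uniformly from the unit sphere and run $\min\{d,\,1+\lceil 2\sqrt{L_1/\varepsilon}\,\log(d/\delta)\rceil\}$ iterations of the Lanczos method on $\nabla^2f(x)$ from $b$; let $v$ be the unit Ritz vector of the smallest Ritz value and $c=v^\top\nabla^2f(x)v$. If $c<0$ and $\frac{2|c|^3}{3L_2^2}>\frac{\|\nabla f(x)\|^2}{2L_1}$, set $x^+=x-\frac{2|c|}{L_2}\mathrm{sign}(v^\top\nabla f(x))\,v$; otherwise set $x^+=x-\frac1{L_1}\nabla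 f(x)$. Its time is $T_h$ times the number of Hessian-vector products (one per Lanczos iteration and one for $c$), plus $T_g$. **NCG-A2** $(x_1,\epsilon_1,\alpha,\delta)$. Let $\epsilon_2=\epsilon_1^\alpha$ and $\delta'=\delta/\bigl(1+\max(12L_2^2/\epsilon_2^3,\,2L_1/\epsilon_1^2)\Delta\bigr)$. For $j=1,2,\dots$ compute $x_{j+1},v_j$ by $\mathrm{NCG}(x_j,\max(\epsilon_2,\|\nabla f(x_j)\|^\alpha)/2,\delta')$, and return $x_j$ if $v_j^\top\nabla^2f(x_j)v_j>-\epsilon_2/2$ and $\|\nabla f(x_j)\|\le\epsilon_1$. **AGD** $(g,y_1,\epsilon,L,\sigma)$. Let $\kappa=L/\sigma$, $m=\frac{\sqrt\kappa-1}{\sqrt\kappa+1}$, $z_1=y_1$. For $j=1,2,\dots$ return $y_j$ if $\|\nabla g(y_j)\|\le\epsilon$; otherwise $y_{j+1}=z_j-\frac1L\nabla g(z_j)$ and $z_{j+1}=(1+m)y_{j+1}-m\,y_j$ (a *gradient step*). **Almost-Convex-AGD** $(h,z_1,\epsilon,\gamma,L)$. For $j=1,2,\dots$ return $z_j$ if $\|\nabla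 h(z_j)\|\le\epsilon$; otherwise $z_{j+1}=\mathrm{AGD}\bigl(h+\gamma\|\cdot-z_j\|^2,\,z_j,\,\epsilon\sqrt{\gamma/(50(L+2\gamma))},\,L,\,\gamma\bigr)$. **NCG-B2** $(x_0,\epsilon_1,\alpha,\delta)$. Let $\epsilon_2=\epsilon_1^\alpha$, $K=\Bigl\lceil 1+\Delta\Bigl(\frac{\max(12L_2^2,2L_1)}{\epsilon_2^3}+\frac{2\sqrt{10}L_2}{\epsilon_1\epsilon_2}\Bigr)\Bigr\rceil$, $\delta'=\delta/K$, $x_1=x_0$. For $k=1,2,\dots$ let $\widehat x_k=\text{NCG-A2}(x_k,\epsilon_1^{3\alpha/2},\frac23,\delta')$; return $\widehat x_k$ if $\|\nabla f(\widehat x_k)\|\le\epsilon_1$; otherwise let $f_k(x)=f(x)+L_1\bigl([\|x-\widehat x_k\|-\epsilon_2/L_2]_+\bigr)^2$ and $x_{k+1}=\text{Almost-Convex-AGD}(f_k,\widehat x_k,\epsilon_1/2,3\epsilon_2,5L_1)$. **Theorem 4.** There are an absolute constant $c>0$ and, for all $L_1,L_2>0$, $\Delta\ge0$, a constant $C>0$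 depending only on $L_1,L_2,\Delta$, such that the following holds in the above setting. Let $\alpha\in(0,1]$, $\epsilon_1\in(0,1]$, $\epsilon_2=\epsilon_1^\alpha$ with $3\epsilon_2\le L_1$, $\delta\in(0,1)$, and $\tau=1+\frac1{\epsilon_1}+\frac1\delta+d+L_1+L_2+\Delta$. Then, with probability at least $1-\delta$, NCG-B2 terminates and returns a point $\widehat x$ with $\|\nabla f(\widehat x)\|\le\epsilon_1$ and $\lambda_{\min}(\nabla^2f(\widehat x))\ge-\epsilon_2$, and moreover: 1. it takes at most $C\left(\frac1{\epsilon_2^3}+\frac1{\epsilon_1\epsilon_2}\right)$ NCG steps; 2. it takes at most $C\left(\frac1{\epsilon_2^{7/2}}+\frac1{\epsilon_1\epsilon_2^{3/2}}+\frac{\epsilon_2^{1/2}}{\epsilon_1^2}\right)\log\tau$ gradient steps in Almost-Convex-AGD; 3. with $B(x)=\frac{\sqrt{L_1}}{\max(\epsilon_2,\|\nabla f(x)\|^{2/3})^{1/2}}\log\frac d{\delta'}$ and $\delta'=\delta/K$, each NCG step at a point $x_j$ takes time at most $c\,T_h\max\{1,B(x_j)\}$, and, if $d\ge2$, also at most $C\,T_h\,B(x_j)$;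 4. its total time is at most $C\left(\left(\frac1{\epsilon_1\epsilon_2^{3/2}}+\frac1{\epsilon_2^{7/2}}\right)T_h+\frac{\epsilon_2^{1/2}}{\epsilon_1^2}T_g\right)\log\tau$. -/

import Mathlib

open MeasureTheory ProbabilityTheory

noncomputable section

namespace NegCurv

/-- `ℝᵈ` with the Euclidean norm. -/
abbrev Vec (d : ℕ) : Type := EuclideanSpace ℝ (Fin d)

/-- The smallest eigenvalue of an endomorphism (used for symmetric ones on nonzero
finite-dimensional real spaces, where the set of eigenvalues is finite and nonempty). -/
def lambdaMin {M : Type*} [AddCommGroup M] [Module ℝ M] (A : Module.End ℝ M) : ℝ :=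
  sInf {μ : ℝ | Module.End.HasEigenvalue A μ}

/-- The Hessian of `f` at `x`, as a linear operator: the derivative of the gradient. -/
def hess {d : ℕ} (f : Vec d → ℝ) (x : Vec d) : Vec d →L[ℝ] Vec d :=
  fderiv ℝ (gradient f) x

/-- The standing assumptions on the objective function and the initial point: `f` is twice
differentiable, its gradient is `L₁`-Lipschitz, its Hessian is `L₂`-Lipschitz in the spectral
norm, and `f x₀ - f x ≤ Δ` for every `x`. -/
structure Admissible {d : ℕ} (f : Vec d → ℝ) (x₀ : Vec d) (L₁ L₂ Δ : ℝ) : Prop where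
  differentiable : Differentiable ℝ f
  differentiable_gradient : Differentiable ℝ (gradient f)
  gradient_lipschitz : ∀ x y, ‖gradient f x - gradient f y‖ ≤ L₁ * ‖x - y‖
  hess_lipschitz : ∀ x y, ‖hess f x - hess f y‖ ≤ L₂ * ‖x - y‖
  gap : ∀ x, f x₀ - f x ≤ Δ

/-- The uniform distribution on the unit sphere of `ℝᵈ`: normalized surface measure. -/
def uniformSphere (d : ℕ) : Measure (Metric.sphere (0 : Vec d) 1) :=
  ProbabilityTheory.cond (volume : Measure (Vec d)).toSphere Set.univ

/-! ### The Lanczos method -/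

section Lanczos

variable {d : ℕ} (H : Vec d →L[ℝ] Vec d) (b : Vec d)

/-- The Lanczos three-term recurrence started at the unit vector `b`. The state at index `j` is
`(q (j-1), q j, β j)`; passing to the next state uses the single product `H (q j)`. After a
breakdown (`β j = 0`) all further vectors are zero. -/
def lanczosState : ℕ → Vec d × Vec d × ℝ
  | 0 => (0, b, 0)
  | j + 1 =>
    let p := (lanczosState j).1
    let q := (lanczosState j).2.1
    let β := (lanczosState j).2.2
    let w := H q - (inner ℝ q (H q)) • q - β • p
    (q, ‖w‖⁻¹ • w, ‖w‖)

/-- The `j`-th Lanczos vector. -/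
def lanczosQ (j : ℕ) : Vec d := (lanczosState H b j).2.1

/-- The off-diagonal coefficient linking the Lanczos vectors `j - 1` and `j`. -/
def lanczosBeta (j : ℕ) : ℝ := (lanczosState H b j).2.2

/-- The diagonal coefficient belonging to the `j`-th Lanczos vector. -/
def lanczosAlpha (j : ℕ) : ℝ := inner ℝ (lanczosQ H b j) (H (lanczosQ H b j))

/-- The number of Lanczos vectors built in `k` iterations (it is `k` unless the recurrence
breaks down earlier). -/
def lanczosDim (k : ℕ) : ℕ :=
  ((Finset.range k).filter fun j => 0 < ‖lanczosQ H b j‖).card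

/-- The tridiagonal matrix of the first `m` Lanczos vectors. -/
def lanczosT (m : ℕ) : Matrix (Fin m) (Fin m) ℝ :=
  Matrix.of fun i j =>
    if i = j then lanczosAlpha H b i
    else if (i : ℕ) + 1 = j then lanczosBeta H b j
    else if (j : ℕ) + 1 = i then lanczosBeta H b i
    else 0

/-- The smallest Ritz value after `k` iterations. -/
def ritzValue (k : ℕ) : ℝ :=
  lambdaMin (Matrix.toLin' (lanczosT H b (lanczosDim H b k)))

/-- The eigenvector of the tridiagonal matrix for the eigenvalue `θ`, with first coordinate `1`,
obtained from the rows of `T y = θ y` by forward substitution. -/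
def ritzCoeff (θ : ℝ) : ℕ → ℝ
  | 0 => 1
  | 1 => (θ - lanczosAlpha H b 0) / lanczosBeta H b 1
  | j + 2 =>
    ((θ - lanczosAlpha H b (j + 1)) * ritzCoeff θ (j + 1)
      - lanczosBeta H b (j + 1) * ritzCoeff θ j) / lanczosBeta H b (j + 2)

/-- The output of `k` iterations of the Lanczos method: the normalized Ritz vector that belongs to
the smallest Ritz value. It costs (at most) `k` products of `H` with a vector. -/
def lanczos (k : ℕ) : Vec d :=
  let y := ritzCoeff H b (ritzValue H b k)
  let u := ∑ j ∈ Finset.range (lanczosDim H b k), y j • lanczosQ H b j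
  ‖u‖⁻¹ • u

end Lanczos

/-- The number of Lanczos iterations run for noise level `ε` and failure probability `δ`:
`O(√(L₁ / ε) log (d / δ))`, and never more than the dimension. -/
def lanczosIters (L₁ : ℝ) (d : ℕ) (ε δ : ℝ) : ℕ :=
  min d (1 + ⌈2 * √(L₁ / ε) * Real.log (d / δ)⌉₊)

/-! ### The cost model -/

/-- The record of one executed NCG step: the point where it was taken, and the numbers of
Hessian-vector products and of gradients of `f` that it used. -/
structure NCGRecord (d : ℕ) where
  point : Vec d
  hvps : ℕ
  grads : ℕ

/-- The time of an NCG step if a gradient costs `Tg` and a Hessian-vector product costs `Th`. -/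
def NCGRecord.time {d : ℕ} (Tg Th : ℝ) (r : NCGRecord d) : ℝ :=
  Th * r.hvps + Tg * r.grads

/-- The account kept during a run: the NCG steps executed so far, the number of accelerated
gradient steps, and the number of gradients of `f` computed outside the NCG steps. -/
structure Tally (d : ℕ) where
  ncg : List (NCGRecord d)
  agdSteps : ℕ
  grads : ℕ

/-- The total time spent so far. -/
def Tally.time {d : ℕ} (Tg Th : ℝ) (t : Tally d) : ℝ :=
  (t.ncg.map (NCGRecord.time Tg Th)).sum + Tg * t.grads

/-- Nothing has been spent yet. -/
def Tally.zero (d : ℕ) : Tally d := ⟨[], 0, 0⟩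

/-- Enter an executed NCG step. -/
def Tally.addNCG {d : ℕ} (t : Tally d) (r : NCGRecord d) : Tally d :=
  { t with ncg := r :: t.ncg }

/-- Enter `n` gradients computed outside the NCG steps. -/
def Tally.addGrads {d : ℕ} (t : Tally d) (n : ℕ) : Tally d :=
  { t with grads := t.grads + n }

/-- Enter an accelerated gradient step. -/
def Tally.addAGDStep {d : ℕ} (t : Tally d) : Tally d :=
  { t with agdSteps := t.agdSteps + 1 }

/-! ### The algorithms

Every unbounded loop is a `PFun.fix`: the loop body answers `Sum.inl` to return a value and
`Sum.inr` to go on with a new state, and the loop has no value if it never returns. -/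

/-- The sign of a real number, with `sign 0 = 1` (the negative curvature step must move). -/
def sgn (t : ℝ) : ℝ := if 0 ≤ t then 1 else -1

/-- The unit vector `v` computed by an NCG step at `x` with noise level `ε`, failure probability
`δ` and random starting vector `b`. -/
def ncgDir {d : ℕ} (f : Vec d → ℝ) (L₁ : ℝ) (b x : Vec d) (ε δ : ℝ) : Vec d :=
  lanczos (hess f x) b (lanczosIters L₁ d ε δ)

/-- The curvature `vᵀ ∇²f(x) v` along the vector `v` computed by an NCG step. -/
def ncgCurv {d : ℕ} (f : Vec d → ℝ) (L₁ : ℝ) (b x : Vec d) (ε δ : ℝ) : ℝ :=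
  inner ℝ (ncgDir f L₁ b x ε δ) (hess f x (ncgDir f L₁ b x ε δ))

/-- The next iterate of an NCG step: the step along the computed direction is taken if that
direction has negative curvature and its guaranteed decrease of `f` exceeds that of the gradient
step; otherwise the gradient step is taken. -/
def ncgNext {d : ℕ} (f : Vec d → ℝ) (L₁ L₂ : ℝ) (b x : Vec d) (ε δ : ℝ) : Vec d :=
  let v := ncgDir f L₁ b x ε δ
  let c := ncgCurv f L₁ b x ε δ
  if c < 0 ∧ ‖gradient f x‖ ^ 2 / (2 * L₁) < 2 * |c| ^ 3 / (3 * L₂ ^ 2) then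
    x - (2 * |c| / L₂ * sgn (inner ℝ v (gradient f x))) • v
  else
    x - (1 / L₁) • gradient f x

/-- The cost of an NCG step: the products of the Lanczos method, one more product for the
curvature `vᵀ ∇²f(x) v`, and one gradient. -/
def ncgRecord {d : ℕ} (L₁ : ℝ) (x : Vec d) (ε δ : ℝ) : NCGRecord d :=
  ⟨x, lanczosIters L₁ d ε δ + 1, 1⟩

/-- The failure probability that NCG-A2 hands to each of its NCG steps. -/
def ncgA2Delta (L₁ L₂ Δ ε₁ α δ : ℝ) : ℝ :=
  δ / (1 + max (12 * L₂ ^ 2 / (ε₁ ^ α) ^ 3) (2 * L₁ / ε₁ ^ 2) * Δ)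

/-- The procedure NCG-A2 with parameters `ε₁, α, δ`, started at a point and an account. The `n`-th
NCG step of the whole computation uses the random vector `ξ n`. -/
def ncgA2 {d : ℕ} (f : Vec d → ℝ) (L₁ L₂ Δ : ℝ) (ξ : ℕ → Vec d) (ε₁ α δ : ℝ) :
    Vec d × Tally d →. Vec d × Tally d :=
  PFun.fix fun s =>
    let x := s.1
    let b := ξ s.2.ncg.length
    let ε₂ := ε₁ ^ α
    let δ' := ncgA2Delta L₁ L₂ Δ ε₁ α δ
    let ε := max ε₂ (‖gradient f x‖ ^ α) / 2
    let t := s.2.addNCG (ncgRecord L₁ x ε δ')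
    Part.some <|
      if -ε₂ / 2 < ncgCurv f L₁ b x ε δ' ∧ ‖gradient f x‖ ≤ ε₁ then Sum.inl (x, t)
      else Sum.inr (ncgNext f L₁ L₂ b x ε δ', t)

/-- The procedure Accelerated-Gradient-Descent for `g` with accuracy `ε`, smoothness parameter `L`
and strong convexity parameter `σ`. The loop state is `(y j, z j)` and the account. Each iteration
computes a gradient at `y j` and, if it does not return, another one at `z j`. -/
def agd {d : ℕ} (g : Vec d → ℝ) (ε L σ : ℝ) :
    (Vec d × Vec d) × Tally d →. Vec d × Tally d :=
  PFun.fix fun s =>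
    let y := s.1.1
    let z := s.1.2
    let κ := L / σ
    let m := (√κ - 1) / (√κ + 1)
    Part.some <|
      if ‖gradient g y‖ ≤ ε then Sum.inl (y, s.2.addGrads 1)
      else
        let y' := z - (1 / L) • gradient g z
        Sum.inr ((y', (1 + m) • y' - m • y), (s.2.addGrads 2).addAGDStep)

/-- The procedure Almost-Convex-AGD for `f` with accuracy `ε`, almost-convexity parameter `γ` and
smoothness parameter `L`. -/
def almostConvexAGD {d : ℕ} (f : Vec d → ℝ) (ε γ L : ℝ) :
    Vec d × Tally d →. Vec d × Tally d :=
  PFun.fix fun s =>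
    let z := s.1
    let t := s.2.addGrads 1
    if ‖gradient f z‖ ≤ ε then Part.some (Sum.inl (z, t))
    else
      let g : Vec d → ℝ := fun x => f x + γ * ‖x - z‖ ^ 2
      let ε' := ε * √(γ / (50 * (L + 2 * γ)))
      (agd g ε' L γ ((z, z), t)).map Sum.inr

/-- The number `K` of outer iterations allowed for in NCG-B2. -/
def outerBound (L₁ L₂ Δ ε₁ ε₂ : ℝ) : ℕ :=
  ⌈1 + Δ * (max (12 * L₂ ^ 2) (2 * L₁) / ε₂ ^ 3 + 2 * √10 * L₂ / (ε₁ * ε₂))⌉₊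

/-- The failure probability `δ' = δ / K` that NCG-B2 hands to each call of NCG-A2. -/
def ncgB2Delta (L₁ L₂ Δ ε₁ α δ : ℝ) : ℝ :=
  δ / outerBound L₁ L₂ Δ ε₁ (ε₁ ^ α)

/-- The function `f(x) + L₁ ([‖x - c‖ - ε₂ / L₂]₊)²`. -/
def regularized {d : ℕ} (f : Vec d → ℝ) (L₁ L₂ ε₂ : ℝ) (c : Vec d) : Vec d → ℝ :=
  fun x => f x + L₁ * (max (‖x - c‖ - ε₂ / L₂) 0) ^ 2

/-- The algorithm NCG-B2 with parameters `ε₁, α, δ`, started at `x₀`, using the random starting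
vectors `ξ`. Its value is the returned point with the account of the whole run. -/
def ncgB2 {d : ℕ} (f : Vec d → ℝ) (L₁ L₂ Δ : ℝ) (ξ : ℕ → Vec d) (ε₁ α δ : ℝ) (x₀ : Vec d) :
    Part (Vec d × Tally d) :=
  let ε₂ := ε₁ ^ α
  let δ' := ncgB2Delta L₁ L₂ Δ ε₁ α δ
  PFun.fix (fun s : Vec d × Tally d =>
    (ncgA2 f L₁ L₂ Δ ξ (ε₁ ^ (3 * α / 2)) (2 / 3) δ' s).bind fun r =>
      let t := r.2.addGrads 1
      if ‖gradient f r.1‖ ≤ ε₁ then Part.some (Sum.inl (r.1, t))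
      else
        (almostConvexAGD (regularized f L₁ L₂ ε₂ r.1) (ε₁ / 2) (3 * ε₂) (5 * L₁)
          (r.1, t)).map Sum.inr)
    (x₀, Tally.zero d)

/-- The bound `√L₁ / max(ε₂, ‖∇f(x)‖^{2/3})^{1/2} · log (d / δ')` for an NCG step at `x`. -/
def stepBound {d : ℕ} (f : Vec d → ℝ) (L₁ ε₂ δ' : ℝ) (x : Vec d) : ℝ :=
  √L₁ / √(max ε₂ (‖gradient f x‖ ^ (2 / 3 : ℝ))) * Real.log (d / δ')

end NegCurv

end

open NegCurv

/-!
Let `a = ε₂³ / max (12 L₂²) (2 L₁)` and `b = ε₁ ε₂ / (2 √10 L₂)`. The proof is a potential argument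
for `f`, whose total decrease along a run is at most `Δ`, on the event that no call of the Lanczos
method fails.

*Lanczos method.* As long as the recurrence does not break down it builds an orthonormal basis of a
Krylov space, so that the Ritz vector minimizes the Rayleigh quotient over all `p(H) b` with
`deg p < k` (`lanczos_spec`). A Chebyshev polynomial that is large at the smallest eigenvalue and
bounded on the part of the spectrum beyond the noise level (or, for `k = d`, a product of linear
factors) shows that the method misses the smallest eigenvalue by more than `ε` only if `b` is nearly
orthogonal to an eigenvector; the uniform measure of such a band is bounded by a linear change of
variables (`uniformSphere_lanczos_failure_le`). The iterates that precede an NCG step are a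
measurable function of the earlier starting vectors, hence independent of the current one, and a
union bound over `N = ⌊K + Δ / a⌋` steps with failure probability `δ / (K (1 + Δ / a))` each gives
`Admissible.measure_exists_lanczosFails_le`.

*Progress.* An NCG step after which NCG-A2 does not return decreases `f` by `a`
(`Admissible.ncgNext_le_of_not_returns`). If NCG-A2 returns, the Hessian there is at least `-ε₂`.
As the Hessian is Lipschitz, the penalized function is then `3 ε₂`-almost convex
(`Admissible.quadraticBounds_proximal`), so that every call of the accelerated gradient method is
applied to a strongly convex function and converges linearly, and Almost-Convex-AGD terminates
(`acOut_mem_almostConvexAGD`). If its output has a gradient larger than `ε₁`, the penalty is active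
there, hence the output is at distance at least `ε₂ / L₂` from the start, and `f` has decreased by
`a` or by `b` (`Admissible.b2Out_spec`). Counting these decreases bounds the number of outer
iterations by `K` and that of NCG steps by `N` (`Admissible.exists_mem_fix_b2Body`). What remains is
to express `K`, `N` and the logarithms through `ε₁`, `ε₂` and `τ`.
-/

namespace NegCurv

open scoped RealInnerProductSpace

/-! ### The smallest eigenvalue of a symmetric operator -/

section LambdaMin

variable {E : Type*} [NormedAddCommGroup E] [InnerProductSpace ℝ E]

theorem inner_map_eq_sum {n : ℕ} {A : E →ₗ[ℝ] E} (e : OrthonormalBasis (Fin n) ℝ E) (l : Fin n → ℝ)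
    (hA : A.IsSymmetric) (he : ∀ i, A (e i) = l i • e i) (x : E) :
    ⟪x, A x⟫ = ∑ i, l i * ⟪e i, x⟫ ^ 2 := by
  rw [← e.sum_inner_mul_inner x (A x)]
  refine Finset.sum_congr rfl fun i _ => ?_
  rw [← hA (e i) x, he i, real_inner_smul_left, real_inner_comm x (e i)]
  ring

theorem norm_sq_eq_sum {n : ℕ} (e : OrthonormalBasis (Fin n) ℝ E) (x : E) :
    ‖x‖ ^ 2 = ∑ i, ⟪e i, x⟫ ^ 2 := by
  rw [← real_inner_self_eq_norm_sq, ← e.sum_inner_mul_inner x x]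
  refine Finset.sum_congr rfl fun i _ => ?_
  rw [real_inner_comm x (e i)]
  ring

/-- A symmetric operator has an orthonormal eigenbasis, and `lambdaMin` is the least of the
eigenvalues belonging to it. -/
theorem exists_eigenbasis [FiniteDimensional ℝ E] {A : E →ₗ[ℝ] E} (hA : A.IsSymmetric) {n : ℕ}
    (hn : Module.finrank ℝ E = n) (hpos : 0 < n) :
    ∃ (e : OrthonormalBasis (Fin n) ℝ E) (l : Fin n → ℝ) (i₀ : Fin n),
      (∀ i, A (e i) = l i • e i) ∧ l i₀ = lambdaMin A ∧ ∀ i, lambdaMin A ≤ l i := by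
  have : Nonempty (Fin n) := ⟨⟨0, hpos⟩⟩
  set e := hA.eigenvectorBasis hn
  set l := hA.eigenvalues hn
  have he : ∀ i, A (e i) = l i • e i := fun i => hA.apply_eigenvectorBasis hn i
  obtain ⟨i₀, hi₀⟩ := Finite.exists_min l
  have hleast : IsLeast {μ : ℝ | Module.End.HasEigenvalue A μ} (l i₀) := by
    refine ⟨hA.hasEigenvalue_eigenvalues hn i₀, fun μ hμ => ?_⟩
    obtain ⟨v, hv⟩ := hμ.exists_hasEigenvector
    have h0 : 0 < ‖v‖ ^ 2 := by have := norm_pos_iff.2 hv.2; positivity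
    have h1 : ⟪v, A v⟫ = μ * ‖v‖ ^ 2 := by
      rw [hv.apply_eq_smul, real_inner_smul_right, real_inner_self_eq_norm_sq]
    have h2 : l i₀ * ‖v‖ ^ 2 ≤ ⟪v, A v⟫ := by
      rw [inner_map_eq_sum e l hA he, norm_sq_eq_sum e, Finset.mul_sum]
      exact Finset.sum_le_sum fun i _ => mul_le_mul_of_nonneg_right (hi₀ i) (sq_nonneg _)
    rw [h1] at h2
    exact le_of_mul_le_mul_right h2 h0
  have h : lambdaMin A = l i₀ := hleast.csInf_eq
  exact ⟨e, l, i₀, he, h.symm, fun i => h ▸ hi₀ i⟩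

theorem lambdaMin_mul_norm_sq_le [FiniteDimensional ℝ E] {A : E →ₗ[ℝ] E} (hA : A.IsSymmetric)
    (x : E) : lambdaMin A * ‖x‖ ^ 2 ≤ ⟪x, A x⟫ := by
  rcases Nat.eq_zero_or_pos (Module.finrank ℝ E) with h | h
  · have : Subsingleton E := Module.finrank_zero_iff.1 h
    simp [Subsingleton.elim x 0]
  obtain ⟨e, l, i₀, he, -, hl⟩ := exists_eigenbasis hA rfl h
  rw [inner_map_eq_sum e l hA he, norm_sq_eq_sum e, Finset.mul_sum]
  exact Finset.sum_le_sum fun i _ => mul_le_mul_of_nonneg_right (hl i) (sq_nonneg _)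

theorem exists_unit_eigenvector_lambdaMin [FiniteDimensional ℝ E] [Nontrivial E] {A : E →ₗ[ℝ] E}
    (hA : A.IsSymmetric) : ∃ v, ‖v‖ = 1 ∧ A v = lambdaMin A • v := by
  obtain ⟨e, l, i₀, he, h0, -⟩ := exists_eigenbasis hA rfl Module.finrank_pos
  exact ⟨e i₀, e.norm_eq_one i₀, h0 ▸ he i₀⟩

theorem lambdaMin_le_of_inner [FiniteDimensional ℝ E] [Nontrivial E] {A B : E →ₗ[ℝ] E}
    (hA : A.IsSymmetric) (hB : B.IsSymmetric) {c : ℝ}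
    (h : ∀ v, ‖v‖ = 1 → ⟪v, A v⟫ ≤ ⟪v, B v⟫ + c) : lambdaMin A ≤ lambdaMin B + c := by
  obtain ⟨v, hv, hBv⟩ := exists_unit_eigenvector_lambdaMin hB
  have h1 := lambdaMin_mul_norm_sq_le hA v
  have h2 := h v hv
  rw [hBv, real_inner_smul_right, real_inner_self_eq_norm_sq] at h2
  rw [hv] at h1 h2
  linarith

end LambdaMin

/-! ### First- and second-order Taylor bounds -/

section Taylor

theorem sub_le_sub_of_deriv_le {φ φ' ψ ψ' : ℝ → ℝ} {T : ℝ} (hT : 0 ≤ T)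
    (hφ : ∀ t, HasDerivAt φ (φ' t) t)
    (hψ : ∀ t, HasDerivAt ψ (ψ' t) t) (h : ∀ t, 0 ≤ t → t ≤ T → φ' t ≤ ψ' t) :
    φ T - φ 0 ≤ ψ T - ψ 0 := by
  have hd : ∀ t, HasDerivAt (fun t => ψ t - φ t) (ψ' t - φ' t) t := fun t => (hψ t).sub (hφ t)
  have hm : MonotoneOn (fun t => ψ t - φ t) (Set.Icc 0 T) := by
    refine monotoneOn_of_deriv_nonneg (convex_Icc _ _)
      (fun t _ => (hd t).continuousAt.continuousWithinAt)
      (fun t _ => (hd t).differentiableAt.differentiableWithinAt) fun t ht => ?_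
    rw [interior_Icc] at ht
    rw [(hd t).deriv]
    exact sub_nonneg.2 (h t ht.1.le ht.2.le)
  have := hm (Set.left_mem_Icc.2 hT) (Set.right_mem_Icc.2 hT) hT
  simp only at this
  linarith

variable {E : Type*} [NormedAddCommGroup E] [InnerProductSpace ℝ E]

theorem hasDerivAt_line (x h : E) (t : ℝ) : HasDerivAt (fun t : ℝ => x + t • h) h t := by
  simpa using ((hasDerivAt_id t).smul_const h).const_add x

variable [CompleteSpace E]

theorem hasDerivAt_comp_line {f : E → ℝ} (hf : Differentiable ℝ f) (x h : E) (t : ℝ) :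
    HasDerivAt (fun t : ℝ => f (x + t • h)) ⟪gradient f (x + t • h), h⟫ t := by
  have h1 := (hf (x + t • h)).hasGradientAt.hasFDerivAt
  exact h1.comp_hasDerivAt t (hasDerivAt_line x h t)

/-- Integrating a one-sided bound for the gradient along a segment. -/
theorem sub_le_of_gradient_le {f : E → ℝ} (hf : Differentiable ℝ f) (x h : E) {c : ℝ}
    (hc : ∀ t : ℝ, 0 ≤ t → t ≤ 1 →
      ⟪gradient f (x + t • h), h⟫ ≤ ⟪gradient f x, h⟫ + c * t * ‖h‖ ^ 2) :
    f (x + h) ≤ f x + ⟪gradient f x, h⟫ + c / 2 * ‖h‖ ^ 2 := by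
  have key := sub_le_sub_of_deriv_le (T := 1) zero_le_one (hasDerivAt_comp_line hf x h)
    (ψ := fun t => t * ⟪gradient f x, h⟫ + c / 2 * ‖h‖ ^ 2 * t ^ 2)
    (ψ' := fun t => 1 * ⟪gradient f x, h⟫ + c / 2 * ‖h‖ ^ 2 * (2 * t))
    (fun t => ((hasDerivAt_id t).mul_const _).add
      (((hasDerivAt_pow 2 t).const_mul _).congr_deriv (by simp)))
    (fun t h0 h1 => by have := hc t h0 h1; linarith)
  simp [-inner_gradient_left] at key
  linarith

theorem le_sub_of_le_gradient {f : E → ℝ} (hf : Differentiable ℝ f) (x h : E) {c : ℝ}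
    (hc : ∀ t : ℝ, 0 ≤ t → t ≤ 1 →
      ⟪gradient f x, h⟫ + c * t * ‖h‖ ^ 2 ≤ ⟪gradient f (x + t • h), h⟫) :
    f x + ⟪gradient f x, h⟫ + c / 2 * ‖h‖ ^ 2 ≤ f (x + h) := by
  have key := sub_le_sub_of_deriv_le (T := 1) zero_le_one
    (φ := fun t => t * ⟪gradient f x, h⟫ + c / 2 * ‖h‖ ^ 2 * t ^ 2)
    (φ' := fun t => 1 * ⟪gradient f x, h⟫ + c / 2 * ‖h‖ ^ 2 * (2 * t))
    (fun t => ((hasDerivAt_id t).mul_const _).add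
      (((hasDerivAt_pow 2 t).const_mul _).congr_deriv (by simp)))
    (hasDerivAt_comp_line hf x h)
    (fun t h0 h1 => by have := hc t h0 h1; linarith)
  simp [-inner_gradient_left] at key
  linarith

/-- The descent lemma. -/
theorem le_of_gradient_lipschitz {f : E → ℝ} (hf : Differentiable ℝ f) {L : ℝ}
    (hL : ∀ x y, ‖gradient f x - gradient f y‖ ≤ L * ‖x - y‖) (x h : E) :
    f (x + h) ≤ f x + ⟪gradient f x, h⟫ + L / 2 * ‖h‖ ^ 2 := by
  refine sub_le_of_gradient_le hf x h fun t h0 _ => ?_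
  have h1 : ⟪gradient f (x + t • h) - gradient f x, h⟫ ≤ L * t * ‖h‖ ^ 2 := by
    refine (real_inner_le_norm _ _).trans ?_
    have := hL (x + t • h) x
    rw [add_sub_cancel_left, norm_smul, Real.norm_of_nonneg h0] at this
    nlinarith [norm_nonneg h]
  rw [inner_sub_left] at h1
  linarith

end Taylor

section Objective

variable {d : ℕ} {f : Vec d → ℝ} {x₀ : Vec d} {L₁ L₂ Δ : ℝ}

theorem hasFDerivAt_gradient (hf : Differentiable ℝ (gradient f)) (x : Vec d) :
    HasFDerivAt (gradient f) (hess f x) x := (hf x).hasFDerivAt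

theorem Admissible.hess_symm (h : Admissible f x₀ L₁ L₂ Δ) (x : Vec d) :
    (hess f x : Vec d →ₗ[ℝ] Vec d).IsSymmetric := by
  intro v w
  have h1 : ∀ y, HasFDerivAt f (innerSL ℝ (gradient f y)) y := fun y =>
    (h.differentiable y).hasGradientAt.hasFDerivAt
  have h2 : HasFDerivAt (fun y => innerSL ℝ (gradient f y))
      ((innerSL ℝ : Vec d →L[ℝ] Vec d →L[ℝ] ℝ).comp (hess f x)) x :=
    (innerSL ℝ : Vec d →L[ℝ] Vec d →L[ℝ] ℝ).hasFDerivAt.comp x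
      (hasFDerivAt_gradient h.differentiable_gradient x)
  have h3 := second_derivative_symmetric h1 h2 v w
  simp at h3
  simp only [ContinuousLinearMap.coe_coe]
  rw [h3, real_inner_comm]

theorem Admissible.norm_hess_le (h : Admissible f x₀ L₁ L₂ Δ) (hL : 0 ≤ L₁) (x : Vec d) :
    ‖hess f x‖ ≤ L₁ := by
  refine (hasFDerivAt_gradient h.differentiable_gradient x).le_of_lip' hL ?_
  exact Filter.Eventually.of_forall fun y => h.gradient_lipschitz y x

theorem abs_inner_clm_le (H : Vec d →L[ℝ] Vec d) (v : Vec d) : |⟪v, H v⟫| ≤ ‖H‖ * ‖v‖ ^ 2 := by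
  refine (abs_real_inner_le_norm _ _).trans ?_
  have := H.le_opNorm v
  nlinarith [norm_nonneg v]

theorem Admissible.hasDerivAt_gradient_line (h : Admissible f x₀ L₁ L₂ Δ) (x u w : Vec d) (t : ℝ) :
    HasDerivAt (fun t : ℝ => ⟪gradient f (x + t • u), w⟫) ⟪hess f (x + t • u) u, w⟫ t := by
  have h1 := (hasFDerivAt_gradient h.differentiable_gradient (x + t • u)).comp_hasDerivAt t
    (hasDerivAt_line x u t)
  simpa using h1.inner ℝ (hasDerivAt_const t w)

/-- The second-order Taylor bound with cubic remainder. -/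
theorem Admissible.cubic_bound (h : Admissible f x₀ L₁ L₂ Δ) (x u : Vec d) :
    f (x + u) ≤ f x + ⟪gradient f x, u⟫ + ⟪u, hess f x u⟫ / 2 + L₂ / 6 * ‖u‖ ^ 3 := by
  have h1 : ∀ T : ℝ, 0 ≤ T → ⟪gradient f (x + T • u), u⟫ ≤ ⟪gradient f x, u⟫ + T * ⟪u, hess f x u⟫
      + L₂ / 2 * ‖u‖ ^ 3 * T ^ 2 := by
    intro T hT
    have key := sub_le_sub_of_deriv_le hT (h.hasDerivAt_gradient_line x u u)
      (ψ := fun t => t * ⟪u, hess f x u⟫ + L₂ / 2 * ‖u‖ ^ 3 * t ^ 2)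
      (ψ' := fun t => 1 * ⟪u, hess f x u⟫ + L₂ / 2 * ‖u‖ ^ 3 * (2 * t))
      (fun t => ((hasDerivAt_id t).mul_const _).add
        (((hasDerivAt_pow 2 t).const_mul _).congr_deriv (by simp)))
      (fun t h0 _ => by
        have h2 := abs_inner_clm_le (hess f (x + t • u) - hess f x) u
        have h3 := h.hess_lipschitz (x + t • u) x
        rw [add_sub_cancel_left, norm_smul, Real.norm_of_nonneg h0] at h3
        have h4 := (le_abs_self _).trans h2
        rw [sub_apply, inner_sub_right] at h4
        rw [real_inner_comm]
        nlinarith [sq_nonneg ‖u‖])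
    simp [-inner_gradient_left] at key
    linarith
  have key := sub_le_sub_of_deriv_le (T := 1) zero_le_one (hasDerivAt_comp_line h.differentiable x u)
    (ψ := fun t => t * ⟪gradient f x, u⟫ + ⟪u, hess f x u⟫ / 2 * t ^ 2 + L₂ / 6 * ‖u‖ ^ 3 * t ^ 3)
    (ψ' := fun t => 1 * ⟪gradient f x, u⟫ + ⟪u, hess f x u⟫ / 2 * (2 * t)
      + L₂ / 6 * ‖u‖ ^ 3 * (3 * t ^ 2))
    (fun t => (((hasDerivAt_id t).mul_const _).add
      (((hasDerivAt_pow 2 t).const_mul _).congr_deriv (by simp))).add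
      (((hasDerivAt_pow 3 t).const_mul _).congr_deriv (by simp)))
    (fun t h0 _ => by have := h1 t h0; linarith)
  simp [-inner_gradient_left] at key
  linarith

/-- A step of length `2 |c| / L₂` along a unit vector of curvature `c < 0`, oriented against the
gradient, decreases `f` by at least `2 |c|³ / (3 L₂²)`. -/
theorem Admissible.negative_curvature_step (h : Admissible f x₀ L₁ L₂ Δ) (hL : 0 < L₂)
    (x v : Vec d) (hv : ‖v‖ = 1) (hc : ⟪v, hess f x v⟫ < 0) :
    f (x - (2 * |⟪v, hess f x v⟫| / L₂ * sgn (inner ℝ v (gradient f x))) • v)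
      ≤ f x - 2 * |⟪v, hess f x v⟫| ^ 3 / (3 * L₂ ^ 2) := by
  set c := ⟪v, hess f x v⟫ with hcdef
  set σ := sgn (inner ℝ v (gradient f x)) with hσ
  have h1 := h.cubic_bound x (-((2 * |c| / L₂ * σ) • v))
  have hσ2 : σ ^ 2 = 1 := by rw [hσ, sgn]; split_ifs <;> norm_num
  have hσa : |σ| = 1 := by rw [hσ, sgn]; split_ifs <;> norm_num
  have hσi : 0 ≤ σ * ⟪gradient f x, v⟫ := by
    rw [hσ, sgn, real_inner_comm v]
    split_ifs with h0 <;> linarith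
  have e1 : ⟪gradient f x, -((2 * |c| / L₂ * σ) • v)⟫
      = -(2 * |c| / L₂ * (σ * ⟪gradient f x, v⟫)) := by
    rw [inner_neg_right, real_inner_smul_right]; ring
  have e2 : ⟪-((2 * |c| / L₂ * σ) • v), hess f x (-((2 * |c| / L₂ * σ) • v))⟫
      = (2 * |c| / L₂) ^ 2 * c := by
    rw [map_neg, inner_neg_neg, map_smul, real_inner_smul_left, real_inner_smul_right, ← hcdef]
    linear_combination (2 * |c| / L₂) ^ 2 * c * hσ2
  have e3 : ‖-((2 * |c| / L₂ * σ) • v)‖ = 2 * |c| / L₂ := by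
    rw [norm_neg, norm_smul, hv, mul_one, Real.norm_eq_abs, abs_mul, hσa, mul_one]
    exact abs_of_nonneg (by positivity)
  rw [e1, e2, e3, ← sub_eq_add_neg] at h1
  have e4 : c = -|c| := by rw [abs_of_neg hc]; ring
  have e5 : 0 ≤ 2 * |c| / L₂ * (σ * ⟪gradient f x, v⟫) := by positivity
  have e6 : (2 * |c| / L₂) ^ 2 * c / 2 + L₂ / 6 * (2 * |c| / L₂) ^ 3
      = -(2 * |c| ^ 3 / (3 * L₂ ^ 2)) := by
    nth_rewrite 2 [e4]
    field_simp
    ring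
  linarith

theorem Admissible.gradient_step (h : Admissible f x₀ L₁ L₂ Δ) (hL : 0 < L₁) (x : Vec d) :
    f (x - (1 / L₁) • gradient f x) ≤ f x - ‖gradient f x‖ ^ 2 / (2 * L₁) := by
  have h1 := le_of_gradient_lipschitz h.differentiable h.gradient_lipschitz x
    (-((1 / L₁) • gradient f x))
  rw [inner_neg_right, real_inner_smul_right, real_inner_self_eq_norm_sq, norm_neg, norm_smul,
    Real.norm_of_nonneg (by positivity), ← sub_eq_add_neg] at h1
  refine h1.trans (le_of_eq ?_)
  field_simp
  ring

theorem Admissible.norm_gradient_sq_le (h : Admissible f x₀ L₁ L₂ Δ) (hL : 0 < L₁) (x : Vec d)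
    (hx : f x ≤ f x₀) : ‖gradient f x‖ ^ 2 ≤ 2 * L₁ * Δ := by
  have h1 := h.gradient_step hL x
  have h2 := h.gap (x - (1 / L₁) • gradient f x)
  have h3 : ‖gradient f x‖ ^ 2 / (2 * L₁) ≤ Δ := by linarith
  rw [div_le_iff₀ (by positivity)] at h3
  linarith

theorem Admissible.lambdaMin_hess_lipschitz (h : Admissible f x₀ L₁ L₂ Δ) (hd : 0 < d)
    (x y : Vec d) :
    lambdaMin (hess f x : Module.End ℝ (Vec d))
      ≤ lambdaMin (hess f y : Module.End ℝ (Vec d)) + L₂ * ‖x - y‖ := by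
  have : Nonempty (Fin d) := ⟨⟨0, hd⟩⟩
  refine lambdaMin_le_of_inner (h.hess_symm x) (h.hess_symm y) fun v hv => ?_
  have h2 := (le_abs_self _).trans (abs_inner_clm_le (hess f x - hess f y) v)
  rw [hv, sub_apply, inner_sub_right] at h2
  have := h.hess_lipschitz x y
  simp only [ContinuousLinearMap.coe_coe]
  linarith

end Objective

/-! ### The Lanczos vectors -/

section LanczosVectors

variable {d : ℕ} (H : Vec d →L[ℝ] Vec d) (b : Vec d)

/-- The Lanczos vector preceding the `j`-th one (`0` for `j = 0`). -/
noncomputable def lanczosPrev (j : ℕ) : Vec d := (lanczosState H b j).1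

@[simp] theorem lanczosQ_zero : lanczosQ H b 0 = b := rfl
@[simp] theorem lanczosPrev_zero : lanczosPrev H b 0 = 0 := rfl
@[simp] theorem lanczosPrev_succ (j : ℕ) : lanczosPrev H b (j + 1) = lanczosQ H b j := rfl
@[simp] theorem lanczosBeta_zero : lanczosBeta H b 0 = 0 := rfl

/-- The three-term recurrence, valid through and after a breakdown. -/
theorem map_lanczosQ (j : ℕ) : H (lanczosQ H b j) = lanczosBeta H b (j + 1) • lanczosQ H b (j + 1)
    + lanczosAlpha H b j • lanczosQ H b j + lanczosBeta H b j • lanczosPrev H b j := by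
  set w := H (lanczosQ H b j) - lanczosAlpha H b j • lanczosQ H b j
    - lanczosBeta H b j • lanczosPrev H b j with hw
  have h1 : lanczosBeta H b (j + 1) = ‖w‖ := rfl
  have h2 : lanczosQ H b (j + 1) = ‖w‖⁻¹ • w := rfl
  have h3 : lanczosBeta H b (j + 1) • lanczosQ H b (j + 1) = w := by
    rw [h1, h2]
    rcases eq_or_ne w 0 with h0 | h0
    · simp [h0]
    · rw [smul_smul, mul_inv_cancel₀ (norm_ne_zero_iff.2 h0), one_smul]
  rw [h3, hw]
  abel

theorem lanczosQ_succ_eq_zero_iff (j : ℕ) :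
    lanczosQ H b (j + 1) = 0 ↔ lanczosBeta H b (j + 1) = 0 := by
  set w := H (lanczosQ H b j) - lanczosAlpha H b j • lanczosQ H b j
    - lanczosBeta H b j • lanczosPrev H b j with hw
  have h1 : lanczosBeta H b (j + 1) = ‖w‖ := rfl
  have h2 : lanczosQ H b (j + 1) = ‖w‖⁻¹ • w := rfl
  rw [h1, h2]
  simp

variable {H b}

theorem norm_lanczosQ (hb : ‖b‖ = 1) {j : ℕ} (hj : lanczosQ H b j ≠ 0) : ‖lanczosQ H b j‖ = 1 := by
  cases j with
  | zero => simpa using hb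
  | succ j =>
    set w := H (lanczosQ H b j) - lanczosAlpha H b j • lanczosQ H b j
      - lanczosBeta H b j • lanczosPrev H b j with hw
    have h2 : lanczosQ H b (j + 1) = ‖w‖⁻¹ • w := rfl
    rw [h2] at hj ⊢
    have : w ≠ 0 := fun h => hj (by simp [h])
    rw [norm_smul, norm_inv, norm_norm, inv_mul_cancel₀ (norm_ne_zero_iff.2 this)]

theorem lanczosQ_succ_eq_zero (hb : ‖b‖ = 1) {j : ℕ} (hj : lanczosQ H b j = 0) :
    lanczosQ H b (j + 1) = 0 := by
  cases j with
  | zero =>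
    rw [lanczosQ_zero] at hj
    simp [hj] at hb
  | succ j =>
    have h := map_lanczosQ H b (j + 1)
    rw [hj, (lanczosQ_succ_eq_zero_iff H b j).1 hj] at h
    simp only [map_zero, smul_zero, add_zero, zero_smul] at h
    rcases smul_eq_zero.1 h.symm with h1 | h1
    · exact (lanczosQ_succ_eq_zero_iff H b (j + 1)).2 h1
    · exact h1

theorem lanczosQ_ne_zero_of_le (hb : ‖b‖ = 1) {i j : ℕ} (hij : i ≤ j) (hj : lanczosQ H b j ≠ 0) :
    lanczosQ H b i ≠ 0 := by
  induction j, hij using Nat.le_induction with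
  | base => exact hj
  | succ j _ ih => exact ih fun h => hj (lanczosQ_succ_eq_zero hb h)

theorem lanczosQ_orthogonal (hH : (H : Vec d →ₗ[ℝ] Vec d).IsSymmetric) (hb : ‖b‖ = 1) {i j : ℕ}
    (hij : i < j) : ⟪lanczosQ H b i, lanczosQ H b j⟫ = 0 := by
  -- Orthogonality to all earlier vectors, by strong induction on the later index.
  have key : ∀ n, ∀ i < n, ⟪lanczosQ H b i, lanczosQ H b n⟫ = 0 := by
    intro n
    induction n using Nat.strong_induction_on with
    | _ n ih =>
    rcases n with _ | n
    · intro i hi; omega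
    have horth : ∀ i ≤ n, ∀ j ≤ n, i ≠ j → ⟪lanczosQ H b i, lanczosQ H b j⟫ = 0 := by
      intro i hi j hj hne
      rcases lt_or_gt_of_ne hne with h | h
      · exact ih j (by omega) i h
      · rw [real_inner_comm]; exact ih i (by omega) j h
    intro i hi
    rcases eq_or_ne (lanczosQ H b (n + 1)) 0 with h0 | h0
    · simp [h0]
    have hβ : lanczosBeta H b (n + 1) ≠ 0 := fun h =>
      h0 ((lanczosQ_succ_eq_zero_iff H b n).2 h)
    have hn : ∀ j ≤ n, ⟪lanczosQ H b j, lanczosQ H b j⟫ = 1 := fun j hj => by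
      rw [real_inner_self_eq_norm_sq,
        norm_lanczosQ hb (lanczosQ_ne_zero_of_le hb (by omega : j ≤ n + 1) h0), one_pow]
    have hrec := congrArg (fun u => ⟪lanczosQ H b i, u⟫) (map_lanczosQ H b n)
    simp only [inner_add_right, real_inner_smul_right] at hrec
    suffices h : ⟪lanczosQ H b i, H (lanczosQ H b n)⟫
        = lanczosAlpha H b n * ⟪lanczosQ H b i, lanczosQ H b n⟫
          + lanczosBeta H b n * ⟪lanczosQ H b i, lanczosPrev H b n⟫ by
      rw [h] at hrec
      have : lanczosBeta H b (n + 1) * ⟪lanczosQ H b i, lanczosQ H b (n + 1)⟫ = 0 := by linarith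
      exact (mul_eq_zero.1 this).resolve_left hβ
    rcases Nat.lt_or_ge i n with hin | hin
    · obtain ⟨n, rfl⟩ : ∃ n', n = n' + 1 := ⟨n - 1, by omega⟩
      have hsym : ⟪lanczosQ H b i, H (lanczosQ H b (n + 1))⟫
          = ⟪H (lanczosQ H b i), lanczosQ H b (n + 1)⟫ :=
        (hH (lanczosQ H b i) (lanczosQ H b (n + 1))).symm
      have hprev : ⟪lanczosPrev H b i, lanczosQ H b (n + 1)⟫ = 0 := by
        rcases i with _ | i
        · simp
        · exact horth i (by omega) (n + 1) le_rfl (by omega)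
      rw [hsym, map_lanczosQ H b i, inner_add_left, inner_add_left, real_inner_smul_left,
        real_inner_smul_left, real_inner_smul_left, hprev,
        horth i (by omega) (n + 1) le_rfl (by omega), lanczosPrev_succ]
      rcases eq_or_ne i n with rfl | hne
      · rw [hn i (by omega), hn (i + 1) (by omega)]; ring
      · rw [horth (i + 1) (by omega) (n + 1) le_rfl (by omega), horth i (by omega) n (by omega) hne]
        ring
    · obtain rfl : i = n := by omega
      have hprev : ⟪lanczosQ H b i, lanczosPrev H b i⟫ = 0 := by
        rcases i with _ | i
        · simp
        · exact horth (i + 1) le_rfl i (by omega) (by omega)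
      rw [hprev, hn i le_rfl, lanczosAlpha]
      ring
  exact key j i hij

theorem lanczosQ_ne_zero_iff (hb : ‖b‖ = 1) {k j : ℕ} (hj : j < k) :
    lanczosQ H b j ≠ 0 ↔ j < lanczosDim H b k := by
  obtain ⟨m, hm⟩ : ∃ m, ∀ j < k, lanczosQ H b j ≠ 0 ↔ j < m := by
    by_cases h : ∃ j, lanczosQ H b j = 0
    · classical
      refine ⟨Nat.find h, fun j _ => ⟨fun h1 => ?_, fun h1 => Nat.find_min h h1⟩⟩
      by_contra h2
      exact lanczosQ_ne_zero_of_le hb (not_lt.1 h2) h1 (Nat.find_spec h)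
    · push Not at h
      exact ⟨k, fun j hj => ⟨fun _ => hj, fun _ => h j⟩⟩
  have : lanczosDim H b k = min m k := by
    rw [lanczosDim, ← Finset.card_range (min m k)]
    congr 1
    ext i
    simp only [Finset.mem_filter, Finset.mem_range, norm_pos_iff]
    constructor
    · rintro ⟨h1, h2⟩; exact lt_min ((hm i h1).1 h2) h1
    · intro h; exact ⟨(lt_min_iff.1 h).2, (hm i (lt_min_iff.1 h).2).2 (lt_min_iff.1 h).1⟩
  rw [hm j hj, this]
  omega

theorem lanczosDim_le (k : ℕ) : lanczosDim H b k ≤ k := by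
  rw [lanczosDim]
  exact (Finset.card_filter_le _ _).trans (Finset.card_range k).le

theorem lanczosDim_pos (hb : ‖b‖ = 1) {k : ℕ} (hk : 0 < k) : 0 < lanczosDim H b k := by
  rw [← lanczosQ_ne_zero_iff (H := H) hb hk, lanczosQ_zero]
  intro h
  simp [h] at hb

theorem lanczosQ_ne_zero_of_lt (hb : ‖b‖ = 1) {k j : ℕ} (hj : j < lanczosDim H b k) :
    lanczosQ H b j ≠ 0 :=
  (lanczosQ_ne_zero_iff hb (hj.trans_le (lanczosDim_le k))).2 hj

theorem lanczosQ_orthonormal (hH : (H : Vec d →ₗ[ℝ] Vec d).IsSymmetric) (hb : ‖b‖ = 1) (k : ℕ) :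
    Orthonormal ℝ fun j : Fin (lanczosDim H b k) => lanczosQ H b j := by
  refine ⟨fun j => norm_lanczosQ hb (lanczosQ_ne_zero_of_lt hb j.2), fun i j hij => ?_⟩
  rcases lt_or_gt_of_ne (fun h => hij (Fin.ext h) : (i : ℕ) ≠ j) with h | h
  · exact lanczosQ_orthogonal hH hb h
  · simp only
    rw [real_inner_comm]; exact lanczosQ_orthogonal hH hb h

/-- The tridiagonal matrix represents `H` on the span of the Lanczos vectors. -/
theorem lanczosT_apply (hH : (H : Vec d →ₗ[ℝ] Vec d).IsSymmetric) (hb : ‖b‖ = 1) {k : ℕ}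
    (i j : Fin (lanczosDim H b k)) :
    lanczosT H b (lanczosDim H b k) i j = ⟪lanczosQ H b i, H (lanczosQ H b j)⟫ := by
  have horth : ∀ i j : ℕ, i ≠ j → ⟪lanczosQ H b i, lanczosQ H b j⟫ = 0 := by
    intro i j hne
    rcases lt_or_gt_of_ne hne with h | h
    · exact lanczosQ_orthogonal hH hb h
    · rw [real_inner_comm]; exact lanczosQ_orthogonal hH hb h
  have hn : ∀ j : Fin (lanczosDim H b k), ⟪lanczosQ H b j, lanczosQ H b j⟫ = 1 := fun j => by
    rw [real_inner_self_eq_norm_sq, norm_lanczosQ hb (lanczosQ_ne_zero_of_lt hb j.2), one_pow]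
  have hprev : ⟪lanczosQ H b i, lanczosPrev H b j⟫ = if (i : ℕ) + 1 = j then 1 else 0 := by
    rcases hj : (j : ℕ) with _ | j'
    · simp
    · rw [lanczosPrev_succ]
      split_ifs with h
      · rw [← hn i, show j' = i by omega]
      · exact horth _ _ (by omega)
  rw [map_lanczosQ, inner_add_right, inner_add_right, real_inner_smul_right, real_inner_smul_right,
    real_inner_smul_right, hprev, lanczosT, Matrix.of_apply]
  by_cases h1 : i = j
  · subst h1
    rw [horth i (i + 1) (by omega), hn]
    simp
  have h1' : (i : ℕ) ≠ j := fun h => h1 (Fin.ext h)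
  rw [if_neg h1, horth i j h1']
  by_cases h2 : (i : ℕ) + 1 = j
  · rw [horth i (j + 1) (by omega)]; simp [h2]
  by_cases h3 : (j : ℕ) + 1 = i
  · have := hn i
    rw [if_neg h2, if_pos h3, if_neg h2, h3, this]
    ring
  · rw [if_neg h2, if_neg h3, if_neg h2, horth i (j + 1) (by omega)]
    ring

end LanczosVectors

/-! ### The Ritz vector minimizes the Rayleigh quotient over the Krylov space -/

section Ritz

variable {d : ℕ} {H : Vec d →L[ℝ] Vec d} {b : Vec d}

theorem lambdaMin_toLin' {m : ℕ} (T : Matrix (Fin m) (Fin m) ℝ) :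
    lambdaMin (Matrix.toLin' T) = lambdaMin (Matrix.toEuclideanLin T) := by
  have key : ∀ μ, Module.End.HasEigenvalue (Matrix.toLin' T) μ
      ↔ Module.End.HasEigenvalue (Matrix.toEuclideanLin T) μ := by
    intro μ
    constructor
    · intro h
      obtain ⟨v, hv, h0⟩ := h.exists_hasEigenvector
      refine Module.End.hasEigenvalue_of_hasEigenvector (x := WithLp.toLp 2 v) ⟨?_, ?_⟩
      · rw [Module.End.mem_eigenspace_iff] at hv ⊢
        rw [Matrix.toLin'_apply] at hv
        rw [Matrix.toLpLin_apply, hv]; rfl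
      · simpa using h0
    · intro h
      obtain ⟨v, hv, h0⟩ := h.exists_hasEigenvector
      refine Module.End.hasEigenvalue_of_hasEigenvector (x := WithLp.ofLp v) ⟨?_, ?_⟩
      · rw [Module.End.mem_eigenspace_iff] at hv ⊢
        rw [Matrix.toLin'_apply]
        rw [Matrix.toLpLin_apply] at hv
        exact congrArg WithLp.ofLp hv
      · simpa using h0
  simp only [lambdaMin, key]

theorem lanczosT_isHermitian (H : Vec d →L[ℝ] Vec d) (b : Vec d) (m : ℕ) :
    (lanczosT H b m).IsHermitian := by
  ext i j
  simp only [Matrix.conjTranspose_apply, lanczosT, Matrix.of_apply, star_trivial]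
  by_cases h1 : i = j
  · subst h1; rfl
  have h1' : (i : ℕ) ≠ j := fun h => h1 (Fin.ext h)
  rw [if_neg h1, if_neg (Ne.symm h1)]
  by_cases h2 : (i : ℕ) + 1 = j
  · rw [if_pos h2, if_neg (by omega), if_pos h2]
  · by_cases h3 : (j : ℕ) + 1 = i
    · rw [if_pos h3, if_neg h2, if_pos h3]
    · rw [if_neg h3, if_neg h2, if_neg h3, if_neg h2]

/-- The Krylov space after `k` iterations: the span of the first `k` Lanczos vectors. -/
def krylov (H : Vec d →L[ℝ] Vec d) (b : Vec d) (k : ℕ) : Submodule ℝ (Vec d) :=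
  Submodule.span ℝ (lanczosQ H b '' Set.Iio k)

theorem krylov_mono {i j : ℕ} (h : i ≤ j) : krylov H b i ≤ krylov H b j :=
  Submodule.span_mono (Set.image_mono (Set.Iio_subset_Iio h))

theorem self_mem_krylov : b ∈ krylov H b 1 :=
  Submodule.subset_span ⟨0, by simp, by simp⟩

theorem map_mem_krylov {k : ℕ} {u : Vec d} (hu : u ∈ krylov H b k) : H u ∈ krylov H b (k + 1) := by
  have hq : ∀ j < k + 1, lanczosQ H b j ∈ krylov H b (k + 1) := fun j hj =>
    Submodule.subset_span ⟨j, hj, rfl⟩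
  induction hu using Submodule.span_induction with
  | mem x hx =>
    obtain ⟨j, hj, rfl⟩ := hx
    have hj : j < k := hj
    rw [map_lanczosQ]
    refine add_mem (add_mem (Submodule.smul_mem _ _ (hq _ (by omega)))
      (Submodule.smul_mem _ _ (hq _ (by omega)))) (Submodule.smul_mem _ _ ?_)
    rcases j with _ | j
    · simp
    · exact hq j (by omega)
  | zero => simp
  | add x y _ _ hx hy => rw [map_add]; exact add_mem hx hy
  | smul c x _ hx => rw [map_smul]; exact Submodule.smul_mem _ _ hx

theorem exists_coeff_of_mem_krylov (hb : ‖b‖ = 1) {k : ℕ} {u : Vec d} (hu : u ∈ krylov H b k) :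
    ∃ c : Fin (lanczosDim H b k) → ℝ, ∑ j, c j • lanczosQ H b j = u := by
  have h : krylov H b k
      ≤ Submodule.span ℝ (Set.range fun j : Fin (lanczosDim H b k) => lanczosQ H b j) := by
    refine Submodule.span_le.2 ?_
    rintro _ ⟨j, hj, rfl⟩
    by_cases h0 : lanczosQ H b j = 0
    · rw [h0]; exact zero_mem _
    · exact Submodule.subset_span ⟨⟨j, (lanczosQ_ne_zero_iff hb hj).1 h0⟩, rfl⟩
  exact (Submodule.mem_span_range_iff_exists_fun ℝ).1 (h hu)

theorem norm_sq_lanczos_sum (hH : (H : Vec d →ₗ[ℝ] Vec d).IsSymmetric) (hb : ‖b‖ = 1) {k : ℕ}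
    (x : EuclideanSpace ℝ (Fin (lanczosDim H b k))) :
    ‖∑ j, x j • lanczosQ H b j‖ ^ 2 = ‖x‖ ^ 2 := by
  rw [← real_inner_self_eq_norm_sq, (lanczosQ_orthonormal hH hb k).inner_sum,
    EuclideanSpace.real_norm_sq_eq]
  simp [sq]

theorem inner_map_lanczos_sum (hH : (H : Vec d →ₗ[ℝ] Vec d).IsSymmetric) (hb : ‖b‖ = 1) {k : ℕ}
    (x : EuclideanSpace ℝ (Fin (lanczosDim H b k))) :
    ⟪∑ j, x j • lanczosQ H b j, H (∑ j, x j • lanczosQ H b j)⟫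
      = ⟪x, Matrix.toEuclideanLin (lanczosT H b (lanczosDim H b k)) x⟫ := by
  rw [map_sum, sum_inner, PiLp.inner_apply]
  refine Finset.sum_congr rfl fun i _ => ?_
  rw [inner_sum, Matrix.toLpLin_apply]
  simp only [Matrix.mulVec, dotProduct, map_smul, real_inner_smul_left, real_inner_smul_right,
    lanczosT_apply hH hb, RCLike.inner_apply, conj_trivial]
  rw [Finset.sum_mul]
  exact Finset.sum_congr rfl fun j _ => by ring

/-- The vector built by forward substitution is an eigenvector of the tridiagonal matrix, so that
the output of the Lanczos method is a unit vector whose curvature is the smallest Ritz value, the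
minimum of the Rayleigh quotient over the Krylov space. -/
theorem lanczos_spec (hH : (H : Vec d →ₗ[ℝ] Vec d).IsSymmetric) (hb : ‖b‖ = 1) {k : ℕ}
    (hk : 0 < k) : ‖lanczos H b k‖ = 1 ∧
      ∀ u ∈ krylov H b k, ⟪lanczos H b k, H (lanczos H b k)⟫ * ‖u‖ ^ 2 ≤ ⟪u, H u⟫ := by
  have hm : 0 < lanczosDim H b k := lanczosDim_pos hb hk
  have : Nonempty (Fin (lanczosDim H b k)) := ⟨⟨0, hm⟩⟩
  set T := Matrix.toEuclideanLin (lanczosT H b (lanczosDim H b k)) with hT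
  have hTs : T.IsSymmetric := Matrix.isSymmetric_toEuclideanLin_iff.2 (lanczosT_isHermitian H b _)
  have hθ : ritzValue H b k = lambdaMin T := by rw [ritzValue, lambdaMin_toLin']
  obtain ⟨x, hx1, hx⟩ := exists_unit_eigenvector_lambdaMin hTs
  rw [← hθ] at hx
  set θ := ritzValue H b k with hθd
  set u := ∑ j, x j • lanczosQ H b j with hu
  have hun : ‖u‖ ^ 2 = 1 := by rw [hu, norm_sq_lanczos_sum hH hb, hx1, one_pow]
  have hX : ∀ j : Fin (lanczosDim H b k), ⟪lanczosQ H b j, u⟫ = x j := fun j =>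
    (lanczosQ_orthonormal hH hb k).inner_right_fintype x j
  -- The eigenvalue equation, row by row.
  have hrow : ∀ j < lanczosDim H b k, ⟪lanczosQ H b j, H u⟫ = θ * ⟪lanczosQ H b j, u⟫ := by
    intro j hj
    have h1 : (T x) ⟨j, hj⟩ = θ * x ⟨j, hj⟩ := by rw [hx]; rfl
    rw [hX ⟨j, hj⟩, ← h1, hu, map_sum, inner_sum, hT, Matrix.toLpLin_apply]
    simp only [Matrix.mulVec, dotProduct, map_smul, real_inner_smul_right, lanczosT_apply hH hb]
    exact Finset.sum_congr rfl fun j _ => by ring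
  have hrec : ∀ j < lanczosDim H b k, lanczosBeta H b (j + 1) * ⟪lanczosQ H b (j + 1), u⟫
      = (θ - lanczosAlpha H b j) * ⟪lanczosQ H b j, u⟫
        - lanczosBeta H b j * ⟪lanczosPrev H b j, u⟫ := by
    intro j hj
    have h1 := hrow j hj
    have h2 : ⟪lanczosQ H b j, H u⟫ = ⟪H (lanczosQ H b j), u⟫ := (hH (lanczosQ H b j) u).symm
    rw [h2, map_lanczosQ, inner_add_left, inner_add_left, real_inner_smul_left,
      real_inner_smul_left, real_inner_smul_left] at h1
    linarith
  have hβ : ∀ j, j + 1 < lanczosDim H b k → lanczosBeta H b (j + 1) ≠ 0 := fun j hj h =>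
    lanczosQ_ne_zero_of_lt hb hj ((lanczosQ_succ_eq_zero_iff H b j).2 h)
  have hcoeff : ∀ j < lanczosDim H b k,
      ⟪lanczosQ H b j, u⟫ = ⟪lanczosQ H b 0, u⟫ * ritzCoeff H b θ j := by
    intro j
    induction j using Nat.strong_induction_on with
    | _ j ih =>
    intro hj
    match j, ih, hj with
    | 0, _, _ => simp [ritzCoeff]
    | 1, ih, hj =>
      have h1 := hrec 0 hm
      have h2 := hβ 0 hj
      rw [ritzCoeff]
      field_simp
      simp only [zero_add, lanczosBeta_zero, zero_mul, sub_zero] at h1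
      linarith
    | j + 2, ih, hj =>
      have h1 := hrec (j + 1) (by omega)
      have h2 := hβ (j + 1) hj
      rw [lanczosPrev_succ, ih j (by omega) (by omega), ih (j + 1) (by omega) (by omega)] at h1
      rw [ritzCoeff]
      field_simp
      linear_combination h1
  set y := ∑ j ∈ Finset.range (lanczosDim H b k), ritzCoeff H b θ j • lanczosQ H b j with hy
  set s := ⟪lanczosQ H b 0, u⟫ with hs
  have huy : u = s • y := by
    rw [hu, hy, Finset.smul_sum, ← Fin.sum_univ_eq_sum_range
      (fun j => s • ritzCoeff H b θ j • lanczosQ H b j)]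
    refine Finset.sum_congr rfl fun j _ => ?_
    rw [smul_smul, ← hcoeff j j.2, hX]
  have hs0 : s ≠ 0 := by rintro h; simp [huy, h] at hun
  have hy0 : ‖y‖ ≠ 0 := by
    intro h; rw [huy, norm_smul, h] at hun; simp at hun
  have hv : lanczos H b k = ‖y‖⁻¹ • y := rfl
  have hv1 : ‖lanczos H b k‖ = 1 := by
    rw [hv, norm_smul, norm_inv, norm_norm, inv_mul_cancel₀ hy0]
  have huu : ⟪u, H u⟫ = θ := by
    rw [hu, inner_map_lanczos_sum hH hb, ← hT, hx, real_inner_smul_right,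
      real_inner_self_eq_norm_sq, hx1]
    ring
  have hvv : ⟪lanczos H b k, H (lanczos H b k)⟫ = θ := by
    have h1 : ⟪u, H u⟫ = s ^ 2 * ⟪y, H y⟫ := by
      rw [huy, map_smul, real_inner_smul_left, real_inner_smul_right]; ring
    have h2 : s ^ 2 * ‖y‖ ^ 2 = 1 := by
      rw [← hun, huy, norm_smul, mul_pow, Real.norm_eq_abs, sq_abs]
    rw [hv, map_smul, real_inner_smul_left, real_inner_smul_right, ← huu, h1]
    field_simp
    linear_combination (-⟪y, H y⟫) * h2
  refine ⟨hv1, fun w hw => ?_⟩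
  obtain ⟨c, rfl⟩ := exists_coeff_of_mem_krylov hb hw
  have h1 := norm_sq_lanczos_sum hH hb (WithLp.toLp 2 c)
  have h2 := inner_map_lanczos_sum hH hb (WithLp.toLp 2 c)
  simp only at h1 h2
  rw [hvv, h1, h2, hθ]
  exact lambdaMin_mul_norm_sq_le hTs _

end Ritz

/-! ### The measure of a band around the equator of the sphere -/

section Cap

open scoped Pointwise

theorem inv_three_le_one_sub_inv_pow {d : ℕ} (hd : 0 < d) :
    (1 / 3 : ℝ) ≤ (1 - 1 / (d : ℝ)) ^ (d - 1) := by
  rcases Nat.lt_or_ge d 2 with h | h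
  · obtain rfl : d = 1 := by omega
    norm_num
  obtain ⟨n, rfl⟩ : ∃ n, d = n + 1 := ⟨d - 1, by omega⟩
  have hn : 0 < (n : ℝ) := by exact_mod_cast (by omega : 0 < n)
  have h1 : (1 + 1 / (n : ℝ)) ^ n ≤ 3 := by
    have h2 : 1 + 1 / (n : ℝ) ≤ Real.exp (1 / n) := by
      rw [add_comm]; exact Real.add_one_le_exp _
    calc (1 + 1 / (n : ℝ)) ^ n ≤ Real.exp (1 / n) ^ n := by gcongr
      _ = Real.exp 1 := by
        rw [← Real.exp_nat_mul]; congr 1; field_simp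
      _ ≤ 3 := by have := Real.exp_one_lt_d9; linarith
  have h3 : (1 - 1 / ((n + 1 : ℕ) : ℝ)) = (1 + 1 / (n : ℝ))⁻¹ := by
    push_cast
    field_simp
    ring
  rw [h3, inv_pow, Nat.add_sub_cancel, one_div]
  exact inv_anti₀ (by positivity) h1

/-- The uniform measure of the band `|⟨v, b⟩| ≤ t` of the sphere is at most `√(3 d) t`. The cone
over the band is mapped into the unit ball by the linear map that stretches `v` by `1 / (√d t)`
and shrinks its orthogonal complement by `√(1 - 1/d)`, whose determinant is at least
`1 / (√(3 d) t)`. -/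
theorem uniformSphere_band_le {d : ℕ} (hd : 0 < d) (e : OrthonormalBasis (Fin d) ℝ (Vec d))
    (i₀ : Fin d) {t : ℝ} (ht : 0 < t) :
    uniformSphere d {b | |⟪e i₀, (b : Vec d)⟫| ≤ t} ≤ ENNReal.ofReal (√(3 * d) * t) := by
  have : Nonempty (Fin d) := ⟨i₀⟩
  have hd0 : 0 < (d : ℝ) := by exact_mod_cast hd
  set a := √(1 - 1 / (d : ℝ)) with ha
  set β := 1 / (√d * t) with hβ
  have hβ0 : 0 < β := by positivity
  have hone : 0 ≤ 1 - 1 / (d : ℝ) := by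
    rw [sub_nonneg, div_le_one hd0]; exact_mod_cast hd
  have ha2 : a ^ 2 = 1 - 1 / (d : ℝ) := Real.sq_sqrt hone
  have hapow : 1 / √3 ≤ a ^ (d - 1) := by
    refine (pow_le_pow_iff_left₀ (by positivity) (by positivity) two_ne_zero).1 ?_
    rw [← pow_mul, mul_comm, pow_mul, ha2, div_pow, Real.sq_sqrt (by norm_num), one_pow]
    exact inv_three_le_one_sub_inv_pow hd
  set w : Fin d → ℝ := fun i => if i = i₀ then β else a with hw
  set D := Matrix.toLin e.toBasis e.toBasis (Matrix.diagonal w) with hD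
  have hdet : LinearMap.det D = β * a ^ (d - 1) := by
    rw [hD, LinearMap.det_toLin, Matrix.det_diagonal, ← Finset.mul_prod_erase _ _ (Finset.mem_univ i₀)]
    congr 1
    · simp [hw]
    · rw [Finset.prod_congr rfl (g := fun _ => a) fun i hi => by
        simp [hw, (Finset.mem_erase.1 hi).1]]
      simp
  have hdetpos : 0 < LinearMap.det D := by
    rw [hdet]; exact mul_pos hβ0 (lt_of_lt_of_le (by positivity) hapow)
  have hDe : ∀ i, D (e i) = w i • e i := by
    intro i
    have := Matrix.toLin_self e.toBasis e.toBasis (Matrix.diagonal w) i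
    simp only [OrthonormalBasis.coe_toBasis, Matrix.diagonal_apply, ite_smul, zero_smul] at this
    rw [hD, this, Finset.sum_eq_single i]
    · simp
    · intro j _ hj; simp [hj]
    · simp
  have hDsymm : ∀ i x, ⟪e i, D x⟫ = w i * ⟪e i, x⟫ := by
    intro i x
    conv_lhs => rw [← e.sum_repr' x]
    rw [map_sum, inner_sum]
    rw [Finset.sum_eq_single i]
    · rw [map_smul, hDe, real_inner_smul_right, real_inner_smul_right, real_inner_self_eq_norm_sq,
        e.norm_eq_one]
      ring
    · intro j _ hj
      rw [map_smul, hDe, real_inner_smul_right, real_inner_smul_right,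
        e.orthonormal.inner_eq_zero hj.symm]
      ring
    · simp
  set A : Set (Vec d) := {x | ‖x‖ ≤ 1 ∧ |⟪e i₀, x⟫| ≤ t} with hA
  have hAsub : A ⊆ D ⁻¹' Metric.closedBall 0 1 := by
    rintro x ⟨hx1, hxt⟩
    rw [Set.mem_preimage, mem_closedBall_zero_iff]
    refine (pow_le_pow_iff_left₀ (norm_nonneg _) zero_le_one two_ne_zero).1 ?_
    have h1 : ‖D x‖ ^ 2 = (β ^ 2 - a ^ 2) * ⟪e i₀, x⟫ ^ 2 + a ^ 2 * ‖x‖ ^ 2 := by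
      rw [norm_sq_eq_sum e (D x), norm_sq_eq_sum e x, ← Finset.add_sum_erase _ _ (Finset.mem_univ i₀),
        ← Finset.add_sum_erase _ (fun i => ⟪e i, x⟫ ^ 2) (Finset.mem_univ i₀), hDsymm]
      have : ∑ i ∈ Finset.univ.erase i₀, ⟪e i, D x⟫ ^ 2
          = a ^ 2 * ∑ i ∈ Finset.univ.erase i₀, ⟪e i, x⟫ ^ 2 := by
        rw [Finset.mul_sum]
        refine Finset.sum_congr rfl fun i hi => ?_
        rw [hDsymm]; simp [hw, (Finset.mem_erase.1 hi).1, mul_pow]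
      rw [this]
      simp only [hw, if_true]
      ring
    have h2 : β ^ 2 * ⟪e i₀, x⟫ ^ 2 ≤ 1 / (d : ℝ) := by
      have h3 : ⟪e i₀, x⟫ ^ 2 ≤ t ^ 2 := sq_le_sq' (by linarith [(abs_le.1 hxt).1]) (abs_le.1 hxt).2
      calc β ^ 2 * ⟪e i₀, x⟫ ^ 2 ≤ β ^ 2 * t ^ 2 := by gcongr
        _ = 1 / (d : ℝ) := by
          rw [hβ, div_pow, mul_pow, Real.sq_sqrt hd0.le]; field_simp
    have h3 : ‖x‖ ^ 2 ≤ 1 := by nlinarith [norm_nonneg x]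
    rw [h1, one_pow]
    nlinarith [sq_nonneg a, sq_nonneg ⟪e i₀, x⟫, mul_nonneg (sq_nonneg a) (sub_nonneg.2 h3),
      mul_nonneg (sq_nonneg a) (sq_nonneg ⟪e i₀, x⟫)]
  set S : Set (Metric.sphere (0 : Vec d) 1) := {b | |⟪e i₀, (b : Vec d)⟫| ≤ t} with hS
  have hSm : MeasurableSet S := by
    refine measurableSet_le ?_ measurable_const
    fun_prop
  have hcone : Set.Ioo (0 : ℝ) 1 • ((↑) '' S : Set (Vec d)) ⊆ A := by
    rintro _ ⟨s, hs, _, ⟨b, hb, rfl⟩, rfl⟩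
    have hb1 : ‖(b : Vec d)‖ = 1 := by simp
    have hb : |⟪e i₀, (b : Vec d)⟫| ≤ t := hb
    refine ⟨?_, ?_⟩
    · simp only [norm_smul, hb1, Real.norm_of_nonneg hs.1.le]; linarith [hs.2]
    · simp only [real_inner_smul_right, abs_mul, abs_of_pos hs.1]
      nlinarith [hs.1, hs.2, abs_nonneg ⟪e i₀, (b : Vec d)⟫]
  have hvol : (volume : Measure (Vec d)) A
      ≤ ENNReal.ofReal (√(3 * d) * t) * volume (Metric.ball (0 : Vec d) 1) := by
    refine (measure_mono hAsub).trans ?_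
    rw [Measure.addHaar_preimage_linearMap _ hdetpos.ne', Measure.addHaar_closedBall_eq_addHaar_ball]
    gcongr
    rw [abs_of_pos (inv_pos.2 hdetpos), hdet]
    rw [inv_le_comm₀ (hdet ▸ hdetpos) (by positivity)]
    calc (√(3 * d) * t)⁻¹ = β * (1 / √3) := by
          rw [hβ, Real.sqrt_mul (by norm_num)]; field_simp
      _ ≤ β * a ^ (d - 1) := by gcongr
  have hball0 : volume (Metric.ball (0 : Vec d) 1) ≠ 0 :=
    (Metric.measure_ball_pos _ _ one_pos).ne'
  have hballt : volume (Metric.ball (0 : Vec d) 1) ≠ ⊤ := measure_ball_lt_top.ne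
  rw [uniformSphere, cond_apply MeasurableSet.univ, Set.univ_inter, Measure.toSphere_apply_univ,
    Measure.toSphere_apply' _ hSm]
  have hfin : (Module.finrank ℝ (Vec d) : ENNReal) = d := by simp
  rw [hfin]
  have hdne : (d : ENNReal) ≠ 0 := by exact_mod_cast hd.ne'
  calc ((d : ENNReal) * volume (Metric.ball (0 : Vec d) 1))⁻¹
        * (d * volume (Set.Ioo (0 : ℝ) 1 • ((↑) '' S : Set (Vec d))))
      ≤ ((d : ENNReal) * volume (Metric.ball (0 : Vec d) 1))⁻¹
        * (d * (ENNReal.ofReal (√(3 * d) * t) * volume (Metric.ball (0 : Vec d) 1))) := by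
        gcongr
        exact (measure_mono hcone).trans hvol
    _ = ENNReal.ofReal (√(3 * d) * t) * (((d : ENNReal) * volume (Metric.ball (0 : Vec d) 1))⁻¹
        * (d * volume (Metric.ball (0 : Vec d) 1))) := by ring
    _ = ENNReal.ofReal (√(3 * d) * t) := by
        rw [ENNReal.inv_mul_cancel (mul_ne_zero hdne hball0)
          (ENNReal.mul_ne_top (ENNReal.natCast_ne_top d) hballt), mul_one]

end Cap

/-! ### Odd Chebyshev polynomials of a square root -/

section Chebyshev

/-- The polynomial of degree `n` with `y * oddCheb n (y ^ 2) = T_{2n+1} y`. -/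
noncomputable def oddCheb : ℕ → ℝ → ℝ
  | 0, _ => 1
  | 1, s => 4 * s - 3
  | n + 2, s => 2 * (2 * s - 1) * oddCheb (n + 1) s - oddCheb n s

theorem cos_mul_oddCheb (θ : ℝ) :
    ∀ n : ℕ, Real.cos θ * oddCheb n (Real.cos θ ^ 2) = Real.cos ((2 * n + 1) * θ)
  | 0 => by simp [oddCheb]
  | 1 => by
    rw [oddCheb, show (2 * ((1 : ℕ) : ℝ) + 1) * θ = 3 * θ by push_cast; ring, Real.cos_three_mul]
    ring
  | n + 2 => by
    have h1 := cos_mul_oddCheb θ n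
    have h2 := cos_mul_oddCheb θ (n + 1)
    have e0 : (2 * (n : ℝ) + 1) * θ = (2 * n + 3) * θ - 2 * θ := by ring
    have e1 : (2 * ((n + 1 : ℕ) : ℝ) + 1) * θ = (2 * n + 3) * θ := by push_cast; ring
    have e2 : (2 * ((n + 2 : ℕ) : ℝ) + 1) * θ = (2 * n + 3) * θ + 2 * θ := by push_cast; ring
    rw [e0, Real.cos_sub] at h1
    rw [e1] at h2
    rw [e2, Real.cos_add, oddCheb]
    have h3 := Real.cos_two_mul θ
    linear_combination 2 * (2 * Real.cos θ ^ 2 - 1) * h2 - h1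
      - 2 * Real.cos ((2 * n + 3) * θ) * h3

theorem sinh_mul_oddCheb (x : ℝ) :
    ∀ n : ℕ, Real.sinh x * oddCheb n (-Real.sinh x ^ 2) = (-1) ^ n * Real.sinh ((2 * n + 1) * x)
  | 0 => by simp [oddCheb]
  | 1 => by
    rw [oddCheb, show (2 * ((1 : ℕ) : ℝ) + 1) * x = 3 * x by push_cast; ring, Real.sinh_three_mul]
    ring
  | n + 2 => by
    have h1 := sinh_mul_oddCheb x n
    have h2 := sinh_mul_oddCheb x (n + 1)
    have e0 : (2 * (n : ℝ) + 1) * x = (2 * n + 3) * x - 2 * x := by ring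
    have e1 : (2 * ((n + 1 : ℕ) : ℝ) + 1) * x = (2 * n + 3) * x := by push_cast; ring
    have e2 : (2 * ((n + 2 : ℕ) : ℝ) + 1) * x = (2 * n + 3) * x + 2 * x := by push_cast; ring
    rw [e0, Real.sinh_sub] at h1
    rw [e1, pow_succ (-1 : ℝ) n] at h2
    rw [e2, Real.sinh_add, oddCheb, pow_succ (-1 : ℝ) (n + 1), pow_succ (-1 : ℝ) n]
    have h3 := Real.cosh_two_mul x
    have h4 := Real.cosh_sq x
    linear_combination 2 * (2 * (-Real.sinh x ^ 2) - 1) * h2 - h1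
      - 2 * (-1) ^ n * Real.sinh ((2 * n + 3) * x) * (h3 + h4)

theorem mul_oddCheb_sq_le_one (n : ℕ) {s : ℝ} (h0 : 0 ≤ s) (h1 : s ≤ 1) :
    s * oddCheb n s ^ 2 ≤ 1 := by
  have hc : Real.cos (Real.arccos √s) = √s :=
    Real.cos_arccos (by linarith [Real.sqrt_nonneg s]) (Real.sqrt_le_one.2 h1)
  have h := cos_mul_oddCheb (Real.arccos √s) n
  rw [hc, Real.sq_sqrt h0] at h
  have h2 := Real.cos_sq_le_one ((2 * n + 1) * Real.arccos √s)
  rw [← h, mul_pow, Real.sq_sqrt h0] at h2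
  exact h2

end Chebyshev

/-! ### The failure probability of the Lanczos method -/

section Failure

variable {d : ℕ} {H : Vec d →L[ℝ] Vec d} {b : Vec d}

theorem inner_eigenvector_map (hH : (H : Vec d →ₗ[ℝ] Vec d).IsSymmetric) {e : Vec d} {l : ℝ}
    (he : H e = l • e) (u : Vec d) : ⟪e, H u⟫ = l * ⟪e, u⟫ := by
  have : ⟪e, H u⟫ = ⟪H e, u⟫ := (hH e u).symm
  rw [this, he, real_inner_smul_left]

/-- In an eigenbasis of `H` the Krylov vector `p(H) b`, where `p` is the polynomial `oddCheb n`
rescaled, has the coordinates of `b` multiplied by the values of `p` at the eigenvalues. -/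
theorem exists_oddCheb_mem_krylov (hH : (H : Vec d →ₗ[ℝ] Vec d).IsSymmetric) (c Λ : ℝ) (n : ℕ) :
    ∃ u ∈ krylov H b (n + 1), ∀ e l, H e = l • e →
      ⟪e, u⟫ = oddCheb n ((l - c) / Λ) * ⟪e, b⟫ := by
  induction n using Nat.strong_induction_on with
  | _ n ih =>
  match n, ih with
  | 0, _ => exact ⟨b, self_mem_krylov, fun e l _ => by simp [oddCheb]⟩
  | 1, _ =>
    refine ⟨(4 / Λ) • (H b - c • b) - (3 : ℝ) • b, ?_, fun e l he => ?_⟩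
    · have h1 : b ∈ krylov H b (1 + 1) := krylov_mono (by omega) self_mem_krylov
      exact sub_mem (Submodule.smul_mem _ _ (sub_mem (map_mem_krylov self_mem_krylov)
        (Submodule.smul_mem _ _ h1))) (Submodule.smul_mem _ _ h1)
    · rw [inner_sub_right, real_inner_smul_right, inner_sub_right, real_inner_smul_right,
        real_inner_smul_right, inner_eigenvector_map hH he, oddCheb]
      ring
  | n + 2, ih =>
    obtain ⟨u, hu, hu'⟩ := ih (n + 1) (by omega)
    obtain ⟨w, hw, hw'⟩ := ih n (by omega)
    refine ⟨(4 / Λ) • (H u - c • u) - (2 : ℝ) • u - w, ?_, fun e l he => ?_⟩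
    · have h1 : u ∈ krylov H b (n + 2 + 1) := krylov_mono (by omega) hu
      have h2 : w ∈ krylov H b (n + 2 + 1) := krylov_mono (by omega) hw
      exact sub_mem (sub_mem (Submodule.smul_mem _ _ (sub_mem (map_mem_krylov hu)
        (Submodule.smul_mem _ _ h1))) (Submodule.smul_mem _ _ h1)) h2
    · rw [inner_sub_right, inner_sub_right, real_inner_smul_right, inner_sub_right,
        real_inner_smul_right, real_inner_smul_right, inner_eigenvector_map hH he, oddCheb,
        hu' e l he, hw' e l he]
      ring

/-- The analogue for the polynomial with the roots `ls`. -/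
theorem exists_prod_mem_krylov (hH : (H : Vec d →ₗ[ℝ] Vec d).IsSymmetric) (ls : List ℝ) :
    ∃ u ∈ krylov H b (ls.length + 1), ∀ e l, H e = l • e →
      ⟪e, u⟫ = (ls.map fun μ => l - μ).prod * ⟪e, b⟫ := by
  induction ls with
  | nil => exact ⟨b, self_mem_krylov, fun e l _ => by simp⟩
  | cons μ ls ih =>
    obtain ⟨u, hu, hu'⟩ := ih
    refine ⟨H u - μ • u, ?_, fun e l he => ?_⟩
    · exact sub_mem (map_mem_krylov hu) (Submodule.smul_mem _ _ (krylov_mono (by simp) hu))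
    · rw [inner_sub_right, real_inner_smul_right, inner_eigenvector_map hH he, hu' e l he]
      simp only [List.map_cons, List.prod_cons]
      ring

/-- This is `artanh u ≥ u` for `u = √y`, as `arsinh (u / √(1 - u²)) = artanh u`. -/
theorem le_arsinh_of_tanh {y : ℝ} (h0 : 0 < y) (h1 : y < 1) :
    √y ≤ Real.arsinh √(y / (1 - y)) := by
  set x := Real.arsinh √(y / (1 - y)) with hx
  have hsq : Real.sinh x ^ 2 = y / (1 - y) := by
    rw [hx, Real.sinh_arsinh, Real.sq_sqrt (div_nonneg h0.le (by linarith))]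
  have hx0 : 0 ≤ x := Real.arsinh_nonneg_iff.2 (Real.sqrt_nonneg _)
  have hcosh : Real.cosh x ^ 2 = 1 / (1 - y) := by
    rw [Real.cosh_sq, hsq]
    have : 1 - y ≠ 0 := by linarith
    field_simp
    ring
  -- `tanh x ≤ x`, in the form `sinh x ≤ x * cosh x`.
  have hle : Real.sinh x ≤ x * Real.cosh x := by
    have hd : ∀ t, HasDerivAt (fun t => t * Real.cosh t) (1 * Real.cosh t + t * Real.sinh t) t :=
      fun t => (hasDerivAt_id t).mul (Real.hasDerivAt_cosh t)
    have := sub_le_sub_of_deriv_le hx0 Real.hasDerivAt_sinh hd fun t h0 _ => by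
      have := Real.sinh_nonneg_iff.2 h0
      nlinarith
    simpa using this
  have hs0 : 0 ≤ Real.sinh x := Real.sinh_nonneg_iff.2 hx0
  rw [Real.sqrt_le_left hx0]
  have h2 : Real.sinh x ^ 2 ≤ x ^ 2 * Real.cosh x ^ 2 := by
    rw [← mul_pow]; exact pow_le_pow_left₀ hs0 hle 2
  rw [hsq, hcosh, mul_one_div, div_le_div_iff_of_pos_right (by linarith)] at h2
  exact h2

theorem lanczos_curv_le_of_mem_krylov (hH : (H : Vec d →ₗ[ℝ] Vec d).IsSymmetric) (hb : ‖b‖ = 1)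
    {k : ℕ} (hk : 0 < k) {u : Vec d} (hu : u ∈ krylov H b k) (hu0 : u ≠ 0) {c : ℝ}
    (h : ⟪u, H u⟫ ≤ c * ‖u‖ ^ 2) : ⟪lanczos H b k, H (lanczos H b k)⟫ ≤ c := by
  have h1 := (lanczos_spec hH hb hk).2 u hu
  have h2 : 0 < ‖u‖ ^ 2 := by have := norm_pos_iff.2 hu0; positivity
  exact le_of_mul_le_mul_right (h1.trans h) h2

/-- After `d` iterations the Ritz value is exact, unless the starting vector is orthogonal to the
eigenvector. -/
theorem lanczos_exact (hH : (H : Vec d →ₗ[ℝ] Vec d).IsSymmetric) (hb : ‖b‖ = 1) (hd : 0 < d)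
    (e : OrthonormalBasis (Fin d) ℝ (Vec d)) (l : Fin d → ℝ) (i₀ : Fin d)
    (he : ∀ i, H (e i) = l i • e i) (hb0 : ⟪e i₀, b⟫ ≠ 0) :
    ⟪lanczos H b d, H (lanczos H b d)⟫ ≤ l i₀ := by
  set ls := ((Finset.univ.filter fun i => l i ≠ l i₀).toList).map l with hls
  obtain ⟨u, hu, hu'⟩ := exists_prod_mem_krylov (b := b) hH ls
  have hlen : ls.length + 1 ≤ d := by
    rw [hls, List.length_map, Finset.length_toList]
    have : (Finset.univ.filter fun i => l i ≠ l i₀).card < (Finset.univ : Finset (Fin d)).card :=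
      Finset.card_lt_card (Finset.filter_ssubset.2 ⟨i₀, Finset.mem_univ _, by simp⟩)
    simpa using this
  have hne : ⟪e i₀, u⟫ ≠ 0 := by
    rw [hu' _ _ (he i₀)]
    refine mul_ne_zero (List.prod_ne_zero fun h => ?_) hb0
    simp only [hls, List.mem_map, Finset.mem_toList, Finset.mem_filter, Finset.mem_univ,
      true_and, exists_exists_and_eq_and] at h
    obtain ⟨i, hi, hi'⟩ := h
    exact hi (by linarith)
  have hzero : ∀ i, l i ≠ l i₀ → ⟪e i, u⟫ = 0 := by
    intro i hi
    rw [hu' _ _ (he i)]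
    refine mul_eq_zero_of_left (List.prod_eq_zero ?_) _
    simp only [hls, List.mem_map, Finset.mem_toList, Finset.mem_filter, Finset.mem_univ,
      true_and, exists_exists_and_eq_and]
    exact ⟨i, hi, sub_self _⟩
  refine lanczos_curv_le_of_mem_krylov hH hb hd (krylov_mono hlen hu) (fun h => hne (by simp [h])) ?_
  have h1 := inner_map_eq_sum e l hH he u
  simp only [ContinuousLinearMap.coe_coe] at h1
  rw [h1, norm_sq_eq_sum e, Finset.mul_sum]
  refine (Finset.sum_congr rfl fun i _ => ?_).le
  by_cases hi : l i = l i₀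
  · rw [hi]
  · rw [hzero i hi]; ring

/-- The Kuczyński–Woźniakowski bound: `n + 1` iterations reach accuracy `ε` if the component of
the starting vector along the eigenvector is at least `1 / sinh ((2 n + 1) x)`, where
`sinh² x = ε / (2 L - ε)`. -/
theorem lanczos_accuracy (hH : (H : Vec d →ₗ[ℝ] Vec d).IsSymmetric) (hb : ‖b‖ = 1)
    (e : OrthonormalBasis (Fin d) ℝ (Vec d)) (l : Fin d → ℝ) (i₀ : Fin d)
    (he : ∀ i, H (e i) = l i • e i) {L ε x : ℝ} (hl : ∀ i, l i ≤ l i₀ + 2 * L)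
    (hεL : ε < 2 * L) (hsinh : Real.sinh x ^ 2 = ε / (2 * L - ε)) (n : ℕ)
    (hb0 : 1 ≤ Real.sinh ((2 * n + 1) * x) ^ 2 * ⟪e i₀, b⟫ ^ 2) :
    ⟪lanczos H b (n + 1), H (lanczos H b (n + 1))⟫ ≤ l i₀ + ε := by
  set Λ := 2 * L - ε with hΛ
  have hΛ0 : 0 < Λ := by linarith
  obtain ⟨u, hu, hu'⟩ := exists_oddCheb_mem_krylov (b := b) hH (l i₀ + ε) Λ n
  set s : Fin d → ℝ := fun i => (l i - (l i₀ + ε)) / Λ with hs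
  have hs0 : s i₀ = -Real.sinh x ^ 2 := by rw [hsinh, hs]; simp only; ring
  have hsq : s i₀ * oddCheb n (s i₀) ^ 2 = -Real.sinh ((2 * n + 1) * x) ^ 2 := by
    have h := congrArg (· ^ 2) (sinh_mul_oddCheb x n)
    simp only [mul_pow] at h
    rw [← pow_mul, mul_comm n 2, pow_mul, neg_one_sq, one_pow, one_mul] at h
    rw [hs0, ← h]; ring
  have hu0 : u ≠ 0 := by
    intro h0
    have h1 := hu' _ _ (he i₀)
    rw [h0, inner_zero_right] at h1
    have h2 : s i₀ * oddCheb n (s i₀) ^ 2 * ⟪e i₀, b⟫ ^ 2 = 0 := by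
      have : (oddCheb n (s i₀) * ⟪e i₀, b⟫) ^ 2 = 0 := by rw [hs, ← h1]; ring
      linear_combination s i₀ * this
    rw [hsq] at h2
    linarith
  refine lanczos_curv_le_of_mem_krylov hH hb n.succ_pos hu hu0 ?_
  have h1 := inner_map_eq_sum e l hH he u
  simp only [ContinuousLinearMap.coe_coe] at h1
  rw [h1, norm_sq_eq_sum e, Finset.mul_sum, ← sub_nonpos, ← Finset.sum_sub_distrib]
  have h2 : ∀ i, l i * ⟪e i, u⟫ ^ 2 - (l i₀ + ε) * ⟪e i, u⟫ ^ 2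
      = Λ * (s i * oddCheb n (s i) ^ 2 * ⟪e i, b⟫ ^ 2) := by
    intro i
    rw [hu' _ _ (he i)]
    simp only [hs]
    field_simp
  rw [Finset.sum_congr rfl fun i _ => h2 i, ← Finset.mul_sum]
  refine mul_nonpos_of_nonneg_of_nonpos hΛ0.le ?_
  rw [← Finset.add_sum_erase _ _ (Finset.mem_univ i₀), hsq]
  have h3 : ∑ i ∈ Finset.univ.erase i₀, s i * oddCheb n (s i) ^ 2 * ⟪e i, b⟫ ^ 2
      ≤ ∑ i, ⟪e i, b⟫ ^ 2 := by
    refine (Finset.sum_le_sum fun i _ => ?_).trans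
      (Finset.sum_le_sum_of_subset_of_nonneg (Finset.erase_subset _ _) fun i _ _ => sq_nonneg _)
    have h4 : s i * oddCheb n (s i) ^ 2 ≤ 1 := by
      rcases le_or_gt 0 (s i) with h | h
      · refine mul_oddCheb_sq_le_one n h ?_
        rw [hs]; simp only
        rw [div_le_one hΛ0]; linarith [hl i]
      · nlinarith [sq_nonneg (oddCheb n (s i))]
    nlinarith [sq_nonneg ⟪e i, b⟫]
  rw [← norm_sq_eq_sum e b, hb] at h3
  linarith

/-- With `lanczosIters` iterations from a uniformly distributed starting vector, the Lanczos method
finds the smallest eigenvalue up to `ε`, except with probability `δ`. -/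
theorem uniformSphere_lanczos_failure_le (hH : (H : Vec d →ₗ[ℝ] Vec d).IsSymmetric) {L ε δ : ℝ}
    (hL : 0 < L) (hHL : ‖H‖ ≤ L) (hd : 0 < d) (hε : 0 < ε) (hδ0 : 0 < δ) (hδ1 : δ < 1) :
    uniformSphere d {b | lambdaMin (H : Module.End ℝ (Vec d)) + ε
        < ⟪lanczos H b (lanczosIters L d ε δ), H (lanczos H b (lanczosIters L d ε δ))⟫}
      ≤ ENNReal.ofReal δ := by
  have : Nonempty (Fin d) := ⟨⟨0, hd⟩⟩
  have hd0 : 0 < (d : ℝ) := by exact_mod_cast hd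
  have hd1 : (1 : ℝ) ≤ d := by exact_mod_cast hd
  obtain ⟨e, l, i₀, he, h0, hl⟩ := exists_eigenbasis hH (by simp : Module.finrank ℝ (Vec d) = d) hd
  simp only [ContinuousLinearMap.coe_coe] at he
  have hbd : ∀ v : Vec d, ‖v‖ = 1 → |⟪v, H v⟫| ≤ L := fun v hv => by
    have := abs_inner_clm_le H v
    rw [hv] at this
    linarith
  have hle : ∀ i, |l i| ≤ L := fun i => by
    have := hbd (e i) (e.norm_eq_one i)
    rwa [he, real_inner_smul_right, real_inner_self_eq_norm_sq, e.norm_eq_one, one_pow, mul_one]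
      at this
  rw [← h0]
  set k := lanczosIters L d ε δ with hk
  have hkpos : 0 < k := by rw [hk, lanczosIters]; omega
  -- It suffices to show that failure forces the starting vector into a thin band.
  suffices h : ∃ t > 0, √(3 * d) * t ≤ δ ∧ ∀ b : Vec d, ‖b‖ = 1 → t < |⟪e i₀, b⟫| →
      ⟪lanczos H b k, H (lanczos H b k)⟫ ≤ l i₀ + ε by
    obtain ⟨t, ht, htδ, h⟩ := h
    refine (measure_mono fun b hb => ?_).trans
      ((uniformSphere_band_le hd e i₀ ht).trans (ENNReal.ofReal_le_ofReal htδ))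
    by_contra hcon
    exact (not_lt.2 (h b (by simp) (not_le.1 hcon))) hb
  rcases le_or_gt (2 * L) ε with hεL | hεL
  · refine ⟨δ / √(3 * d), by positivity, (mul_div_cancel₀ _ (by positivity)).le,
      fun b hb _ => ?_⟩
    have h1 := (abs_le.1 (hbd _ (lanczos_spec hH hb hkpos).1)).2
    linarith [(abs_le.1 (hle i₀)).1]
  set r := (d : ℝ) / δ with hr
  have hr1 : 1 < r := by rw [hr, one_lt_div hδ0]; linarith
  have hlog : 0 < Real.log r := Real.log_pos hr1
  set n := ⌈2 * √(L / ε) * Real.log r⌉₊ with hn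
  have hkn' : k = min d (1 + n) := rfl
  rcases Nat.lt_or_ge (1 + n) d with hnd | hnd
  · -- Fewer than `d` iterations, hence `d ≥ 3`.
    have hkn : k = n + 1 := by omega
    have hn0 : 0 < n := Nat.ceil_pos.2 (by positivity)
    have hd3 : (3 : ℝ) ≤ d := by exact_mod_cast (by omega : 3 ≤ d)
    have hrd : (d : ℝ) ≤ r := by rw [hr, le_div_iff₀ hδ0]; nlinarith
    set y := ε / (2 * L) with hy
    have hy0 : 0 < y := by positivity
    have hy1 : y < 1 := by rw [hy, div_lt_one (by positivity)]; exact hεL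
    set x := Real.arsinh √(y / (1 - y)) with hx
    have hx1 : √y ≤ x := le_arsinh_of_tanh hy0 hy1
    have hx0 : 0 < x := (Real.sqrt_pos.2 hy0).trans_le hx1
    have hsinh : Real.sinh x ^ 2 = ε / (2 * L - ε) := by
      rw [hx, Real.sinh_arsinh, Real.sq_sqrt (div_nonneg hy0.le (by linarith)), hy]
      have : 2 * L - ε ≠ 0 := by linarith
      field_simp
    have hM : 2 * Real.log r ≤ (2 * n + 1) * x := by
      have h1 : 2 * √(L / ε) * Real.log r ≤ n := Nat.le_ceil _
      have h2 : 1 / 2 ≤ √(L / ε) * √y := by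
        rw [← Real.sqrt_mul (by positivity), hy]
        refine Real.le_sqrt_of_sq_le ?_
        have : L / ε * (ε / (2 * L)) = 1 / 2 := by field_simp
        rw [this]; norm_num
      calc 2 * Real.log r = 4 * (1 / 2) * Real.log r := by ring
        _ ≤ 4 * (√(L / ε) * √y) * Real.log r := by gcongr
        _ = 2 * (2 * √(L / ε) * Real.log r) * √y := by ring
        _ ≤ 2 * n * x := by gcongr
        _ ≤ (2 * n + 1) * x := by nlinarith
    have hr3 : 3 ≤ r := by linarith
    have hsM : (r ^ 2 - 1) / 2 ≤ Real.sinh ((2 * n + 1) * x) := by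
      have h1 : Real.sinh (2 * Real.log r) ≤ Real.sinh ((2 * n + 1) * x) :=
        Real.sinh_le_sinh.2 hM
      refine le_trans ?_ h1
      have h2 : Real.exp (2 * Real.log r) = r ^ 2 := by
        rw [mul_comm, Real.exp_mul, Real.exp_log (by linarith)]; norm_cast
      rw [Real.sinh_eq, Real.exp_neg, h2]
      have : (r ^ 2)⁻¹ ≤ 1 := inv_le_one_of_one_le₀ (by nlinarith)
      linarith
    have hr8 : 0 < r ^ 2 - 1 := by nlinarith
    refine ⟨2 / (r ^ 2 - 1), by positivity, ?_, fun b hb hbt => ?_⟩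
    · have hδ : δ = d / r := by rw [hr]; field_simp
      rw [hδ, mul_div_assoc', div_le_div_iff₀ hr8 (by linarith)]
      have h1 : √(3 * d) ≤ d := by
        rw [Real.sqrt_le_left hd0.le]; nlinarith
      have h2 : 2 * r ≤ r ^ 2 - 1 := by nlinarith
      calc √(3 * d) * 2 * r = √(3 * d) * (2 * r) := by ring
        _ ≤ d * (r ^ 2 - 1) := by gcongr
    · rw [hkn]
      refine lanczos_accuracy (L := L) hH hb e l i₀ he (fun i => ?_) hεL hsinh n ?_
      · linarith [(abs_le.1 (hle i)).2, (abs_le.1 (hle i₀)).1]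
      · rw [← sq_abs ⟪e i₀, b⟫, ← mul_pow]
        refine one_le_pow₀ ?_
        rw [div_lt_iff₀ hr8] at hbt
        nlinarith [abs_nonneg ⟪e i₀, b⟫]
  · have hkn : k = d := by omega
    refine ⟨δ / √(3 * d), by positivity, (mul_div_cancel₀ _ (by positivity)).le,
      fun b hb hbt => ?_⟩
    have hb0 : ⟪e i₀, b⟫ ≠ 0 := abs_pos.1 (lt_trans (by positivity) hbt)
    rw [hkn]
    linarith [lanczos_exact hH hb hd e l i₀ he hb0]

end Failure

/-! ### Accelerated gradient descent -/

section FixLoop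

/-- A loop that passes through the states `s 0, …, s n` and then returns `o` has value `o`. -/
theorem mem_fix_of_run {α β : Type*} {F : α →. β ⊕ α} {o : β} :
    ∀ (n : ℕ) (s : ℕ → α), (∀ j < n, Sum.inr (s (j + 1)) ∈ F (s j)) → Sum.inl o ∈ F (s n) →
      o ∈ F.fix (s 0)
  | 0, _, _, h => PFun.fix_stop h
  | n + 1, s, h, h' => by
    rw [PFun.fix_fwd_eq (h 0 n.succ_pos)]
    exact mem_fix_of_run n (fun j => s (j + 1)) (fun j hj => h (j + 1) (by omega)) h'

end FixLoop

section AGD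

variable {d : ℕ}

/-- Quadratic upper and lower bounds for `g` at every point: `g` is `L`-smooth and `σ`-strongly
convex. -/
structure QuadraticBounds (g : Vec d → ℝ) (L σ : ℝ) : Prop where
  upper : ∀ x y, g y ≤ g x + ⟪gradient g x, y - x⟫ + L / 2 * ‖y - x‖ ^ 2
  lower : ∀ x y, g x + ⟪gradient g x, y - x⟫ + σ / 2 * ‖y - x‖ ^ 2 ≤ g y

theorem QuadraticBounds.gradient_step {g : Vec d → ℝ} {L σ : ℝ} (h : QuadraticBounds g L σ)
    (hL : 0 < L) (x : Vec d) :
    g (x - (1 / L) • gradient g x) ≤ g x - ‖gradient g x‖ ^ 2 / (2 * L) := by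
  have h1 := h.upper x (x - (1 / L) • gradient g x)
  rw [sub_sub_cancel_left, inner_neg_right, real_inner_smul_right, real_inner_self_eq_norm_sq,
    norm_neg, norm_smul, Real.norm_of_nonneg (by positivity)] at h1
  refine h1.trans (le_of_eq ?_)
  field_simp
  ring

/-- Strong convexity bounds the distance to the minimum by the gradient. -/
theorem QuadraticBounds.sub_le_of_gradient {g : Vec d → ℝ} {L σ : ℝ} (h : QuadraticBounds g L σ)
    (hσ : 0 < σ) (x p : Vec d) : g x - ‖gradient g x‖ ^ 2 / (2 * σ) ≤ g p := by
  have h1 := h.lower x p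
  have h2 := neg_le_of_abs_le (abs_real_inner_le_norm (gradient g x) (p - x))
  have h3 : ‖gradient g x‖ * ‖p - x‖
      ≤ ‖gradient g x‖ ^ 2 / (2 * σ) + σ / 2 * ‖p - x‖ ^ 2 := by
    have : ‖gradient g x‖ ^ 2 / (2 * σ) + σ / 2 * ‖p - x‖ ^ 2 - ‖gradient g x‖ * ‖p - x‖
        = (‖gradient g x‖ - σ * ‖p - x‖) ^ 2 / (2 * σ) := by field_simp; ring
    have h4 : 0 ≤ (‖gradient g x‖ - σ * ‖p - x‖) ^ 2 / (2 * σ) := by positivity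
    linarith
  linarith

theorem QuadraticBounds.exists_min {g : Vec d → ℝ} {L σ : ℝ} (h : QuadraticBounds g L σ)
    (hσ : 0 < σ) (hg : Continuous g) : ∃ p, ∀ y, g p ≤ g y := by
  refine hg.exists_forall_le' 0 ?_
  set G := ‖gradient g 0‖ with hG
  filter_upwards [(tendsto_norm_cocompact_atTop (E := Vec d)).eventually_ge_atTop (2 * G / σ)]
    with y hy
  have h1 := h.lower 0 y
  rw [sub_zero] at h1
  have h2 := neg_le_of_abs_le (abs_real_inner_le_norm (gradient g 0) y)
  rw [div_le_iff₀ hσ] at hy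
  nlinarith [norm_nonneg y]

/-- The iterates `(y, z)` of accelerated gradient descent for the gradient map `G`, with step
`1 / L` and momentum `m`, started at `x`. -/
noncomputable def agdIter (G : Vec d → Vec d) (L m : ℝ) (x : Vec d) : ℕ → Vec d × Vec d
  | 0 => (x, x)
  | n + 1 =>
    let y' := (agdIter G L m x n).2 - (1 / L) • G (agdIter G L m x n).2
    (y', (1 + m) • y' - m • (agdIter G L m x n).1)

/-- The momentum coefficient of accelerated gradient descent. -/
noncomputable def momentum (L σ : ℝ) : ℝ := (√(L / σ) - 1) / (√(L / σ) + 1)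

/-- The number of the first iterate at which the gradient is at most `ε` (and `0` if there is
none). -/
noncomputable def agdCount (G : Vec d → Vec d) (ε L σ : ℝ) (x : Vec d) : ℕ :=
  sInf {n | ‖G (agdIter G L (momentum L σ) x n).1‖ ≤ ε}

/-- The point returned by accelerated gradient descent for the gradient map `G` (the starting
point `x` if the method does not terminate). -/
noncomputable def agdOut (G : Vec d → Vec d) (ε L σ : ℝ) (x : Vec d) : Vec d :=
  (agdIter G L (momentum L σ) x (agdCount G ε L σ x)).1

/-- One step of the Lyapunov argument, in terms of `a = z - p` and `b = z - y`: the potential is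
`g y - g p + σ / 2 * ‖w - p‖ ^ 2` with `w = z + q (z - y)` and `q = √(L / σ)`. -/
theorem lyapunov_step {a b G : Vec d} {gy gz gp gy' σ q : ℝ} (hσ : 0 < σ) (hq : 1 ≤ q)
    (h1 : gy' ≤ gz - ‖G‖ ^ 2 / (2 * (σ * q ^ 2))) (h2 : gz - ⟪G, b⟫ ≤ gy)
    (h3 : gz - ⟪G, a⟫ + σ / 2 * ‖a‖ ^ 2 ≤ gp) :
    gy' - gp + σ / 2 * ‖a + (q - 1) • b - (1 / (σ * q)) • G‖ ^ 2
      ≤ (1 - 1 / q) * (gy - gp + σ / 2 * ‖a + q • b‖ ^ 2) := by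
  have hq0 : 0 < q := by linarith
  have e1 : ‖a + (q - 1) • b - (1 / (σ * q)) • G‖ ^ 2 = ‖a‖ ^ 2 + (q - 1) ^ 2 * ‖b‖ ^ 2
      + (1 / (σ * q)) ^ 2 * ‖G‖ ^ 2 + 2 * (q - 1) * ⟪a, b⟫ - 2 * (1 / (σ * q)) * ⟪G, a⟫
      - 2 * (q - 1) * (1 / (σ * q)) * ⟪G, b⟫ := by
    simp only [← real_inner_self_eq_norm_sq, inner_add_left, inner_add_right, inner_sub_left,
      inner_sub_right, real_inner_smul_left, real_inner_smul_right, real_inner_comm G,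
      real_inner_comm b a]
    ring
  have e2 : ‖a + q • b‖ ^ 2 = ‖a‖ ^ 2 + 2 * q * ⟪a, b⟫ + q ^ 2 * ‖b‖ ^ 2 := by
    simp only [← real_inner_self_eq_norm_sq, inner_add_left, inner_add_right,
      real_inner_smul_left, real_inner_smul_right, real_inner_comm b a]
    ring
  have hi : 0 ≤ 1 - 1 / q := by rw [sub_nonneg, div_le_one hq0]; exact hq
  have h2' := mul_le_mul_of_nonneg_left h2 hi
  have h3' := mul_le_mul_of_nonneg_left h3 (by positivity : 0 ≤ 1 / q)
  have h4 : 0 ≤ σ / 2 * (q - 1) * ‖b‖ ^ 2 := by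
    have : 0 ≤ q - 1 := by linarith
    positivity
  rw [e1, e2]
  have e3 : (1 - 1 / q) * (gy - gp + σ / 2 * (‖a‖ ^ 2 + 2 * q * ⟪a, b⟫ + q ^ 2 * ‖b‖ ^ 2))
      - (gy' - gp + σ / 2 * (‖a‖ ^ 2 + (q - 1) ^ 2 * ‖b‖ ^ 2
      + (1 / (σ * q)) ^ 2 * ‖G‖ ^ 2 + 2 * (q - 1) * ⟪a, b⟫ - 2 * (1 / (σ * q)) * ⟪G, a⟫
      - 2 * (q - 1) * (1 / (σ * q)) * ⟪G, b⟫))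
      = (gz - ‖G‖ ^ 2 / (2 * (σ * q ^ 2)) - gy') + ((1 - 1 / q) * gy - (1 - 1 / q) * (gz - ⟪G, b⟫))
      + (1 / q * gp - 1 / q * (gz - ⟪G, a⟫ + σ / 2 * ‖a‖ ^ 2)) + σ / 2 * (q - 1) * ‖b‖ ^ 2 := by
    field_simp
    ring
  linarith

theorem agdIter_lyapunov {g : Vec d → ℝ} {L σ : ℝ} (h : QuadraticBounds g L σ) (hσ : 0 < σ)
    (hL : σ ≤ L) (x p : Vec d) (n : ℕ) :
    let q := √(L / σ)
    let s := agdIter (gradient g) L (momentum L σ) x n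
    g s.1 - g p + σ / 2 * ‖s.2 - p + q • (s.2 - s.1)‖ ^ 2
      ≤ (1 - 1 / q) ^ n * (g x - g p + σ / 2 * ‖x - p‖ ^ 2) := by
  intro q
  have hq : 1 ≤ q := Real.one_le_sqrt.2 ((one_le_div hσ).2 hL)
  have hq0 : 0 < q := by linarith
  have hL0 : 0 < L := by linarith
  have hLq : L = σ * q ^ 2 := by
    rw [Real.sq_sqrt (by positivity)]; field_simp
  have hi : 0 ≤ 1 - 1 / q := by rw [sub_nonneg, div_le_one hq0]; exact hq
  induction n with
  | zero => simp [agdIter]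
  | succ n ih =>
    intro s'
    simp only at ih
    set y := (agdIter (gradient g) L (momentum L σ) x n).1
    set z := (agdIter (gradient g) L (momentum L σ) x n).2
    set y' := z - (1 / L) • gradient g z with hy'
    have hs1 : s'.1 = y' := rfl
    have hs2 : s'.2 = (1 + momentum L σ) • y' - momentum L σ • y := rfl
    have hm : momentum L σ = (q - 1) / (q + 1) := rfl
    have hvec : s'.2 - p + q • (s'.2 - s'.1)
        = (z - p) + (q - 1) • (z - y) - (1 / (σ * q)) • gradient g z := by
      have h1 : (1 / (σ * q) : ℝ) = q * (1 / L) := by rw [hLq]; field_simp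
      rw [hs1, hs2, hm, h1, hy']
      match_scalars <;> field_simp <;> ring
    have h1 : g y' ≤ g z - ‖gradient g z‖ ^ 2 / (2 * (σ * q ^ 2)) := by
      rw [← hLq]; exact h.gradient_step hL0 z
    have h2 : g z - ⟪gradient g z, z - y⟫ ≤ g y := by
      have := h.lower z y
      rw [← neg_sub z y, inner_neg_right] at this
      have h0 : 0 ≤ σ / 2 * ‖-(z - y)‖ ^ 2 := by positivity
      linarith
    have h3 : g z - ⟪gradient g z, z - p⟫ + σ / 2 * ‖z - p‖ ^ 2 ≤ g p := by
      have := h.lower z p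
      rw [← neg_sub z p, inner_neg_right, norm_neg] at this
      linarith
    rw [hvec, hs1, pow_succ' (1 - 1 / q) n, mul_assoc]
    exact (lyapunov_step hσ hq h1 h2 h3).trans (mul_le_mul_of_nonneg_left ih hi)

/-- After `n` steps, where `n` exceeds `√(L / σ) log (4 L D / ε²)`, the gradient is at most `ε`;
here `D` bounds the initial gap. -/
theorem norm_gradient_agdIter_le {g : Vec d → ℝ} {L σ ε D : ℝ} (h : QuadraticBounds g L σ)
    (hg : Continuous g) (hσ : 0 < σ) (hL : σ ≤ L) (hε : 0 ≤ ε) {x : Vec d}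
    (hD : ∀ p, g x - g p ≤ D) {n : ℕ}
    (hn : 4 * L * D * Real.exp (-(n / √(L / σ))) ≤ ε ^ 2) :
    ‖gradient g (agdIter (gradient g) L (momentum L σ) x n).1‖ ≤ ε := by
  have hL0 : 0 < L := by linarith
  obtain ⟨p, hp⟩ := h.exists_min hσ hg
  have hgrad : gradient g p = 0 := by
    have h1 := h.gradient_step hL0 p
    have h2 := hp (p - (1 / L) • gradient g p)
    have h3 : ‖gradient g p‖ ^ 2 / (2 * L) ≤ 0 := by linarith
    rw [div_le_iff₀ (by positivity), zero_mul] at h3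
    exact norm_eq_zero.1 (pow_eq_zero_iff two_ne_zero |>.1 (le_antisymm h3 (sq_nonneg _)))
  have hlya := agdIter_lyapunov h hσ hL x p n
  simp only at hlya
  set q := √(L / σ)
  have hq : 1 ≤ q := Real.one_le_sqrt.2 ((one_le_div hσ).2 hL)
  have hq0 : 0 < q := by linarith
  have hi : 0 ≤ 1 - 1 / q := by rw [sub_nonneg, div_le_one hq0]; exact hq
  set s := agdIter (gradient g) L (momentum L σ) x n
  have h1 : (1 - 1 / q) ^ n ≤ Real.exp (-(n / q)) := by
    have : 1 - 1 / q ≤ Real.exp (-(1 / q)) := by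
      have := Real.add_one_le_exp (-(1 / q)); linarith
    calc (1 - 1 / q) ^ n ≤ Real.exp (-(1 / q)) ^ n := by gcongr
      _ = Real.exp (-(n / q)) := by rw [← Real.exp_nat_mul]; congr 1; ring
  have h2 : σ / 2 * ‖x - p‖ ^ 2 ≤ g x - g p := by
    have := h.lower p x
    rw [hgrad, inner_zero_left] at this
    linarith
  have h3 : ‖gradient g s.1‖ ^ 2 / (2 * L) ≤ g s.1 - g p := by
    have h4 := h.gradient_step hL0 s.1
    have := hp (s.1 - (1 / L) • gradient g s.1)
    linarith
  have h5 : g s.1 - g p ≤ Real.exp (-(n / q)) * (2 * D) := by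
    have h6 : 0 ≤ σ / 2 * ‖s.2 - p + q • (s.2 - s.1)‖ ^ 2 := by positivity
    have h7 : 0 ≤ g x - g p := by linarith [hp x]
    calc g s.1 - g p ≤ (1 - 1 / q) ^ n * (g x - g p + σ / 2 * ‖x - p‖ ^ 2) := by linarith
      _ ≤ Real.exp (-(n / q)) * (2 * D) := by
        gcongr
        linarith [hD p]
  rw [div_le_iff₀ (by positivity)] at h3
  refine (pow_le_pow_iff_left₀ (norm_nonneg _) hε two_ne_zero).1 (le_trans ?_ hn)
  nlinarith

/-- Running the procedure yields `agdOut` after `agdCount` steps, provided that it terminates. -/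
theorem agdOut_mem_agd {g : Vec d → ℝ} {L σ ε : ℝ} {x : Vec d} (t : Tally d)
    (h : ∃ n, ‖gradient g (agdIter (gradient g) L (momentum L σ) x n).1‖ ≤ ε) :
    (agdOut (gradient g) ε L σ x, (⟨t.ncg, t.agdSteps + agdCount (gradient g) ε L σ x,
      t.grads + 2 * agdCount (gradient g) ε L σ x + 1⟩ : Tally d)) ∈ agd g ε L σ ((x, x), t) := by
  set N := agdCount (gradient g) ε L σ x with hN
  have hmem : ‖gradient g (agdIter (gradient g) L (momentum L σ) x N).1‖ ≤ ε := Nat.sInf_mem h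
  have hlt : ∀ j < N, ¬ ‖gradient g (agdIter (gradient g) L (momentum L σ) x j).1‖ ≤ ε :=
    fun j hj => Nat.notMem_of_lt_sInf hj
  refine mem_fix_of_run N (fun j => (agdIter (gradient g) L (momentum L σ) x j,
    (⟨t.ncg, t.agdSteps + j, t.grads + 2 * j⟩ : Tally d))) (fun j hj => ?_) ?_
  · simp only [Part.mem_some_iff]
    rw [if_neg (hlt j hj)]
    rfl
  · simp only [Part.mem_some_iff]
    rw [if_pos hmem]
    rfl

end AGD

/-! ### The almost convex method -/

section AlmostConvex

variable {d : ℕ}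

/-- The accuracy demanded from the accelerated gradient method by Almost-Convex-AGD. -/
noncomputable def innerAccuracy (ε γ L : ℝ) : ℝ := ε * √(γ / (50 * (L + 2 * γ)))

/-- The iterates of Almost-Convex-AGD, for the gradient maps `G z` of the functions
`h + γ ‖· - z‖²`. -/
noncomputable def acIter (G : Vec d → Vec d → Vec d) (ε γ L : ℝ) (x : Vec d) : ℕ → Vec d
  | 0 => x
  | n + 1 => agdOut (G (acIter G ε γ L x n)) (innerAccuracy ε γ L) L γ (acIter G ε γ L x n)

/-- The number of the first iterate at which the gradient `g` of `h` is at most `ε`. -/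
noncomputable def acCount (g : Vec d → Vec d) (G : Vec d → Vec d → Vec d) (ε γ L : ℝ)
    (x : Vec d) : ℕ := sInf {n | ‖g (acIter G ε γ L x n)‖ ≤ ε}

/-- The point returned by Almost-Convex-AGD (the starting point if the gradient never becomes
small). -/
noncomputable def acOut (g : Vec d → Vec d) (G : Vec d → Vec d → Vec d) (ε γ L : ℝ)
    (x : Vec d) : Vec d := acIter G ε γ L x (acCount g G ε γ L x)

/-- The function `h + γ ‖· - z‖²`. -/
noncomputable def proximal (h : Vec d → ℝ) (γ : ℝ) (z : Vec d) : Vec d → ℝ :=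
  fun x => h x + γ * ‖x - z‖ ^ 2

theorem hasGradientAt_sq_dist (γ : ℝ) (z x : Vec d) :
    HasGradientAt (fun y => γ * ‖y - z‖ ^ 2) ((2 * γ) • (x - z)) x := by
  rw [hasGradientAt_iff_hasFDerivAt]
  have h1 := (((hasFDerivAt_id (𝕜 := ℝ) x).sub_const z).norm_sq).const_mul γ
  refine h1.congr_fderiv ?_
  ext v
  simp
  ring

theorem gradient_proximal {h : Vec d → ℝ} (hh : Differentiable ℝ h) (γ : ℝ) (z x : Vec d) :
    gradient (proximal h γ z) x = gradient h x + (2 * γ) • (x - z) := by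
  refine HasGradientAt.gradient ?_
  have h1 := (hh x).hasGradientAt.hasFDerivAt.add (hasGradientAt_sq_dist γ z x).hasFDerivAt
  rw [hasGradientAt_iff_hasFDerivAt, map_add]
  exact h1

/-- A call of the accelerated gradient method decreases `h` by at least `γ` times the squared
length of its step; the step is long unless it ends at a point with small gradient. -/
theorem proximal_step {h : Vec d → ℝ} (hh : Differentiable ℝ h) {ε γ L : ℝ} (hε : 0 < ε)
    (hγ : 0 < γ) (hL : 0 < L) {z z' : Vec d} (hb : QuadraticBounds (proximal h γ z) L γ)
    (hz : ε < ‖gradient h z‖) (hz' : ‖gradient (proximal h γ z) z'‖ ≤ innerAccuracy ε γ L) :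
    γ * ‖z' - z‖ ^ 2 ≤ h z - h z' ∧
      (ε < ‖gradient h z'‖ → 9 * ε / (20 * γ) ≤ ‖z' - z‖) := by
  have hacc2 : innerAccuracy ε γ L ^ 2 = ε ^ 2 * (γ / (50 * (L + 2 * γ))) := by
    rw [innerAccuracy, mul_pow, Real.sq_sqrt (by positivity)]
  have hacc : innerAccuracy ε γ L ≤ ε / 10 := by
    refine (pow_le_pow_iff_left₀ (by unfold innerAccuracy; positivity) (by positivity)
      two_ne_zero).1 ?_
    rw [hacc2, div_pow, div_eq_mul_one_div (ε ^ 2)]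
    refine mul_le_mul_of_nonneg_left ?_ (sq_nonneg _)
    rw [div_le_div_iff₀ (by positivity) (by norm_num)]
    nlinarith
  constructor
  · have h1 := hb.sub_le_of_gradient hγ z' (z - (1 / L) • gradient (proximal h γ z) z)
    have h2 := hb.gradient_step hL z
    have hgz : gradient (proximal h γ z) z = gradient h z := by
      rw [gradient_proximal hh]; simp
    have h3 : ‖gradient (proximal h γ z) z'‖ ^ 2 / (2 * γ)
        ≤ ‖gradient (proximal h γ z) z‖ ^ 2 / (2 * L) := by
      rw [hgz]
      calc ‖gradient (proximal h γ z) z'‖ ^ 2 / (2 * γ)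
          ≤ ε ^ 2 * (γ / (50 * (L + 2 * γ))) / (2 * γ) := by rw [← hacc2]; gcongr
        _ = ε ^ 2 / (100 * (L + 2 * γ)) := by field_simp; norm_num
        _ ≤ ε ^ 2 / (2 * L) := by
          gcongr
          · norm_num
          · linarith
        _ ≤ ‖gradient h z‖ ^ 2 / (2 * L) := by gcongr
    have e1 : proximal h γ z z = h z := by simp [proximal]
    have e2 : proximal h γ z z' = h z' + γ * ‖z' - z‖ ^ 2 := rfl
    linarith
  · intro hz2
    have h1 : gradient h z' = gradient (proximal h γ z) z' - (2 * γ) • (z' - z) := by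
      rw [gradient_proximal hh]; abel
    have h2 : ‖gradient h z'‖ ≤ ε / 10 + 2 * γ * ‖z' - z‖ := by
      rw [h1]
      refine (norm_sub_le _ _).trans ?_
      rw [norm_smul, Real.norm_of_nonneg (by positivity)]
      linarith
    rw [div_le_iff₀ (by positivity)]
    linarith

/-- The arithmetic of the displacement bound: `S` is the total length of the long steps, `s` the
length of the last step. -/
theorem displacement_aux {ε γ a S s : ℝ} (hε : 0 < ε) (hγ : 0 < γ) (ha : a = 9 * ε / (20 * γ))
    (hS : a ≤ S) (hs : 0 ≤ s) : ε * (S + s) / √10 ≤ γ * a * S + γ * s ^ 2 := by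
  have ha0 : 0 < a := by rw [ha]; positivity
  have hr : (25 / 9 : ℝ) ≤ √10 := Real.le_sqrt_of_sq_le (by norm_num)
  have h1 : ε * (S + s) / √10 ≤ 4 / 5 * (γ * a) * (S + s) := by
    have hεa : 4 / 5 * (γ * a) = 9 / 25 * ε := by rw [ha]; field_simp; norm_num
    rw [hεa, div_le_iff₀ (by positivity)]
    have : 0 ≤ ε * (S + s) := mul_nonneg hε.le (by linarith)
    nlinarith
  have h2 : 4 / 5 * a * (S + s) ≤ a * S + s ^ 2 := by
    nlinarith [sq_nonneg (s - 2 / 5 * a), mul_nonneg ha0.le (sub_nonneg.2 hS)]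
  have h3 := mul_le_mul_of_nonneg_left h2 hγ.le
  linarith

/-- A sequence whose steps decrease `h` by `γ` times their squared length, and are long as long as
the gradient is large, reaches a small gradient; the number of steps and the total displacement are
controlled by the decrease of `h`. -/
theorem path_bounds {h : Vec d → ℝ} {ε γ D : ℝ} (hε : 0 < ε) (hγ : 0 < γ) (z : ℕ → Vec d)
    (hD : ∀ p, h (z 0) - h p ≤ D) (hx : ε < ‖gradient h (z 0)‖)
    (hstep : ∀ j, h (z j) ≤ h (z 0) → ε < ‖gradient h (z j)‖ →
      γ * ‖z (j + 1) - z j‖ ^ 2 ≤ h (z j) - h (z (j + 1)) ∧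
      (ε < ‖gradient h (z (j + 1))‖ → 9 * ε / (20 * γ) ≤ ‖z (j + 1) - z j‖)) :
    ∃ N, ‖gradient h (z N)‖ ≤ ε ∧ (∀ j < N, ε < ‖gradient h (z j)‖ ∧ h (z j) ≤ h (z 0)) ∧
      (N : ℝ) ≤ 1 + 5 * γ / ε ^ 2 * (h (z 0) - h (z N)) ∧
      (γ * ‖z N - z 0‖ ^ 2 ≤ h (z 0) - h (z N) ∨
        ε * ‖z N - z 0‖ / √10 ≤ h (z 0) - h (z N)) := by
  set a := 9 * ε / (20 * γ) with ha
  have ha0 : 0 < a := by positivity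
  obtain ⟨path, hp0, hps⟩ : ∃ path : ℕ → ℝ, path 0 = 0 ∧
      ∀ j, path (j + 1) = path j + ‖z (j + 1) - z j‖ :=
    ⟨fun j => ∑ i ∈ Finset.range j, ‖z (i + 1) - z i‖, by simp,
      fun j => Finset.sum_range_succ _ _⟩
  have hpos : ∀ j, 0 ≤ path j := by
    intro j
    induction j with
    | zero => rw [hp0]
    | succ j ih => rw [hps]; positivity
  -- As long as all gradients are large, the decrease is linear in the length of the path.
  have hlong : ∀ j, (∀ i ≤ j, ε < ‖gradient h (z i)‖) →
      a * j ≤ path j ∧ γ * a * path j ≤ h (z 0) - h (z j) := by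
    intro j
    induction j with
    | zero => intro _; simp [hp0]
    | succ j ih =>
      intro hj
      obtain ⟨h1, h2⟩ := ih fun i hi => hj i (by omega)
      have hle : h (z j) ≤ h (z 0) := by
        have : 0 ≤ γ * a * path j := mul_nonneg (by positivity) (hpos j)
        linarith
      obtain ⟨h3, h4⟩ := hstep j hle (hj j (by omega))
      have h5 := h4 (hj (j + 1) le_rfl)
      rw [hps]
      push_cast
      refine ⟨by linarith, ?_⟩
      have h7 : γ * a * ‖z (j + 1) - z j‖ ≤ γ * ‖z (j + 1) - z j‖ ^ 2 := by
        rw [mul_assoc, sq]; gcongr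
      linarith
  have hdist : ∀ j, ‖z j - z 0‖ ≤ path j := by
    intro j
    induction j with
    | zero => simp [hp0]
    | succ j ih =>
      have := norm_sub_le_norm_sub_add_norm_sub (z (j + 1)) (z j) (z 0)
      rw [hps]
      linarith
  have hex : ∃ j, ‖gradient h (z j)‖ ≤ ε := by
    by_contra hcon
    push Not at hcon
    obtain ⟨n, hn⟩ := exists_nat_gt (D / (γ * a * a))
    obtain ⟨h1, h2⟩ := hlong n fun i _ => hcon i
    have h3 := hD (z n)
    rw [div_lt_iff₀ (by positivity)] at hn
    have h4 : γ * a * (a * n) ≤ γ * a * path n := by gcongr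
    linarith
  classical
  obtain ⟨N, hmem, hlt⟩ : ∃ N, ‖gradient h (z N)‖ ≤ ε ∧ ∀ j < N, ε < ‖gradient h (z j)‖ :=
    ⟨Nat.find hex, Nat.find_spec hex, fun j hj => not_le.1 (Nat.find_min hex hj)⟩
  obtain ⟨M, rfl⟩ : ∃ M, N = M + 1 := by
    rcases N with _ | M
    · exact absurd hmem (not_le.2 hx)
    · exact ⟨M, rfl⟩
  obtain ⟨hl1, hl2⟩ := hlong M fun i hi => hlt i (by omega)
  have hle : ∀ j ≤ M, h (z j) ≤ h (z 0) := fun j hj => by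
    have h1 := (hlong j fun i hi => hlt i (by omega)).2
    have h2 : 0 ≤ γ * a * path j := mul_nonneg (by positivity) (hpos j)
    linarith
  obtain ⟨hlast, -⟩ := hstep M (hle M le_rfl) (hlt M (by omega))
  have hdec : γ * a * path M + γ * ‖z (M + 1) - z M‖ ^ 2 ≤ h (z 0) - h (z (M + 1)) := by linarith
  have hDist := hdist (M + 1)
  rw [hps] at hDist
  refine ⟨M + 1, hmem, fun j hj => ⟨hlt j hj, hle j (by omega)⟩, ?_, ?_⟩
  · push_cast
    have h1 : γ * a * (a * M) ≤ γ * a * path M := by gcongr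
    have h2 : 0 ≤ γ * ‖z (M + 1) - z M‖ ^ 2 := by positivity
    have h3 : γ * a * (a * M) = 81 / 400 * (ε ^ 2 / γ) * M := by rw [ha]; field_simp; ring
    have h4 : 5 * γ / ε ^ 2 * (81 / 400 * (ε ^ 2 / γ) * M) = 81 / 80 * M := by
      field_simp; ring
    have h5 : 5 * γ / ε ^ 2 * (81 / 400 * (ε ^ 2 / γ) * M)
        ≤ 5 * γ / ε ^ 2 * (h (z 0) - h (z (M + 1))) := by
      gcongr; linarith
    have h6 : (0 : ℝ) ≤ M := Nat.cast_nonneg M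
    linarith
  · rcases Nat.eq_zero_or_pos M with h0 | h0
    · left
      subst h0
      have : 0 ≤ γ * a * path 0 := mul_nonneg (by positivity) (hpos 0)
      linarith
    · right
      have h1 : a ≤ path M := by
        have : (1 : ℝ) ≤ M := by exact_mod_cast h0
        nlinarith
      refine le_trans ?_ ((displacement_aux hε hγ ha h1 (norm_nonneg (z (M + 1) - z M))).trans hdec)
      gcongr

/-- The run of Almost-Convex-AGD for an almost convex function `h`: it terminates after `J` calls
of the accelerated gradient method with at most `S` steps each; `J` is controlled by the decrease
of `h`, and so is the distance from the starting point. -/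
theorem acOut_mem_almostConvexAGD {h : Vec d → ℝ} (hh : Differentiable ℝ h) {ε γ L D : ℝ}
    (hε : 0 < ε) (hγ : 0 < γ) (hγL : γ ≤ L)
    (hb : ∀ z, QuadraticBounds (proximal h γ z) L γ) {x : Vec d} (hD : ∀ p, h x - h p ≤ D)
    (hx : ε < ‖gradient h x‖) {S : ℕ}
    (hS : 4 * L * D * Real.exp (-(S / √(L / γ))) ≤ innerAccuracy ε γ L ^ 2) (t : Tally d)
    {out : Vec d}
    (hout : out = acOut (gradient h) (fun z => gradient (proximal h γ z)) ε γ L x) :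
    ∃ J s : ℕ, s ≤ J * S ∧ (J : ℝ) ≤ 1 + 5 * γ / ε ^ 2 * (h x - h out) ∧
      ‖gradient h out‖ ≤ ε ∧
      (γ * ‖out - x‖ ^ 2 ≤ h x - h out ∨ ε * ‖out - x‖ / √10 ≤ h x - h out) ∧
      (out, (⟨t.ncg, t.agdSteps + s, t.grads + 2 * s + 2 * J + 1⟩ : Tally d))
        ∈ almostConvexAGD h ε γ L (x, t) := by
  have hL : 0 < L := by linarith
  have hacc0 : 0 ≤ innerAccuracy ε γ L := by unfold innerAccuracy; positivity
  -- Each accelerated run terminates within `S` steps.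
  have hterm : ∀ z, h z ≤ h x → ‖gradient (proximal h γ z)
      (agdIter (gradient (proximal h γ z)) L (momentum L γ) z S).1‖ ≤ innerAccuracy ε γ L := by
    intro z hz
    refine norm_gradient_agdIter_le (hb z) ?_ hγ hγL hacc0 (D := D) (fun p => ?_) hS
    · exact hh.continuous.add (by fun_prop)
    · have h1 : 0 ≤ γ * ‖p - z‖ ^ 2 := by positivity
      have := hD p
      simp only [proximal, sub_self, norm_zero]
      linarith
  have hagd : ∀ z, h z ≤ h x → ‖gradient (proximal h γ z)
      (agdOut (gradient (proximal h γ z)) (innerAccuracy ε γ L) L γ z)‖ ≤ innerAccuracy ε γ L :=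
    fun z hz => Nat.sInf_mem (s := {n | ‖gradient (proximal h γ z)
      (agdIter (gradient (proximal h γ z)) L (momentum L γ) z n).1‖ ≤ innerAccuracy ε γ L})
      ⟨S, hterm z hz⟩
  have hcount : ∀ z, h z ≤ h x →
      agdCount (gradient (proximal h γ z)) (innerAccuracy ε γ L) L γ z ≤ S :=
    fun z hz => Nat.sInf_le (hterm z hz)
  have hmemagd : ∀ (z : Vec d) (t : Tally d), h z ≤ h x →
      (agdOut (gradient (proximal h γ z)) (innerAccuracy ε γ L) L γ z, (⟨t.ncg, t.agdSteps
        + agdCount (gradient (proximal h γ z)) (innerAccuracy ε γ L) L γ z, t.grads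
        + 2 * agdCount (gradient (proximal h γ z)) (innerAccuracy ε γ L) L γ z + 1⟩ : Tally d))
      ∈ agd (fun x => h x + γ * ‖x - z‖ ^ 2) (ε * √(γ / (50 * (L + 2 * γ)))) L γ ((z, z), t) :=
    fun z t hz => agdOut_mem_agd (g := proximal h γ z) t ⟨S, hterm z hz⟩
  obtain ⟨z, hz⟩ : ∃ z, z = acIter (fun z => gradient (proximal h γ z)) ε γ L x := ⟨_, rfl⟩
  have hz0 : z 0 = x := by rw [hz]; rfl
  have hzs : ∀ j, z (j + 1)
      = agdOut (gradient (proximal h γ (z j))) (innerAccuracy ε γ L) L γ (z j) :=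
    fun j => by rw [hz]; rfl
  have hout' : out = z (sInf {n | ‖gradient h (z n)‖ ≤ ε}) := by rw [hout, hz]; rfl
  clear hout
  subst hz0
  obtain ⟨N, hmem, hlt, hN, hdist⟩ := path_bounds hε hγ z hD hx fun j hj hj' =>
    proximal_step hh hε hγ hL (hb (z j)) hj' (by rw [hzs]; exact hagd (z j) hj)
  have hNinf : sInf {n | ‖gradient h (z n)‖ ≤ ε} = N := by
    refine le_antisymm (Nat.sInf_le hmem) (le_csInf ⟨N, hmem⟩ fun n hn => ?_)
    by_contra hcon
    exact absurd hn (not_le.2 (hlt n (not_le.1 hcon)).1)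
  rw [hNinf] at hout'
  subst hout'
  set cnt : ℕ → ℕ := fun j =>
    agdCount (gradient (proximal h γ (z j))) (innerAccuracy ε γ L) L γ (z j) with hcnt
  refine ⟨N, ∑ j ∈ Finset.range N, cnt j, ?_, hN, hmem, hdist, ?_⟩
  · exact (Finset.sum_le_card_nsmul _ _ S fun j hj =>
      hcount (z j) (hlt j (Finset.mem_range.1 hj)).2).trans (by simp)
  · refine mem_fix_of_run N (fun j => (z j, (⟨t.ncg, t.agdSteps + ∑ i ∈ Finset.range j, cnt i,
        t.grads + 2 * (∑ i ∈ Finset.range j, cnt i) + 2 * j⟩ : Tally d))) ?_ ?_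
    · intro j hj
      simp only
      rw [if_neg (not_le.2 (hlt j hj).1), Part.mem_map_iff]
      refine ⟨_, hmemagd (z j) _ (hlt j hj).2, ?_⟩
      rw [← hzs]
      refine congrArg Sum.inr (Prod.ext rfl ?_)
      simp only [Tally.addGrads, Finset.sum_range_succ, hcnt, Tally.mk.injEq, true_and]
      constructor
      · omega
      · ring
    · simp only
      rw [if_pos hmem]
      exact Part.mem_some _

end AlmostConvex

/-! ### The regularized function is almost convex and smooth -/

section Regularized

variable {d : ℕ}

/-- Half the gradient of the squared distance to the ball of radius `r` about the origin. -/
noncomputable def ballGap (r : ℝ) (w : Vec d) : Vec d := (max (‖w‖ - r) 0 / ‖w‖) • w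

/-- The squared distance to a ball is convex, and its gradient `2 • ballGap r` is `2`-Lipschitz. -/
theorem sq_ballDist_sandwich {r : ℝ} (hr : 0 ≤ r) (w u : Vec d) :
    0 ≤ max (‖w + u‖ - r) 0 ^ 2 - max (‖w‖ - r) 0 ^ 2 - 2 * ⟪ballGap r w, u⟫ ∧
    max (‖w + u‖ - r) 0 ^ 2 - max (‖w‖ - r) 0 ^ 2 - 2 * ⟪ballGap r w, u⟫ ≤ ‖u‖ ^ 2 := by
  have hS0 : 0 ≤ max (‖w + u‖ - r) 0 := le_max_right _ _
  rcases le_or_gt ‖w‖ r with h | h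
  · have hs : max (‖w‖ - r) 0 = 0 := max_eq_right (by linarith)
    rw [ballGap, hs]
    simp only [zero_div, zero_smul, inner_zero_left]
    have h1 : max (‖w + u‖ - r) 0 ≤ ‖u‖ :=
      max_le (by linarith [norm_add_le w u]) (norm_nonneg u)
    constructor <;> nlinarith
  · have hw : 0 < ‖w‖ := by linarith
    have hs : max (‖w‖ - r) 0 = ‖w‖ - r := max_eq_left (by linarith)
    have hi : ⟪ballGap r w, u⟫ = (‖w‖ - r) * (⟪w, u⟫ / ‖w‖) := by
      rw [ballGap, hs, real_inner_smul_left]; ring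
    rw [hi, hs]
    set a := ⟪w, u⟫ / ‖w‖ with ha
    have hau : ⟪w, u⟫ = a * ‖w‖ := by rw [ha]; field_simp
    have hexp : ‖w + u‖ ^ 2 = ‖w‖ ^ 2 + 2 * (a * ‖w‖) + ‖u‖ ^ 2 := by
      rw [norm_add_sq_real, hau]
    constructor
    · have h1 : ‖w‖ + a ≤ ‖w + u‖ := by
        have h2 := real_inner_le_norm w (w + u)
        rw [inner_add_right, real_inner_self_eq_norm_sq, hau] at h2
        nlinarith
      have h3 : ‖w‖ - r + a ≤ max (‖w + u‖ - r) 0 := le_trans (by linarith) (le_max_left _ _)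
      rcases le_or_gt 0 (‖w‖ - r + a) with h4 | h4
      · have h5 := pow_le_pow_left₀ h4 h3 2
        nlinarith [sq_nonneg a]
      · nlinarith
    · -- The foot point of `w` lies in the ball, so `w + u` is at distance at most `‖u + n‖`.
      have h5 : ‖w + u‖ ≤ r + ‖u + ballGap r w‖ := by
        have h6 : w + u = (r / ‖w‖) • w + (u + ballGap r w) := by
          rw [ballGap, hs]
          match_scalars <;> field_simp
          ring
        calc ‖w + u‖ ≤ ‖(r / ‖w‖) • w‖ + ‖u + ballGap r w‖ := by
              conv_lhs => rw [h6]
              exact norm_add_le _ _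
          _ = r + ‖u + ballGap r w‖ := by
              rw [norm_smul, Real.norm_of_nonneg (by positivity)]; field_simp
      have h7 : max (‖w + u‖ - r) 0 ≤ ‖u + ballGap r w‖ :=
        max_le (by linarith) (norm_nonneg _)
      have h8 : ‖u + ballGap r w‖ ^ 2 = ‖u‖ ^ 2 + 2 * ((‖w‖ - r) * a) + (‖w‖ - r) ^ 2 := by
        rw [norm_add_sq_real, real_inner_comm, hi, ballGap, hs, norm_smul, mul_pow,
          Real.norm_eq_abs, sq_abs]
        field_simp
      nlinarith [norm_nonneg (u + ballGap r w)]

/-- Outside the ball of radius `2 r`, the gradient of the squared distance to the ball of radius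
`r` is strongly monotone. -/
theorem ballGap_strongly_monotone {r : ℝ} (hr : 0 < r) {w w' : Vec d} (hw : 2 * r ≤ ‖w‖)
    (hw' : 2 * r ≤ ‖w'‖) :
    ‖w - w'‖ ^ 2 / 2 ≤ ⟪ballGap r w - ballGap r w', w - w'⟫ := by
  have hn : 0 < ‖w‖ := by linarith
  have hm : 0 < ‖w'‖ := by linarith
  have hs : max (‖w‖ - r) 0 = ‖w‖ - r := max_eq_left (by linarith)
  have hs' : max (‖w'‖ - r) 0 = ‖w'‖ - r := max_eq_left (by linarith)
  have hcs : 0 ≤ ‖w‖ * ‖w'‖ - ⟪w, w'⟫ := sub_nonneg.2 (real_inner_le_norm w w')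
  have h1 : ⟪ballGap r w - ballGap r w', w - w'⟫ = ‖w - w'‖ ^ 2
      - (‖w‖ * ‖w'‖ - ⟪w, w'⟫) * (r / ‖w‖ + r / ‖w'‖) := by
    rw [norm_sub_sq_real, ballGap, ballGap, hs, hs']
    simp only [inner_sub_left, inner_sub_right, real_inner_smul_left, real_inner_self_eq_norm_sq,
      real_inner_comm w w']
    field_simp
    ring
  have h2 : r / ‖w‖ + r / ‖w'‖ ≤ 1 := by
    have e1 : r / ‖w‖ ≤ 1 / 2 := by rw [div_le_div_iff₀ hn two_pos]; linarith
    have e2 : r / ‖w'‖ ≤ 1 / 2 := by rw [div_le_div_iff₀ hm two_pos]; linarith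
    linarith
  have h3 : (‖w‖ * ‖w'‖ - ⟪w, w'⟫) * (r / ‖w‖ + r / ‖w'‖) ≤ ‖w‖ * ‖w'‖ - ⟪w, w'⟫ := by
    nlinarith
  have h4 := norm_sub_sq_real w w'
  rw [h1]
  nlinarith [sq_nonneg (‖w‖ - ‖w'‖)]

/-- The gradient of `regularized f L₁ L₂ ε₂ c`. -/
noncomputable def regularizedGradient (f : Vec d → ℝ) (L₁ L₂ ε₂ : ℝ) (c x : Vec d) : Vec d :=
  gradient f x + (2 * L₁) • ballGap (ε₂ / L₂) (x - c)

theorem hasGradientAt_of_quadratic {φ : Vec d → ℝ} {x G : Vec d} {C : ℝ}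
    (h : ∀ u, |φ (x + u) - φ x - ⟪G, u⟫| ≤ C * ‖u‖ ^ 2) : HasGradientAt φ G x := by
  rw [hasGradientAt_iff_hasFDerivAt]
  have h1 : (fun y => φ y - ⟪G, y⟫ - (φ x - ⟪G, x⟫)) =O[nhds x] fun y => ‖y - x‖ ^ 2 := by
    refine Asymptotics.IsBigO.of_bound C (Filter.Eventually.of_forall fun y => ?_)
    have := h (y - x)
    rw [add_sub_cancel, inner_sub_right] at this
    rw [Real.norm_eq_abs, Real.norm_of_nonneg (sq_nonneg _)]
    refine le_trans (le_of_eq (congrArg _ ?_)) this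
    ring
  have h2 := Asymptotics.IsBigO.hasFDerivAt (𝕜 := ℝ) h1 (by norm_num : 1 < 2)
  have h3 := ((h2.add_const (φ x - ⟪G, x⟫)).add (innerSL ℝ G).hasFDerivAt)
  refine (h3.congr_of_eventuallyEq (Filter.Eventually.of_forall fun y => ?_)).congr_fderiv ?_
  · simp
  · ext v
    simp

variable {f : Vec d → ℝ} {x₀ : Vec d} {L₁ L₂ Δ ε₂ : ℝ}

theorem hasGradientAt_regularized (hf : Differentiable ℝ f) (hL₁ : 0 ≤ L₁) (hr : 0 ≤ ε₂ / L₂)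
    (c x : Vec d) :
    HasGradientAt (regularized f L₁ L₂ ε₂ c) (regularizedGradient f L₁ L₂ ε₂ c x) x := by
  have h1 : HasGradientAt (fun x => L₁ * max (‖x - c‖ - ε₂ / L₂) 0 ^ 2)
      ((2 * L₁) • ballGap (ε₂ / L₂) (x - c)) x := by
    refine hasGradientAt_of_quadratic (C := L₁) fun u => ?_
    obtain ⟨h2, h3⟩ := sq_ballDist_sandwich hr (x - c) u
    rw [show x + u - c = x - c + u by abel, real_inner_smul_left, abs_le]
    constructor
    · have := mul_nonneg hL₁ h2
      have : 0 ≤ L₁ * ‖u‖ ^ 2 := by positivity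
      linarith
    · have := mul_le_mul_of_nonneg_left h3 hL₁
      linarith
  have h2 := (hf x).hasGradientAt.hasFDerivAt.add h1.hasFDerivAt
  rw [hasGradientAt_iff_hasFDerivAt, regularizedGradient, map_add]
  exact h2

theorem gradient_regularized (hf : Differentiable ℝ f) (hL₁ : 0 ≤ L₁) (hr : 0 ≤ ε₂ / L₂)
    (c x : Vec d) :
    gradient (regularized f L₁ L₂ ε₂ c) x = regularizedGradient f L₁ L₂ ε₂ c x :=
  (hasGradientAt_regularized hf hL₁ hr c x).gradient

theorem differentiable_regularized (hf : Differentiable ℝ f) (hL₁ : 0 ≤ L₁) (hr : 0 ≤ ε₂ / L₂)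
    (c : Vec d) : Differentiable ℝ (regularized f L₁ L₂ ε₂ c) := fun x =>
  (hasGradientAt_regularized hf hL₁ hr c x).differentiableAt

/-- Inside the ball of radius `2 ε₂ / L₂` the Hessian of `f` is at least `-3 ε₂`, since it is at
least `-ε₂` at the centre. -/
theorem Admissible.gradient_monotone_of_mem_ball (h : Admissible f x₀ L₁ L₂ Δ) (hL₂ : 0 < L₂)
    {c : Vec d} (hc : -ε₂ ≤ lambdaMin (hess f c : Module.End ℝ (Vec d))) {x y : Vec d}
    (hx : ‖x - c‖ ≤ 2 * (ε₂ / L₂)) (hy : ‖y - c‖ ≤ 2 * (ε₂ / L₂)) :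
    -(3 * ε₂) * ‖y - x‖ ^ 2 ≤ ⟪gradient f y - gradient f x, y - x⟫ := by
  set u := y - x with hu
  have key := sub_le_sub_of_deriv_le (T := 1) zero_le_one
    (φ := fun t => t * (-(3 * ε₂) * ‖u‖ ^ 2)) (φ' := fun _ => 1 * (-(3 * ε₂) * ‖u‖ ^ 2))
    (fun t => (hasDerivAt_id t).mul_const _)
    (h.hasDerivAt_gradient_line x u u) (fun t h0 h1 => by
      have hball : ‖x + t • u - c‖ ≤ 2 * (ε₂ / L₂) := by
        have e : x + t • u - c = (1 - t) • (x - c) + t • (y - c) := by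
          rw [hu]; match_scalars <;> ring
        rw [e]
        refine (norm_add_le _ _).trans ?_
        rw [norm_smul, norm_smul, Real.norm_of_nonneg h0, Real.norm_of_nonneg (sub_nonneg.2 h1)]
        nlinarith
      have h2 := lambdaMin_mul_norm_sq_le (h.hess_symm c) u
      rw [ContinuousLinearMap.coe_coe] at h2
      have h3 := neg_le_of_abs_le (abs_inner_clm_le (hess f (x + t • u) - hess f c) u)
      have h4 := h.hess_lipschitz (x + t • u) c
      have h5 : L₂ * ‖x + t • u - c‖ ≤ 2 * ε₂ := by
        calc L₂ * ‖x + t • u - c‖ ≤ L₂ * (2 * (ε₂ / L₂)) := by gcongr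
          _ = 2 * ε₂ := by field_simp
      rw [sub_apply, inner_sub_right] at h3
      rw [real_inner_comm]
      have h6 : ‖hess f (x + t • u) - hess f c‖ * ‖u‖ ^ 2 ≤ 2 * ε₂ * ‖u‖ ^ 2 := by
        gcongr; linarith
      have h7 : -ε₂ * ‖u‖ ^ 2 ≤ lambdaMin (hess f c : Module.End ℝ (Vec d)) * ‖u‖ ^ 2 := by
        gcongr
      linarith)
  simp [-inner_gradient_left] at key
  rw [inner_sub_left]
  have e : x + u = y := by rw [hu]; abel
  rw [e] at key
  linarith

theorem regularizedGradient_sub (f : Vec d → ℝ) (L₁ L₂ ε₂ : ℝ) (c x y : Vec d) :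
    ⟪regularizedGradient f L₁ L₂ ε₂ c y - regularizedGradient f L₁ L₂ ε₂ c x, y - x⟫
      = ⟪gradient f y - gradient f x, y - x⟫
        + 2 * L₁ * ⟪ballGap (ε₂ / L₂) (y - c) - ballGap (ε₂ / L₂) (x - c), y - x⟫ := by
  have : regularizedGradient f L₁ L₂ ε₂ c y - regularizedGradient f L₁ L₂ ε₂ c x
      = (gradient f y - gradient f x)
        + (2 * L₁) • (ballGap (ε₂ / L₂) (y - c) - ballGap (ε₂ / L₂) (x - c)) := by
    rw [regularizedGradient, regularizedGradient, smul_sub]; abel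
  rw [this, inner_add_left, real_inner_smul_left]

theorem ballGap_monotone {r : ℝ} (hr : 0 ≤ r) (w w' : Vec d) :
    0 ≤ ⟪ballGap r w' - ballGap r w, w' - w⟫ := by
  have h1 := (sq_ballDist_sandwich hr w (w' - w)).1
  have h2 := (sq_ballDist_sandwich hr w' (w - w')).1
  rw [add_sub_cancel] at h1 h2
  rw [← neg_sub w' w, inner_neg_right] at h2
  rw [inner_sub_left]
  linarith

/-- The regularized function is almost convex: in the ball of radius `2 ε₂ / L₂` because `f` is,
outside because the penalty compensates the curvature `-L₁` of `f`. A segment between the two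
regions is cut at the sphere. -/
theorem Admissible.regularizedGradient_monotone (h : Admissible f x₀ L₁ L₂ Δ) (hL₁ : 0 ≤ L₁)
    (hL₂ : 0 < L₂) (hε₂ : 0 < ε₂) {c : Vec d}
    (hc : -ε₂ ≤ lambdaMin (hess f c : Module.End ℝ (Vec d))) (x y : Vec d) :
    -(3 * ε₂) * ‖y - x‖ ^ 2
      ≤ ⟪regularizedGradient f L₁ L₂ ε₂ c y - regularizedGradient f L₁ L₂ ε₂ c x, y - x⟫ := by
  have hr : 0 < ε₂ / L₂ := by positivity
  have hin : ∀ x y : Vec d, ‖x - c‖ ≤ 2 * (ε₂ / L₂) → ‖y - c‖ ≤ 2 * (ε₂ / L₂) →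
      -(3 * ε₂) * ‖y - x‖ ^ 2
      ≤ ⟪regularizedGradient f L₁ L₂ ε₂ c y - regularizedGradient f L₁ L₂ ε₂ c x, y - x⟫ := by
    intro x y hx hy
    rw [regularizedGradient_sub]
    have h1 := h.gradient_monotone_of_mem_ball hL₂ hc hx hy
    have h2 := ballGap_monotone hr.le (x - c) (y - c)
    rw [sub_sub_sub_cancel_right] at h2
    have : 0 ≤ 2 * L₁ * ⟪ballGap (ε₂ / L₂) (y - c) - ballGap (ε₂ / L₂) (x - c), y - x⟫ := by
      positivity
    linarith
  have hout : ∀ x y : Vec d, 2 * (ε₂ / L₂) ≤ ‖x - c‖ → 2 * (ε₂ / L₂) ≤ ‖y - c‖ →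
      -(3 * ε₂) * ‖y - x‖ ^ 2
      ≤ ⟪regularizedGradient f L₁ L₂ ε₂ c y - regularizedGradient f L₁ L₂ ε₂ c x, y - x⟫ := by
    intro x y hx hy
    rw [regularizedGradient_sub]
    have h1 := neg_le_of_abs_le (abs_real_inner_le_norm (gradient f y - gradient f x) (y - x))
    have h2 := ballGap_strongly_monotone hr hy hx
    rw [sub_sub_sub_cancel_right] at h2
    have h3 := mul_le_mul_of_nonneg_left h2 (by positivity : 0 ≤ 2 * L₁)
    have h4 := mul_le_mul_of_nonneg_right (h.gradient_lipschitz y x) (norm_nonneg (y - x))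
    have h5 : 0 ≤ 3 * ε₂ * ‖y - x‖ ^ 2 := by positivity
    linarith
  -- The mixed case.
  have hmix : ∀ x y : Vec d, ‖x - c‖ ≤ 2 * (ε₂ / L₂) → 2 * (ε₂ / L₂) ≤ ‖y - c‖ →
      -(3 * ε₂) * ‖y - x‖ ^ 2
      ≤ ⟪regularizedGradient f L₁ L₂ ε₂ c y - regularizedGradient f L₁ L₂ ε₂ c x, y - x⟫ := by
    intro x y hx hy
    obtain ⟨s, hs, hsw⟩ : ∃ s ∈ Set.Icc (0 : ℝ) 1, ‖x + s • (y - x) - c‖ = 2 * (ε₂ / L₂) := by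
      have hcont : ContinuousOn (fun s : ℝ => ‖x + s • (y - x) - c‖) (Set.Icc 0 1) := by fun_prop
      have := intermediate_value_Icc zero_le_one hcont
      refine this ⟨?_, ?_⟩
      · simpa using hx
      · simpa using hy
    set w := x + s • (y - x) with hw
    have e1 : w - x = s • (y - x) := by rw [hw]; abel
    have e2 : y - w = (1 - s) • (y - x) := by rw [hw]; match_scalars <;> ring
    have h1 := hin x w hx hsw.le
    have h2 := hout w y hsw.ge hy
    rw [e1, norm_smul, real_inner_smul_right, Real.norm_of_nonneg hs.1] at h1
    rw [e2, norm_smul, real_inner_smul_right, Real.norm_of_nonneg (sub_nonneg.2 hs.2)] at h2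
    rw [inner_sub_left] at h1 h2 ⊢
    set Fx := ⟪regularizedGradient f L₁ L₂ ε₂ c x, y - x⟫
    set Fy := ⟪regularizedGradient f L₁ L₂ ε₂ c y, y - x⟫
    set Fw := ⟪regularizedGradient f L₁ L₂ ε₂ c w, y - x⟫
    have h3 : -(3 * ε₂) * s * ‖y - x‖ ^ 2 ≤ Fw - Fx := by
      rcases hs.1.eq_or_lt with h0 | h0
      · have : Fw = Fx := by simp [Fw, Fx, hw, ← h0]
        rw [this, ← h0]; simp
      · refine le_of_mul_le_mul_left ?_ h0
        nlinarith
    have h4 : -(3 * ε₂) * (1 - s) * ‖y - x‖ ^ 2 ≤ Fy - Fw := by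
      rcases (sub_nonneg.2 hs.2).eq_or_lt with h0 | h0
      · have h1s : s = 1 := by linarith
        have : Fw = Fy := by simp [Fw, Fy, hw, h1s]
        rw [this, h1s]; simp
      · refine le_of_mul_le_mul_left ?_ h0
        nlinarith
    nlinarith
  rcases le_total ‖x - c‖ (2 * (ε₂ / L₂)) with hx | hx <;>
    rcases le_total ‖y - c‖ (2 * (ε₂ / L₂)) with hy | hy
  · exact hin x y hx hy
  · exact hmix x y hx hy
  · have := hmix y x hy hx
    rwa [norm_sub_rev, ← neg_sub (regularizedGradient f L₁ L₂ ε₂ c y), ← neg_sub y x,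
      inner_neg_neg] at this
  · exact hout x y hx hy

theorem norm_sub_sq_shift (x y z : Vec d) :
    ‖y - z‖ ^ 2 = ‖x - z‖ ^ 2 + 2 * ⟪x - z, y - x⟫ + ‖y - x‖ ^ 2 := by
  rw [← norm_add_sq_real]
  congr 2
  abel

/-- The subproblems of Almost-Convex-AGD in NCG-B2 are `5 L₁`-smooth and `3 ε₂`-strongly convex. -/
theorem Admissible.quadraticBounds_proximal (h : Admissible f x₀ L₁ L₂ Δ) (hL₁ : 0 ≤ L₁)
    (hL₂ : 0 < L₂) (hε₂ : 0 < ε₂) (hε₂' : 3 * ε₂ ≤ L₁) {c : Vec d}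
    (hc : -ε₂ ≤ lambdaMin (hess f c : Module.End ℝ (Vec d))) (z : Vec d) :
    QuadraticBounds (proximal (regularized f L₁ L₂ ε₂ c) (3 * ε₂) z) (5 * L₁) (3 * ε₂) := by
  have hr : 0 ≤ ε₂ / L₂ := by positivity
  have hdiff := differentiable_regularized (ε₂ := ε₂) h.differentiable hL₁ hr c
  have hgrad : ∀ x, gradient (regularized f L₁ L₂ ε₂ c) x = regularizedGradient f L₁ L₂ ε₂ c x :=
    gradient_regularized h.differentiable hL₁ hr c
  have e : ∀ x y, ⟪regularizedGradient f L₁ L₂ ε₂ c x + (2 * (3 * ε₂)) • (x - z), y - x⟫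
      = ⟪regularizedGradient f L₁ L₂ ε₂ c x, y - x⟫ + 2 * (3 * ε₂) * ⟪x - z, y - x⟫ := by
    intro x y
    rw [inner_add_left, real_inner_smul_left]
  constructor
  · intro x y
    rw [gradient_proximal hdiff, hgrad, e]
    simp only [proximal]
    rw [norm_sub_sq_shift x y z]
    have h1 := le_of_gradient_lipschitz h.differentiable h.gradient_lipschitz x (y - x)
    rw [add_sub_cancel] at h1
    have h2 := mul_le_mul_of_nonneg_left (sq_ballDist_sandwich hr (x - c) (y - x)).2 hL₁
    rw [show x - c + (y - x) = y - c by abel] at h2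
    have h3 := mul_le_mul_of_nonneg_right hε₂' (sq_nonneg ‖y - x‖)
    simp only [regularized, regularizedGradient]
    rw [inner_add_left, real_inner_smul_left]
    have : 0 ≤ L₁ * ‖y - x‖ ^ 2 := by positivity
    linarith
  · intro x y
    rw [gradient_proximal hdiff, hgrad, e]
    simp only [proximal]
    rw [norm_sub_sq_shift x y z]
    have h1 := le_sub_of_le_gradient hdiff x (y - x) (c := -(3 * ε₂)) fun t h0 h1 => by
      rw [hgrad, hgrad]
      have h2 := h.regularizedGradient_monotone hL₁ hL₂ hε₂ hc x (x + t • (y - x))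
      rw [add_sub_cancel_left, norm_smul, Real.norm_of_nonneg h0, real_inner_smul_right,
        inner_sub_left] at h2
      rcases h0.eq_or_lt with h3 | h3
      · rw [← h3]; simp
      · refine le_of_mul_le_mul_left ?_ h3
        nlinarith
    rw [add_sub_cancel, hgrad] at h1
    linarith

end Regularized

/-! ### Measurability of the Lanczos method -/

section LanczosMeasurable

theorem measurable_nat_family {α β : Type*} [MeasurableSpace α] [MeasurableSpace β]
    {F : ℕ → α → β} {N : α → ℕ} (hF : ∀ n, Measurable (F n)) (hN : Measurable N) :
    Measurable fun a => F (N a) a := by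
  have h : Measurable fun p : ℕ × α => F p.1 p.2 := measurable_from_prod_countable_right hF
  exact h.comp (hN.prodMk measurable_id)

/-- The smallest eigenvalue of a symmetric matrix lies below `c` if and only if the Rayleigh quotient
does so at some vector of a fixed countable dense set. -/
theorem measurable_lambdaMin_toLin' {α : Type*} [MeasurableSpace α] {m : ℕ}
    {T : α → Matrix (Fin m) (Fin m) ℝ} (hT : ∀ i j, Measurable fun a => T a i j)
    (hs : ∀ a, (T a).IsHermitian) : Measurable fun a => lambdaMin (Matrix.toLin' (T a)) := by
  rcases Nat.eq_zero_or_pos m with rfl | hm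
  · have : (fun a => lambdaMin (Matrix.toLin' (T a))) = fun _ =>
        lambdaMin (Matrix.toLin' (0 : Matrix (Fin 0) (Fin 0) ℝ)) := by
      funext a; rw [Subsingleton.elim (T a) 0]
    rw [this]
    exact measurable_const
  have : Nonempty (Fin m) := ⟨⟨0, hm⟩⟩
  set A : α → EuclideanSpace ℝ (Fin m) →ₗ[ℝ] EuclideanSpace ℝ (Fin m) :=
    fun a => Matrix.toEuclideanLin (T a) with hA
  have hsymm : ∀ a, (A a).IsSymmetric := fun a => Matrix.isSymmetric_toEuclideanLin_iff.2 (hs a)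
  have hAm : ∀ v, Measurable fun a => ⟪v, A a v⟫ := by
    intro v
    simp only [hA, PiLp.inner_apply, Matrix.toLpLin_apply, Matrix.mulVec, dotProduct,
      RCLike.inner_apply, conj_trivial]
    fun_prop
  simp only [lambdaMin_toLin']
  refine measurable_of_Iio fun c => ?_
  have : (fun a => lambdaMin (A a)) ⁻¹' Set.Iio c
      = ⋃ n, {a | ⟪TopologicalSpace.denseSeq (EuclideanSpace ℝ (Fin m)) n,
          A a (TopologicalSpace.denseSeq (EuclideanSpace ℝ (Fin m)) n)⟫
          < c * ‖TopologicalSpace.denseSeq (EuclideanSpace ℝ (Fin m)) n‖ ^ 2} := by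
    ext a
    simp only [Set.mem_preimage, Set.mem_Iio, Set.mem_iUnion, Set.mem_ofPred_eq]
    constructor
    · intro h
      obtain ⟨v, hv, hAv⟩ := exists_unit_eigenvector_lambdaMin (hsymm a)
      have hopen : IsOpen {v | ⟪v, A a v⟫ < c * ‖v‖ ^ 2} := by
        refine isOpen_lt ?_ (by fun_prop)
        exact continuous_id.inner (A a).continuous_of_finiteDimensional
      obtain ⟨n, hn⟩ := (TopologicalSpace.denseRange_denseSeq _).exists_mem_open hopen
        ⟨v, by
          rw [Set.mem_ofPred_eq, hAv, real_inner_smul_right, real_inner_self_eq_norm_sq, hv]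
          linarith⟩
      exact ⟨n, hn⟩
    · rintro ⟨n, hn⟩
      have h := (lambdaMin_mul_norm_sq_le (hsymm a)
        (TopologicalSpace.denseSeq (EuclideanSpace ℝ (Fin m)) n)).trans_lt hn
      exact lt_of_mul_lt_mul_right h (sq_nonneg _)
  rw [this]
  exact MeasurableSet.iUnion fun n => measurableSet_lt (hAm _) measurable_const

variable {α : Type*} [MeasurableSpace α] {d : ℕ} {H : α → Vec d →L[ℝ] Vec d} {b : α → Vec d}

theorem measurable_residual {r q p : α → Vec d} {β : α → ℝ} (hr : Measurable r)
    (hq : Measurable q) (hp : Measurable p) (hβ : Measurable β) :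
    Measurable fun a => r a - (inner ℝ (q a) (r a)) • q a - β a • p a := by
  fun_prop

theorem measurable_lanczosState (hH : ∀ q : α → Vec d, Measurable q → Measurable fun a => H a (q a))
    (hb : Measurable b) (j : ℕ) : Measurable fun a => lanczosState (H a) (b a) j := by
  induction j with
  | zero => exact measurable_const.prodMk (hb.prodMk measurable_const)
  | succ j ih =>
    have hq : Measurable fun a => (lanczosState (H a) (b a) j).2.1 := ih.snd.fst
    have hp : Measurable fun a => (lanczosState (H a) (b a) j).1 := ih.fst
    have hβ : Measurable fun a => (lanczosState (H a) (b a) j).2.2 := ih.snd.snd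
    have hHq := hH _ hq
    have hw : Measurable fun a => H a (lanczosState (H a) (b a) j).2.1
        - (inner ℝ (lanczosState (H a) (b a) j).2.1 (H a (lanczosState (H a) (b a) j).2.1))
          • (lanczosState (H a) (b a) j).2.1
        - (lanczosState (H a) (b a) j).2.2 • (lanczosState (H a) (b a) j).1 :=
      measurable_residual hHq hq hp hβ
    exact hq.prodMk ((hw.norm.inv.smul hw).prodMk hw.norm)

theorem measurable_ritzCoeff {θ : α → ℝ} (hα : ∀ j, Measurable fun a => lanczosAlpha (H a) (b a) j)
    (hβ : ∀ j, Measurable fun a => lanczosBeta (H a) (b a) j) (hθ : Measurable θ) (j : ℕ) :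
    Measurable fun a => ritzCoeff (H a) (b a) (θ a) j := by
  induction j using Nat.strong_induction_on with
  | _ j ih =>
  match j, ih with
  | 0, _ => exact measurable_const
  | 1, _ => exact (hθ.sub (hα 0)).div (hβ 1)
  | j + 2, ih =>
    exact (((hθ.sub (hα (j + 1))).mul (ih (j + 1) (by omega))).sub
      ((hβ (j + 1)).mul (ih j (by omega)))).div (hβ (j + 2))

theorem measurable_lanczos (hH : ∀ q : α → Vec d, Measurable q → Measurable fun a => H a (q a))
    (hb : Measurable b) (k : ℕ) : Measurable fun a => lanczos (H a) (b a) k := by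
  have hst := measurable_lanczosState hH hb
  have hq : ∀ j, Measurable fun a => lanczosQ (H a) (b a) j := fun j => (hst j).snd.fst
  have hβ : ∀ j, Measurable fun a => lanczosBeta (H a) (b a) j := fun j => (hst j).snd.snd
  have hα : ∀ j, Measurable fun a => lanczosAlpha (H a) (b a) j := fun j =>
    (hq j).inner (hH _ (hq j))
  have hdim : Measurable fun a => lanczosDim (H a) (b a) k := by
    simp only [lanczosDim, Finset.card_filter]
    refine Finset.measurable_sum _ fun j _ => ?_
    exact Measurable.ite (measurableSet_lt measurable_const (hq j).norm) measurable_const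
      measurable_const
  have hT : ∀ (m : ℕ) (i j : Fin m), Measurable fun a => lanczosT (H a) (b a) m i j := by
    intro m i j
    simp only [lanczosT, Matrix.of_apply]
    split_ifs
    · exact hα _
    · exact hβ _
    · exact hβ _
    · exact measurable_const
  have hθ : Measurable fun a => ritzValue (H a) (b a) k :=
    measurable_nat_family (F := fun m a => lambdaMin (Matrix.toLin' (lanczosT (H a) (b a) m)))
      (fun m => measurable_lambdaMin_toLin' (hT m) fun a => lanczosT_isHermitian _ _ _) hdim
  have hu : Measurable fun a => ∑ j ∈ Finset.range (lanczosDim (H a) (b a) k),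
      ritzCoeff (H a) (b a) (ritzValue (H a) (b a) k) j • lanczosQ (H a) (b a) j :=
    measurable_nat_family (F := fun m a => ∑ j ∈ Finset.range m,
      ritzCoeff (H a) (b a) (ritzValue (H a) (b a) k) j • lanczosQ (H a) (b a) j)
      (fun m => Finset.measurable_sum _ fun j _ => (measurable_ritzCoeff hα hβ hθ j).smul (hq j))
      hdim
  exact hu.norm.inv.smul hu

end LanczosMeasurable

/-! ### Measurability of the accelerated methods -/

section AGDMeasurable

variable {α : Type*} [MeasurableSpace α] {d : ℕ}

theorem measurable_sInf_nat {p : ℕ → α → Prop} (hp : ∀ n, MeasurableSet {a | p n a}) :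
    Measurable fun a => sInf {n | p n a} := by
  classical
  have hnone : MeasurableSet {a | ∀ n, ¬ p n a} := by
    rw [Set.ofPred_forall]; exact MeasurableSet.iInter fun n => (hp n).compl
  have hex : ∀ a, ∃ n, p n a ∨ ∀ m, ¬ p m a := fun a => by
    by_cases h : ∃ n, p n a
    · exact ⟨h.choose, Or.inl h.choose_spec⟩
    · exact ⟨0, Or.inr (not_exists.1 h)⟩
  have heq : (fun a => sInf {n | p n a}) = fun a => Nat.find (hex a) := by
    funext a
    by_cases h : ∃ n, p n a
    · refine le_antisymm (Nat.sInf_le ?_) (Nat.find_min' _ (Or.inl (Nat.sInf_mem (s := {n | p n a}) h)))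
      exact (Nat.find_spec (hex a)).resolve_right fun h' => h' h.choose h.choose_spec
    · have h1 : {n | p n a} = ∅ := Set.eq_empty_of_forall_notMem (not_exists.1 h)
      rw [h1, Nat.sInf_empty]
      exact ((Nat.find_eq_zero (hex a)).2 (Or.inr (not_exists.1 h))).symm
  rw [heq]
  exact measurable_find hex fun n => (hp n).union hnone

theorem measurable_sub_const_smul {u v : α → Vec d} (c : ℝ) (hu : Measurable u)
    (hv : Measurable v) : Measurable fun a => u a - c • v a := by
  fun_prop

theorem measurable_agdIter {G : α → Vec d → Vec d} {x : α → Vec d} (L m : ℝ)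
    (hG : ∀ q : α → Vec d, Measurable q → Measurable fun a => G a (q a)) (hx : Measurable x)
    (n : ℕ) : Measurable fun a => agdIter (G a) L m (x a) n := by
  induction n with
  | zero => exact hx.prodMk hx
  | succ n ih =>
    have h1 := ih.fst
    have h2 := ih.snd
    have h3 := hG _ h2
    have h4 : Measurable fun a => (agdIter (G a) L m (x a) n).2
        - (1 / L) • G a (agdIter (G a) L m (x a) n).2 :=
      measurable_sub_const_smul _ h2 h3
    exact h4.prodMk (measurable_sub_const_smul _ (h4.const_smul (1 + m)) h1)

theorem measurable_agdOut {G : α → Vec d → Vec d} {x : α → Vec d} (ε L σ : ℝ)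
    (hG : ∀ q : α → Vec d, Measurable q → Measurable fun a => G a (q a)) (hx : Measurable x) :
    Measurable fun a => agdOut (G a) ε L σ (x a) := by
  have hit := measurable_agdIter L (momentum L σ) hG hx
  exact measurable_nat_family (F := fun n a => (agdIter (G a) L (momentum L σ) (x a) n).1)
    (fun n => (hit n).fst) (measurable_sInf_nat fun n =>
      measurableSet_le (hG _ (hit n).fst).norm measurable_const)

theorem measurable_acOut {g : α → Vec d → Vec d} {G : α → Vec d → Vec d → Vec d} {x : α → Vec d}
    (ε γ L : ℝ) (hg : ∀ q : α → Vec d, Measurable q → Measurable fun a => g a (q a))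
    (hG : ∀ z q : α → Vec d, Measurable z → Measurable q → Measurable fun a => G a (z a) (q a))
    (hx : Measurable x) : Measurable fun a => acOut (g a) (G a) ε γ L (x a) := by
  have hit : ∀ n, Measurable fun a => acIter (G a) ε γ L (x a) n := by
    intro n
    induction n with
    | zero => exact hx
    | succ n ih => exact measurable_agdOut _ _ _ (fun q hq => hG _ q ih hq) ih
  exact measurable_nat_family (F := fun n a => acIter (G a) ε γ L (x a) n) hit
    (measurable_sInf_nat fun n => measurableSet_le (hg _ (hit n)).norm measurable_const)

end AGDMeasurable

/-! ### The Markov chain of the points of the NCG steps -/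

section Chain

variable {d : ℕ}

/-- The noise level of the NCG steps of NCG-A2. -/
noncomputable def a2Noise (f : Vec d → ℝ) (e α : ℝ) (x : Vec d) : ℝ :=
  max (e ^ α) (‖gradient f x‖ ^ α) / 2

/-- NCG-A2 with parameters `e, α` and failure probability `δ` per NCG step returns at `x`, if the
random vector is `b`. -/
def A2Returns (f : Vec d → ℝ) (L₁ e α δ : ℝ) (x b : Vec d) : Prop :=
  -(e ^ α) / 2 < ncgCurv f L₁ b x (a2Noise f e α x) δ ∧ ‖gradient f x‖ ≤ e

/-- The point returned by Almost-Convex-AGD in NCG-B2, started at `x`. -/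
noncomputable def b2Out (f : Vec d → ℝ) (L₁ L₂ ε₁ ε₂ : ℝ) (x : Vec d) : Vec d :=
  acOut (regularizedGradient f L₁ L₂ ε₂ x)
    (fun z y => regularizedGradient f L₁ L₂ ε₂ x y + (2 * (3 * ε₂)) • (y - z))
    (ε₁ / 2) (3 * ε₂) (5 * L₁) x

open Classical in
/-- The point of the next NCG step of NCG-B2 after the NCG step at `x` with random vector `b`,
where `e, α, δ` are the parameters of the NCG-A2 calls. Termination of the whole algorithm is
ignored, so that this is the transition of a homogeneous Markov chain. -/
noncomputable def b2Next (f : Vec d → ℝ) (L₁ L₂ ε₁ ε₂ e α δ : ℝ) (x b : Vec d) : Vec d :=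
  if A2Returns f L₁ e α δ x b then b2Out f L₁ L₂ ε₁ ε₂ x
  else ncgNext f L₁ L₂ b x (a2Noise f e α x) δ

/-- The path of a process driven by the sequence `ξ`. -/
def drivenPath {E S : Type*} (Φ : E → S → E) (x₀ : E) (ξ : ℕ → S) : ℕ → E
  | 0 => x₀
  | n + 1 => Φ (drivenPath Φ x₀ ξ n) (ξ n)

/-- The state before step `n` is independent of the `n`-th driving variable, so that the
probability of a bad event at one of the first `N` steps is at most `N` times the largest
conditional probability. -/
theorem measure_exists_bad_le {E S Ω : Type*} [MeasurableSpace E] [MeasurableSpace S]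
    [MeasurableSpace Ω] {P : Measure Ω} [IsProbabilityMeasure P] {U : Measure S}
    {Φ : E → S → E} (hΦ : Measurable fun p : E × S => Φ p.1 p.2) (x₀ : E) {ξ : ℕ → Ω → S}
    (hξ : ∀ n, Measurable (ξ n)) (hind : iIndepFun ξ P) (hU : ∀ n, P.map (ξ n) = U)
    {B : Set (E × S)} (hB : MeasurableSet B) {p : ENNReal}
    (hp : ∀ x, U {b | (x, b) ∈ B} ≤ p) (N : ℕ) :
    P {ω | ∃ n < N, (drivenPath Φ x₀ (fun i => ξ i ω) n, ξ n ω) ∈ B} ≤ N * p := by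
  set X : ℕ → Ω → E := fun n ω => drivenPath Φ x₀ (fun i => ξ i ω) n with hX
  set m : ℕ → MeasurableSpace Ω := fun n => MeasurableSpace.comap (ξ n) inferInstance with hm
  have hXm : ∀ n, Measurable[⨆ i ∈ {i | i < n}, m i] (X n) := by
    intro n
    induction n with
    | zero => exact @measurable_const _ _ _ (_) _
    | succ n ih =>
      have h1 : Measurable[⨆ i ∈ {i | i < n + 1}, m i] (X n) :=
        ih.mono (biSup_mono fun i (hi : i < n) => (Nat.lt_succ_of_lt hi : i < n + 1)) le_rfl
      have h2 : Measurable[⨆ i ∈ {i | i < n + 1}, m i] (ξ n) :=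
        (comap_measurable (ξ n)).mono
          (le_biSup (f := m) (s := {i | i < n + 1}) (Nat.lt_succ_self n : n < n + 1)) le_rfl
      exact hΦ.comp (@Measurable.prodMk _ _ _ _ _ (_) _ _ h1 h2)
  have hle : ∀ i, m i ≤ ‹MeasurableSpace Ω› := fun i => (hξ i).comap_le
  have hXm' : ∀ n, Measurable (X n) := fun n => (hXm n).mono (iSup₂_le fun i _ => hle i) le_rfl
  have hindep : ∀ n, IndepFun (X n) (ξ n) P := by
    intro n
    rw [IndepFun_iff_Indep]
    have h1 := indep_iSup_of_disjoint hle hind.iIndep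
      (S := {i | i < n}) (T := {n}) (by simp)
    refine indep_of_indep_of_le_left (indep_of_indep_of_le_right h1 ?_) (hXm n).comap_le
    exact le_biSup (f := m) (s := {n}) (Set.mem_singleton n)
  have hprob : IsProbabilityMeasure U := by
    rw [← hU 0]; exact Measure.isProbabilityMeasure_map (hξ 0).aemeasurable
  have hone : ∀ n, P {ω | (X n ω, ξ n ω) ∈ B} ≤ p := by
    intro n
    have h1 := (indepFun_iff_map_prod_eq_prod_map_map (hXm' n).aemeasurable
      (hξ n).aemeasurable).1 (hindep n)
    have h2 : P {ω | (X n ω, ξ n ω) ∈ B} = (P.map fun ω => (X n ω, ξ n ω)) B :=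
      (Measure.map_apply ((hXm' n).prodMk (hξ n)) hB).symm
    have hprob' : IsProbabilityMeasure (P.map (X n)) :=
      Measure.isProbabilityMeasure_map (hXm' n).aemeasurable
    rw [h2, h1, hU, Measure.prod_apply hB]
    calc ∫⁻ x, U (Prod.mk x ⁻¹' B) ∂(P.map (X n)) ≤ ∫⁻ _, p ∂(P.map (X n)) :=
          lintegral_mono fun x => hp x
      _ = p := by simp
  have hsub : {ω | ∃ n < N, (X n ω, ξ n ω) ∈ B}
      ⊆ ⋃ n ∈ Finset.range N, {ω | (X n ω, ξ n ω) ∈ B} := by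
    rintro ω ⟨n, hn, hω⟩
    exact Set.mem_biUnion (Finset.mem_coe.2 (Finset.mem_range.2 hn)) hω
  refine (measure_mono hsub).trans ((measure_biUnion_finset_le _ _).trans ?_)
  refine (Finset.sum_le_sum fun n _ => hone n).trans ?_
  simp

variable {f : Vec d → ℝ} {x₀ : Vec d} {L₁ L₂ Δ : ℝ}

theorem Admissible.continuous_hess (h : Admissible f x₀ L₁ L₂ Δ) : Continuous (hess f) := by
  refine (LipschitzWith.of_dist_le_mul (K := L₂.toNNReal) fun x y => ?_).continuous
  rw [dist_eq_norm, dist_eq_norm]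
  refine (h.hess_lipschitz x y).trans ?_
  gcongr
  exact Real.le_coe_toNNReal L₂

theorem Admissible.measurable_hess_apply (h : Admissible f x₀ L₁ L₂ Δ) {α : Type*}
    [MeasurableSpace α] {x q : α → Vec d} (hx : Measurable x) (hq : Measurable q) :
    Measurable fun a => hess f (x a) (q a) := by
  have h1 : Continuous fun p : Vec d × Vec d => hess f p.1 p.2 :=
    (h.continuous_hess.comp continuous_fst).clm_apply continuous_snd
  exact h1.measurable.comp (hx.prodMk hq)

theorem Admissible.measurable_gradient (h : Admissible f x₀ L₁ L₂ Δ) : Measurable (gradient f) :=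
  h.differentiable_gradient.continuous.measurable

theorem Admissible.measurable_a2Noise (h : Admissible f x₀ L₁ L₂ Δ) (e α : ℝ) :
    Measurable (a2Noise f e α) := by
  have := h.measurable_gradient
  unfold a2Noise
  fun_prop

theorem Admissible.measurable_ncgDir (h : Admissible f x₀ L₁ L₂ Δ) {α : Type*}
    [MeasurableSpace α] {x b : α → Vec d} {ε : α → ℝ} (hx : Measurable x) (hb : Measurable b)
    (hε : Measurable ε) (δ : ℝ) : Measurable fun a => ncgDir f L₁ (b a) (x a) (ε a) δ := by
  refine measurable_nat_family (F := fun k a => lanczos (hess f (x a)) (b a) k)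
    (measurable_lanczos (fun q hq => h.measurable_hess_apply hx hq) hb) ?_
  unfold lanczosIters
  fun_prop

theorem Admissible.measurable_ncgCurv (h : Admissible f x₀ L₁ L₂ Δ) {α : Type*}
    [MeasurableSpace α] {x b : α → Vec d} {ε : α → ℝ} (hx : Measurable x) (hb : Measurable b)
    (hε : Measurable ε) (δ : ℝ) : Measurable fun a => ncgCurv f L₁ (b a) (x a) (ε a) δ :=
  (h.measurable_ncgDir hx hb hε δ).inner
    (h.measurable_hess_apply hx (h.measurable_ncgDir hx hb hε δ))

theorem measurable_sgn : Measurable sgn :=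
  Measurable.ite measurableSet_Ici measurable_const measurable_const

theorem Admissible.measurable_ncgNext (h : Admissible f x₀ L₁ L₂ Δ) {α : Type*}
    [MeasurableSpace α] {x b : α → Vec d} {ε : α → ℝ} (hx : Measurable x) (hb : Measurable b)
    (hε : Measurable ε) (δ : ℝ) : Measurable fun a => ncgNext f L₁ L₂ (b a) (x a) (ε a) δ := by
  have hv := h.measurable_ncgDir hx hb hε δ
  have hc := h.measurable_ncgCurv hx hb hε δ
  have hg : Measurable fun a => gradient f (x a) := h.measurable_gradient.comp hx
  have hs : Measurable fun a => sgn (inner ℝ (ncgDir f L₁ (b a) (x a) (ε a) δ) (gradient f (x a))) :=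
    measurable_sgn.comp (hv.inner hg)
  unfold ncgNext
  refine Measurable.ite ?_ ?_ ?_
  · have h1 : MeasurableSet {a | ncgCurv f L₁ (b a) (x a) (ε a) δ < 0} :=
      measurableSet_lt hc measurable_const
    have h2 : MeasurableSet {a | ‖gradient f (x a)‖ ^ 2 / (2 * L₁)
        < 2 * |ncgCurv f L₁ (b a) (x a) (ε a) δ| ^ 3 / (3 * L₂ ^ 2)} := by
      have : Measurable fun a => |ncgCurv f L₁ (b a) (x a) (ε a) δ| := hc.norm
      refine measurableSet_lt ?_ ?_ <;> fun_prop
    exact h1.inter h2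
  · have : Measurable fun a => |ncgCurv f L₁ (b a) (x a) (ε a) δ| := hc.norm
    fun_prop
  · fun_prop

theorem Admissible.measurable_regularizedGradient (h : Admissible f x₀ L₁ L₂ Δ) (ε₂ : ℝ)
    {α : Type*} [MeasurableSpace α] {c x : α → Vec d} (hc : Measurable c) (hx : Measurable x) :
    Measurable fun a => regularizedGradient f L₁ L₂ ε₂ (c a) (x a) := by
  have hg : Measurable fun a => gradient f (x a) := h.measurable_gradient.comp hx
  unfold regularizedGradient ballGap
  fun_prop

theorem Admissible.measurable_b2Out (h : Admissible f x₀ L₁ L₂ Δ) (ε₁ ε₂ : ℝ) :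
    Measurable (b2Out f L₁ L₂ ε₁ ε₂) := by
  refine measurable_acOut _ _ _ (fun q hq => h.measurable_regularizedGradient ε₂ measurable_id hq)
    (fun z q hz hq => ?_) measurable_id
  exact (h.measurable_regularizedGradient ε₂ measurable_id hq).add
    ((hq.sub hz).const_smul (2 * (3 * ε₂)))

theorem Admissible.measurable_b2Next (h : Admissible f x₀ L₁ L₂ Δ) (ε₁ ε₂ e α δ : ℝ) :
    Measurable fun p : Vec d × Metric.sphere (0 : Vec d) 1 =>
      b2Next f L₁ L₂ ε₁ ε₂ e α δ p.1 p.2 := by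
  have hx : Measurable fun p : Vec d × Metric.sphere (0 : Vec d) 1 => p.1 := measurable_fst
  have hb : Measurable fun p : Vec d × Metric.sphere (0 : Vec d) 1 => (p.2 : Vec d) :=
    measurable_subtype_coe.comp measurable_snd
  have hε := (h.measurable_a2Noise e α).comp hx
  classical
  refine Measurable.ite ?_ ((h.measurable_b2Out ε₁ ε₂).comp hx) (h.measurable_ncgNext hx hb hε δ)
  exact (measurableSet_lt measurable_const (h.measurable_ncgCurv hx hb hε δ)).inter
    (measurableSet_le (h.measurable_gradient.comp hx).norm measurable_const)

/-- The Lanczos method of an NCG step of NCG-A2 misses the smallest eigenvalue by more than its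
noise level. -/
def LanczosFails (f : Vec d → ℝ) (L₁ e α δ : ℝ) (x b : Vec d) : Prop :=
  lambdaMin (hess f x : Module.End ℝ (Vec d)) + a2Noise f e α x
    < ncgCurv f L₁ b x (a2Noise f e α x) δ

theorem Admissible.measurableSet_lanczosFails (h : Admissible f x₀ L₁ L₂ Δ) (hd : 0 < d)
    (e α δ : ℝ) : MeasurableSet {p : Vec d × Metric.sphere (0 : Vec d) 1 |
      LanczosFails f L₁ e α δ p.1 p.2} := by
  have hx : Measurable fun p : Vec d × Metric.sphere (0 : Vec d) 1 => p.1 := measurable_fst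
  have hb : Measurable fun p : Vec d × Metric.sphere (0 : Vec d) 1 => (p.2 : Vec d) :=
    measurable_subtype_coe.comp measurable_snd
  have hε := (h.measurable_a2Noise e α).comp hx
  have hlam : Continuous fun x => lambdaMin (hess f x : Module.End ℝ (Vec d)) := by
    refine (LipschitzWith.of_le_add_mul L₂.toNNReal fun x y => ?_).continuous
    rw [dist_eq_norm]
    refine (h.lambdaMin_hess_lipschitz hd x y).trans ?_
    gcongr
    exact Real.le_coe_toNNReal L₂
  exact measurableSet_lt ((hlam.measurable.comp hx).add hε) (h.measurable_ncgCurv hx hb hε δ)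

/-- The probability that the Lanczos method fails at one of the first `N` NCG steps. -/
theorem Admissible.measure_exists_lanczosFails_le (h : Admissible f x₀ L₁ L₂ Δ) (hd : 0 < d)
    (hL₁ : 0 < L₁) {e α δ : ℝ} (he : 0 < e) (hδ0 : 0 < δ) (hδ1 : δ < 1) (ε₁ ε₂ : ℝ)
    {Ω : Type*} [MeasurableSpace Ω] {P : Measure Ω} [IsProbabilityMeasure P]
    {ξ : ℕ → Ω → Metric.sphere (0 : Vec d) 1} (hξ : ∀ n, Measurable (ξ n)) (hind : iIndepFun ξ P)
    (hU : ∀ n, P.map (ξ n) = uniformSphere d) (N : ℕ) :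
    P {ω | ∃ n < N, LanczosFails f L₁ e α δ
        (drivenPath (b2Next f L₁ L₂ ε₁ ε₂ e α δ) x₀ (fun i => (ξ i ω : Vec d)) n) (ξ n ω)}
      ≤ N * ENNReal.ofReal δ := by
  have hpos : ∀ x, 0 < a2Noise f e α x := fun x =>
    half_pos (lt_max_of_lt_left (Real.rpow_pos_of_pos he α))
  have h1 := measure_exists_bad_le (Φ := fun (x : Vec d) (b : Metric.sphere (0 : Vec d) 1) =>
      b2Next f L₁ L₂ ε₁ ε₂ e α δ x b) (h.measurable_b2Next ε₁ ε₂ e α δ) x₀ hξ hind hU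
    (h.measurableSet_lanczosFails hd e α δ) (p := ENNReal.ofReal δ) (fun x =>
      uniformSphere_lanczos_failure_le (h.hess_symm x) hL₁ (h.norm_hess_le hL₁.le x) hd (hpos x)
        hδ0 hδ1) N
  have h2 : ∀ (b : ℕ → Metric.sphere (0 : Vec d) 1) (n : ℕ),
      drivenPath (fun (x : Vec d) (b : Metric.sphere (0 : Vec d) 1) =>
        b2Next f L₁ L₂ ε₁ ε₂ e α δ x b) x₀ b n
      = drivenPath (b2Next f L₁ L₂ ε₁ ε₂ e α δ) x₀ (fun i => (b i : Vec d)) n := by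
    intro b n
    induction n with
    | zero => rfl
    | succ n ih => simp only [drivenPath, ih]
  simp only [Set.mem_ofPred_eq, h2] at h1
  exact h1

end Chain

/-! ### One step of the algorithms -/

section Steps

variable {d : ℕ} {f : Vec d → ℝ} {x₀ : Vec d} {L₁ L₂ Δ : ℝ}

theorem Admissible.norm_ncgDir (h : Admissible f x₀ L₁ L₂ Δ) (hd : 0 < d) (x : Vec d) {b : Vec d}
    (hb : ‖b‖ = 1) (ε δ : ℝ) : ‖ncgDir f L₁ b x ε δ‖ = 1 :=
  (lanczos_spec (h.hess_symm x) hb (by rw [lanczosIters]; omega)).1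

/-- An NCG step decreases `f` by at least the larger of the two guaranteed decreases. -/
theorem Admissible.ncgNext_le (h : Admissible f x₀ L₁ L₂ Δ) (hd : 0 < d) (hL₁ : 0 < L₁)
    (hL₂ : 0 < L₂) (x : Vec d) {b : Vec d} (hb : ‖b‖ = 1) (ε δ : ℝ) :
    f (ncgNext f L₁ L₂ b x ε δ) ≤ f x - ‖gradient f x‖ ^ 2 / (2 * L₁) ∧
    (ncgCurv f L₁ b x ε δ < 0 → f (ncgNext f L₁ L₂ b x ε δ)
      ≤ f x - 2 * |ncgCurv f L₁ b x ε δ| ^ 3 / (3 * L₂ ^ 2)) := by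
  rw [ncgNext]
  by_cases hc : ncgCurv f L₁ b x ε δ < 0 ∧ ‖gradient f x‖ ^ 2 / (2 * L₁)
      < 2 * |ncgCurv f L₁ b x ε δ| ^ 3 / (3 * L₂ ^ 2)
  · have h1 := h.negative_curvature_step hL₂ x _ (h.norm_ncgDir hd x hb ε δ) hc.1
    rw [if_pos hc]
    change f (x - (2 * |ncgCurv f L₁ b x ε δ| / L₂ * _) • _)
      ≤ f x - 2 * |ncgCurv f L₁ b x ε δ| ^ 3 / (3 * L₂ ^ 2) at h1
    exact ⟨by linarith [hc.2], fun _ => h1⟩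
  · rw [if_neg hc]
    have h1 := h.gradient_step hL₁ x
    refine ⟨h1, fun h2 => ?_⟩
    have h3 := not_lt.1 fun h3 => hc ⟨h2, h3⟩
    linarith

/-- An NCG step after which NCG-A2 does not return decreases `f` by `ε₂³ / max (12 L₂²) (2 L₁)`. -/
theorem Admissible.ncgNext_le_of_not_returns (h : Admissible f x₀ L₁ L₂ Δ) (hd : 0 < d)
    (hL₁ : 0 < L₁) (hL₂ : 0 < L₂) {e α ε₂ δ : ℝ} (he : 0 < e) (hε₂ : 0 < ε₂) (heα : e ^ α = ε₂)
    (he2 : e ^ 2 = ε₂ ^ 3) (x : Vec d) {b : Vec d} (hb : ‖b‖ = 1)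
    (hret : ¬ A2Returns f L₁ e α δ x b) :
    f (ncgNext f L₁ L₂ b x (a2Noise f e α x) δ)
      ≤ f x - ε₂ ^ 3 / max (12 * L₂ ^ 2) (2 * L₁) := by
  obtain ⟨h1, h2⟩ := h.ncgNext_le hd hL₁ hL₂ x hb (a2Noise f e α x) δ
  rw [A2Returns, not_and_or, not_lt, not_le, heα] at hret
  rcases hret with h3 | h3
  · set c := ncgCurv f L₁ b x (a2Noise f e α x) δ
    have hc : c < 0 := by linarith
    have h4 := h2 hc
    have h5 : ε₂ / 2 ≤ |c| := by rw [abs_of_neg hc]; linarith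
    have h6 : ε₂ ^ 3 / max (12 * L₂ ^ 2) (2 * L₁) ≤ 2 * |c| ^ 3 / (3 * L₂ ^ 2) := by
      calc ε₂ ^ 3 / max (12 * L₂ ^ 2) (2 * L₁) ≤ ε₂ ^ 3 / (12 * L₂ ^ 2) := by
            gcongr; exact le_max_left _ _
        _ = 2 * (ε₂ / 2) ^ 3 / (3 * L₂ ^ 2) := by field_simp; norm_num
        _ ≤ 2 * |c| ^ 3 / (3 * L₂ ^ 2) := by gcongr
    linarith
  · have h6 : ε₂ ^ 3 / max (12 * L₂ ^ 2) (2 * L₁) ≤ ‖gradient f x‖ ^ 2 / (2 * L₁) := by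
      rw [← he2]
      gcongr
      exact le_max_right _ _
    linarith

theorem lambdaMin_of_returns {e α ε₂ δ : ℝ} (hα : 0 ≤ α) (heα : e ^ α = ε₂) {x b : Vec d}
    (hret : A2Returns f L₁ e α δ x b) (hgood : ¬ LanczosFails f L₁ e α δ x b) :
    -ε₂ ≤ lambdaMin (hess f x : Module.End ℝ (Vec d)) := by
  obtain ⟨h1, h2⟩ := hret
  rw [heα] at h1
  rw [LanczosFails, not_lt] at hgood
  have h3 : a2Noise f e α x = ε₂ / 2 := by
    rw [a2Noise, max_eq_left, heα]
    exact Real.rpow_le_rpow (norm_nonneg _) h2 hα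
  rw [h3] at hgood h1
  linarith

theorem le_regularized (f : Vec d → ℝ) (hL₁ : 0 ≤ L₁) (L₂ ε₂ : ℝ) (x y : Vec d) :
    f y ≤ regularized f L₁ L₂ ε₂ x y := by
  rw [regularized]
  have : 0 ≤ L₁ * max (‖y - x‖ - ε₂ / L₂) 0 ^ 2 := by positivity
  linarith

/-- The call of Almost-Convex-AGD in NCG-B2 at a point whose Hessian is at least `-ε₂`. Unless the
returned point has a small gradient, the penalty is active there, so the point is at distance at
least `ε₂ / L₂` and `f` has decreased accordingly. -/
theorem Admissible.b2Out_spec (h : Admissible f x₀ L₁ L₂ Δ) (hL₁ : 0 < L₁) (hL₂ : 0 < L₂)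
    {ε₁ ε₂ : ℝ} (hε₁ : 0 < ε₁) (hε₂ : 0 < ε₂) (hε₂' : 3 * ε₂ ≤ L₁) {x : Vec d}
    (hx0 : f x ≤ f x₀) (hgrad : ε₁ < ‖gradient f x‖)
    (hlam : -ε₂ ≤ lambdaMin (hess f x : Module.End ℝ (Vec d))) {S : ℕ}
    (hS : 4 * (5 * L₁) * Δ * Real.exp (-(S / √(5 * L₁ / (3 * ε₂))))
      ≤ innerAccuracy (ε₁ / 2) (3 * ε₂) (5 * L₁) ^ 2) (t : Tally d) :
    ∃ J s : ℕ, s ≤ J * S ∧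
      (J : ℝ) ≤ 1 + 60 * ε₂ / ε₁ ^ 2 * (f x - f (b2Out f L₁ L₂ ε₁ ε₂ x)) ∧
      f (b2Out f L₁ L₂ ε₁ ε₂ x) ≤ f x ∧
      (ε₁ < ‖gradient f (b2Out f L₁ L₂ ε₁ ε₂ x)‖ →
        ε₂ ^ 3 / max (12 * L₂ ^ 2) (2 * L₁) ≤ f x - f (b2Out f L₁ L₂ ε₁ ε₂ x) ∨
        ε₁ * ε₂ / (2 * √10 * L₂) ≤ f x - f (b2Out f L₁ L₂ ε₁ ε₂ x)) ∧
      (b2Out f L₁ L₂ ε₁ ε₂ x, (⟨t.ncg, t.agdSteps + s, t.grads + 2 * s + 2 * J + 1⟩ : Tally d))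
        ∈ almostConvexAGD (regularized f L₁ L₂ ε₂ x) (ε₁ / 2) (3 * ε₂) (5 * L₁) (x, t) := by
  have hr : 0 < ε₂ / L₂ := by positivity
  set g := regularized f L₁ L₂ ε₂ x with hg
  have hdiff : Differentiable ℝ g := differentiable_regularized h.differentiable hL₁.le hr.le x
  have hgg : gradient g = regularizedGradient f L₁ L₂ ε₂ x :=
    funext fun y => gradient_regularized h.differentiable hL₁.le hr.le x y
  have hprox : (fun z => gradient (proximal g (3 * ε₂) z))
      = fun z y => regularizedGradient f L₁ L₂ ε₂ x y + (2 * (3 * ε₂)) • (y - z) := by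
    funext z y
    rw [gradient_proximal hdiff, hgg]
  have hgx : g x = f x := by
    simp only [hg, regularized, sub_self, norm_zero, zero_sub]
    rw [max_eq_right (by linarith)]
    ring
  have hgradx : gradient g x = gradient f x := by
    rw [hgg]; simp [regularizedGradient, ballGap]
  have hfg : ∀ y, f y ≤ g y := fun y => le_regularized f hL₁.le L₂ ε₂ x y
  obtain ⟨out, hout⟩ : ∃ out, out = b2Out f L₁ L₂ ε₁ ε₂ x := ⟨_, rfl⟩
  obtain ⟨J, s, hsJ, hJ, hsmall, hdist, hmem⟩ := acOut_mem_almostConvexAGD hdiff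
    (ε := ε₁ / 2) (γ := 3 * ε₂) (L := 5 * L₁) (D := Δ) (by positivity) (by positivity)
    (by linarith) (h.quadraticBounds_proximal hL₁.le hL₂ hε₂ hε₂' hlam)
    (fun p => by rw [hgx]; linarith [hfg p, h.gap p]) (by rw [hgradx]; linarith) hS t
    (out := out) (by rw [hout, hprox, hgg]; rfl)
  rw [← hout]
  rw [hgx] at hJ hdist
  have hge : g x - g out ≤ f x - f out := by rw [hgx]; linarith [hfg out]
  rw [hgx] at hge
  refine ⟨J, s, hsJ, ?_, ?_, fun hbig => ?_, hmem⟩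
  · refine hJ.trans ?_
    have e : 5 * (3 * ε₂) / (ε₁ / 2) ^ 2 = 60 * ε₂ / ε₁ ^ 2 := by field_simp; norm_num
    rw [e]
    gcongr
  · have : 0 ≤ f x - g out := by
      rcases hdist with h1 | h1 <;> exact le_trans (by positivity) h1
    linarith
  · have hfar : ε₂ / L₂ ≤ ‖out - x‖ := by
      by_contra hcon
      have h1 : gradient g out = gradient f out := by
        rw [hgg, regularizedGradient, ballGap, max_eq_right (by linarith)]
        simp
      rw [h1] at hsmall
      linarith
    rcases hdist with h1 | h1
    · left
      refine le_trans ?_ (h1.trans hge)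
      calc ε₂ ^ 3 / max (12 * L₂ ^ 2) (2 * L₁) ≤ ε₂ ^ 3 / (12 * L₂ ^ 2) := by
            gcongr; exact le_max_left _ _
        _ ≤ 3 * ε₂ * (ε₂ / L₂) ^ 2 := by
            rw [div_le_iff₀ (by positivity)]
            have : 3 * ε₂ * (ε₂ / L₂) ^ 2 * (12 * L₂ ^ 2) = 36 * ε₂ ^ 3 := by
              field_simp; norm_num
            rw [this]
            have : 0 < ε₂ ^ 3 := by positivity
            linarith
        _ ≤ 3 * ε₂ * ‖out - x‖ ^ 2 := by gcongr
    · right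
      refine le_trans ?_ (h1.trans hge)
      calc ε₁ * ε₂ / (2 * √10 * L₂) = ε₁ / 2 * (ε₂ / L₂) / √10 := by field_simp
        _ ≤ ε₁ / 2 * ‖out - x‖ / √10 := by gcongr

end Steps

/-! ### The run of NCG-B2 -/

section Run

variable {d : ℕ} {f : Vec d → ℝ} {x₀ : Vec d} {L₁ L₂ Δ : ℝ}

theorem mem_ncgA2_of_returns {ξ : ℕ → Vec d} {e α δ : ℝ} {x : Vec d} {t : Tally d}
    (hret : A2Returns f L₁ e α (ncgA2Delta L₁ L₂ Δ e α δ) x (ξ t.ncg.length)) :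
    (x, t.addNCG (ncgRecord L₁ x (a2Noise f e α x) (ncgA2Delta L₁ L₂ Δ e α δ)))
      ∈ ncgA2 f L₁ L₂ Δ ξ e α δ (x, t) := by
  refine PFun.fix_stop ?_
  simp only [Part.mem_some_iff]
  exact (if_pos hret).symm

theorem ncgA2_of_not_returns {ξ : ℕ → Vec d} {e α δ : ℝ} {x : Vec d} {t : Tally d}
    (hret : ¬ A2Returns f L₁ e α (ncgA2Delta L₁ L₂ Δ e α δ) x (ξ t.ncg.length)) :
    ncgA2 f L₁ L₂ Δ ξ e α δ (x, t) = ncgA2 f L₁ L₂ Δ ξ e α δ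
      (ncgNext f L₁ L₂ (ξ t.ncg.length) x (a2Noise f e α x) (ncgA2Delta L₁ L₂ Δ e α δ),
        t.addNCG (ncgRecord L₁ x (a2Noise f e α x) (ncgA2Delta L₁ L₂ Δ e α δ))) := by
  refine PFun.fix_fwd_eq ?_
  simp only [Part.mem_some_iff]
  exact (if_neg hret).symm

/-- The loop body of NCG-B2. -/
noncomputable def b2Body (f : Vec d → ℝ) (L₁ L₂ Δ : ℝ) (ξ : ℕ → Vec d) (ε₁ ε₂ e α δ : ℝ) :
    Vec d × Tally d →. (Vec d × Tally d) ⊕ (Vec d × Tally d) :=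
  fun s => (ncgA2 f L₁ L₂ Δ ξ e α δ s).bind fun r =>
    if ‖gradient f r.1‖ ≤ ε₁ then Part.some (Sum.inl (r.1, r.2.addGrads 1))
    else (almostConvexAGD (regularized f L₁ L₂ ε₂ r.1) (ε₁ / 2) (3 * ε₂) (5 * L₁)
      (r.1, r.2.addGrads 1)).map Sum.inr

/-- The invariant of NCG-B2 at the beginning of an NCG step at `x` with account `t`, after `p`
completed outer iterations. The numbers `nA` and `nB` count disjoint parts of the run that have
decreased `f` by `a` and by `b`; `J` is the number of calls of the accelerated gradient method,
each with at most `S` steps and, but for one per outer iteration, worth a decrease by `1 / j`. -/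
structure RunInvariant (f : Vec d → ℝ) (x₀ : Vec d) (L₁ Δ ε₁ e α δ a b j : ℝ) (S : ℕ)
    (X : ℕ → Vec d) (x : Vec d) (t : Tally d) (p nA nB J : ℕ) : Prop where
  point : X t.ncg.length = x
  length_le : t.ncg.length ≤ p + nA
  decrease : f x + nA * a + nB * b ≤ f x₀
  outer_le : p ≤ nA + nB + 1
  outer_le' : ε₁ < ‖gradient f x‖ → p ≤ nA + nB
  gap_pos : 1 ≤ p → 0 < Δ
  calls_le : (J : ℝ) ≤ p + j * (f x₀ - f x)
  steps_le : t.agdSteps ≤ J * S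
  grads_le : t.grads ≤ 2 * t.agdSteps + 2 * J + 2 * p
  records : ∀ r ∈ t.ncg, ∃ y, f y ≤ f x₀ ∧ r = ncgRecord L₁ y (a2Noise f e α y) δ

/-- The number of completed outer iterations stays below `⌈1 + Δ / a + Δ / b⌉`. It is crucial that
`nA + nB < Δ / a + Δ / b` is strict, which holds as a decrease cannot be paid twice. -/
theorem count_lt {a b Δ : ℝ} (ha : 0 < a) (hb : 0 < b) {p nA nB K : ℕ}
    (hK : 1 + (Δ / a + Δ / b) ≤ K) (hΔ : 0 ≤ Δ) (hdec : nA * a + nB * b ≤ Δ)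
    (hp : p ≤ nA + nB + 1) (hpos : 1 ≤ p → 0 < Δ) :
    p + 1 ≤ K ∧ (nA : ℝ) ≤ Δ / a := by
  have hnA0 : (0 : ℝ) ≤ nA := Nat.cast_nonneg _
  have hnB0 : (0 : ℝ) ≤ nB := Nat.cast_nonneg _
  have hA : (nA : ℝ) ≤ Δ / a := by rw [le_div_iff₀ ha]; nlinarith
  have hB : (nB : ℝ) ≤ Δ / b := by rw [le_div_iff₀ hb]; nlinarith
  refine ⟨?_, hA⟩
  have hlt : (p : ℝ) < K := by
    rcases Nat.eq_zero_or_pos p with h0 | h0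
    · have h1 : 0 ≤ Δ / a := by positivity
      have h2 : 0 ≤ Δ / b := by positivity
      rw [h0]; push_cast; linarith
    · have hΔ' := hpos h0
      have hstrict : (nA : ℝ) + nB < Δ / a + Δ / b := by
        rcases Nat.eq_zero_or_pos nB with h1 | h1
        · have : 0 < Δ / b := by positivity
          rw [h1]; push_cast; linarith
        · have h2 : (1 : ℝ) ≤ nB := by exact_mod_cast h1
          have h3 : (nA : ℝ) < Δ / a := by rw [lt_div_iff₀ ha]; nlinarith
          linarith
      have hp' : (p : ℝ) ≤ nA + nB + 1 := by exact_mod_cast hp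
      linarith
  exact_mod_cast hlt

/-- If the Lanczos method does not fail at any of the first `N` NCG steps, where `N` is the integer
part of `K + Δ / a`, then NCG-B2 terminates with an approximate second-order stationary point
within that number of NCG steps. -/
theorem Admissible.exists_mem_fix_b2Body (h : Admissible f x₀ L₁ L₂ Δ) (hd : 0 < d) (hL₁ : 0 < L₁)
    (hL₂ : 0 < L₂) (hΔ : 0 ≤ Δ) {ε₁ ε₂ e α δ : ℝ} (hε₁ : 0 < ε₁) (hε₂ : 0 < ε₂)
    (hε₂' : 3 * ε₂ ≤ L₁) (he : 0 < e) (hα : 0 ≤ α) (heα : e ^ α = ε₂) (he2 : e ^ 2 = ε₂ ^ 3)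
    {S K N : ℕ} (hS : 4 * (5 * L₁) * Δ * Real.exp (-(S / √(5 * L₁ / (3 * ε₂))))
      ≤ innerAccuracy (ε₁ / 2) (3 * ε₂) (5 * L₁) ^ 2)
    {a b j δs : ℝ} (ha : a = ε₂ ^ 3 / max (12 * L₂ ^ 2) (2 * L₁))
    (hb : b = ε₁ * ε₂ / (2 * √10 * L₂)) (hj : j = 60 * ε₂ / ε₁ ^ 2)
    (hK : 1 + (Δ / a + Δ / b) ≤ K) (hN : N = ⌊K + Δ / a⌋₊)
    (hδs : δs = ncgA2Delta L₁ L₂ Δ e α δ) {ξ : ℕ → Vec d} (hξ : ∀ n, ‖ξ n‖ = 1) {X : ℕ → Vec d}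
    (hX : X = drivenPath (b2Next f L₁ L₂ ε₁ ε₂ e α δs) x₀ ξ)
    (hgood : ∀ n < N, ¬ LanczosFails f L₁ e α δs (X n) (ξ n)) :
    ∃ (x : Vec d) (t : Tally d),
      (x, t) ∈ (b2Body f L₁ L₂ Δ ξ ε₁ ε₂ e α δ).fix (x₀, Tally.zero d) ∧
      ‖gradient f x‖ ≤ ε₁ ∧ -ε₂ ≤ lambdaMin (hess f x : Module.End ℝ (Vec d)) ∧
      t.ncg.length ≤ N ∧ (t.agdSteps : ℝ) ≤ (K + j * Δ) * S ∧
      (t.grads : ℝ) ≤ 2 * t.agdSteps + 2 * (K + j * Δ) + 2 * K + 1 ∧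
      ∀ r ∈ t.ncg, ∃ y, f y ≤ f x₀ ∧ r = ncgRecord L₁ y (a2Noise f e α y) δs := by
  have ha0 : 0 < a := by
    rw [ha]; exact div_pos (by positivity) (lt_max_of_lt_right (by positivity))
  have hb0 : 0 < b := by rw [hb]; positivity
  have hj0 : 0 < j := by rw [hj]; positivity
  have hXs : ∀ n, X (n + 1) = b2Next f L₁ L₂ ε₁ ε₂ e α δs (X n) (ξ n) := fun n => by rw [hX]; rfl
  set F := b2Body f L₁ L₂ Δ ξ ε₁ ε₂ e α δ with hF
  have key : ∀ (m : ℕ) (x : Vec d) (t : Tally d) (p nA nB J : ℕ),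
      RunInvariant f x₀ L₁ Δ ε₁ e α δs a b j S X x t p nA nB J → N - t.ncg.length ≤ m →
      ∃ (x' : Vec d) (t' : Tally d), (x', t') ∈ F.fix (x, t) ∧
        ‖gradient f x'‖ ≤ ε₁ ∧ -ε₂ ≤ lambdaMin (hess f x' : Module.End ℝ (Vec d)) ∧
        t'.ncg.length ≤ N ∧ (t'.agdSteps : ℝ) ≤ (K + j * Δ) * S ∧
        (t'.grads : ℝ) ≤ 2 * t'.agdSteps + 2 * (K + j * Δ) + 2 * K + 1 ∧
        ∀ r ∈ t'.ncg, ∃ y, f y ≤ f x₀ ∧ r = ncgRecord L₁ y (a2Noise f e α y) δs := by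
    intro m
    induction m with
    | zero | succ m ih => ?_
    all_goals intro x t p nA nB J hI hm
    all_goals
      have hdec := hI.decrease
      have hgap := h.gap x
      obtain ⟨hpK, hnA⟩ := count_lt ha0 hb0 hK hΔ (by linarith) hI.outer_le hI.gap_pos
      have hlen : t.ncg.length < N := by
        have h1 : (t.ncg.length : ℝ) ≤ p + nA := by exact_mod_cast hI.length_le
        have h2 : (p : ℝ) + 1 ≤ K := by exact_mod_cast hpK
        rw [hN, Nat.lt_iff_add_one_le]
        refine Nat.le_floor ?_
        push_cast
        linarith
    · omega
    have hfx : f x ≤ f x₀ := by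
      have : 0 ≤ nA * a + nB * b := by positivity
      linarith
    have hgoodx := hgood _ hlen
    rw [hI.point] at hgoodx
    set r := ncgRecord L₁ x (a2Noise f e α x) δs with hr
    have hrec : ∀ r' ∈ (t.addNCG r).ncg, ∃ y, f y ≤ f x₀ ∧
        r' = ncgRecord L₁ y (a2Noise f e α y) δs := by
      intro r' hr'
      rcases List.mem_cons.1 hr' with h1 | h1
      · exact ⟨x, hfx, h1⟩
      · exact hI.records r' h1
    have hXnext := hXs t.ncg.length
    rw [hI.point] at hXnext
    by_cases hret : A2Returns f L₁ e α δs x (ξ t.ncg.length)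
    · have hlam := lambdaMin_of_returns hα heα hret hgoodx
      have hA2 : (x, t.addNCG r) ∈ ncgA2 f L₁ L₂ Δ ξ e α δ (x, t) := by
        rw [hr, hδs]; exact mem_ncgA2_of_returns (hδs ▸ hret)
      by_cases hsmall : ‖gradient f x‖ ≤ ε₁
      · refine ⟨x, (t.addNCG r).addGrads 1, PFun.fix_stop (Part.mem_bind hA2 ?_), hsmall, hlam,
          hlen, ?_, ?_, hrec⟩
        · simp only
          rw [if_pos hsmall]
          exact Part.mem_some _
        all_goals
          have hp' : (p : ℝ) ≤ K := by exact_mod_cast (by omega : p ≤ K)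
          have hJ : (J : ℝ) ≤ K + j * Δ := by
            have h1 := hI.calls_le
            have h2 : j * (f x₀ - f x) ≤ j * Δ := by gcongr
            linarith
        · have h3 : (t.agdSteps : ℝ) ≤ J * S := by exact_mod_cast hI.steps_le
          refine h3.trans ?_
          gcongr
        · have h3 : (t.grads : ℝ) ≤ 2 * t.agdSteps + 2 * J + 2 * p := by exact_mod_cast hI.grads_le
          simp only [Tally.addGrads, Tally.addNCG]
          push_cast
          linarith
      · have hsmall' : ε₁ < ‖gradient f x‖ := not_le.1 hsmall
        obtain ⟨J', s, hsJ, hJ', hfle, hbig, hmem⟩ := h.b2Out_spec hL₁ hL₂ hε₁ hε₂ hε₂' hfx hsmall'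
          hlam hS ((t.addNCG r).addGrads 1)
        set out := b2Out f L₁ L₂ ε₁ ε₂ x with hout
        have hXout : X (t.ncg.length + 1) = out := by rw [hXnext]; exact if_pos hret
        have hfwd : Sum.inr (out, (⟨(t.addNCG r).ncg, t.agdSteps + s,
            t.grads + 1 + 2 * s + 2 * J' + 1⟩ : Tally d)) ∈ F (x, t) := by
          refine Part.mem_bind hA2 ?_
          simp only
          rw [if_neg hsmall, Part.mem_map_iff]
          exact ⟨_, hmem, rfl⟩
        have hΔpos : 0 < Δ := by
          have h1 := h.norm_gradient_sq_le hL₁ x hfx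
          have h2 : 0 < ‖gradient f x‖ := hε₁.trans hsmall'
          have h3 : 0 < ‖gradient f x‖ ^ 2 := by positivity
          by_contra hcon
          nlinarith
        rw [PFun.fix_fwd_eq hfwd]
        have hle := hI.outer_le' hsmall'
        have hlen' := hI.length_le
        -- The decrease of `f` in this outer iteration is booked under `nA` or `nB`.
        obtain ⟨nA', nB', hnA', hnB', hdec', hout'⟩ : ∃ nA' nB' : ℕ, nA ≤ nA' ∧ nB ≤ nB' ∧
            f out + nA' * a + nB' * b ≤ f x₀ ∧
            (ε₁ < ‖gradient f out‖ → p + 1 ≤ nA' + nB') := by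
          by_cases hg : ε₁ < ‖gradient f out‖
          · rcases hbig hg with h1 | h1
            · rw [← ha] at h1
              exact ⟨nA + 1, nB, by omega, le_rfl, by push_cast; linarith, fun _ => by omega⟩
            · rw [← hb] at h1
              exact ⟨nA, nB + 1, le_rfl, by omega, by push_cast; linarith, fun _ => by omega⟩
          · exact ⟨nA, nB, le_rfl, le_rfl, by linarith, fun h1 => absurd h1 hg⟩
        refine ih out _ (p + 1) nA' nB' (J + J') ⟨hXout, ?_, hdec', by omega, hout',
          fun _ => hΔpos, ?_, ?_, ?_, hrec⟩ ?_
        · simp only [Tally.addNCG, List.length_cons]; omega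
        · have h1 := hI.calls_le
          rw [← hj] at hJ'
          push_cast
          linarith
        · have h1 := hI.steps_le
          simp only
          rw [add_mul]
          omega
        · have h1 := hI.grads_le
          simp only
          omega
        · simp only [Tally.addNCG, List.length_cons]; omega
    · set x' := ncgNext f L₁ L₂ (ξ t.ncg.length) x (a2Noise f e α x) δs with hx'
      have hXout : X (t.ncg.length + 1) = x' := by rw [hXnext]; exact if_neg hret
      have hdec' : f x' ≤ f x - a := by
        rw [ha]
        exact h.ncgNext_le_of_not_returns hd hL₁ hL₂ he hε₂ heα he2 x (hξ _) hret
      have hA2 : ncgA2 f L₁ L₂ Δ ξ e α δ (x, t) = ncgA2 f L₁ L₂ Δ ξ e α δ (x', t.addNCG r) := by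
        rw [hx', hr, hδs]; exact ncgA2_of_not_returns (hδs ▸ hret)
      have hFF : F (x, t) = F (x', t.addNCG r) := by simp only [hF, b2Body, hA2]
      have hlen' := hI.length_le
      have hout := hI.outer_le
      obtain ⟨y, t', hmem, hrest⟩ := ih x' (t.addNCG r) p (nA + 1) nB J
        ⟨hXout, by simp only [Tally.addNCG, List.length_cons]; omega,
          by push_cast; linarith, by omega, fun _ => by omega, hI.gap_pos, by
            have h1 := hI.calls_le
            have h2 : j * (f x₀ - f x) ≤ j * (f x₀ - f x') := by gcongr; linarith
            linarith, hI.steps_le, hI.grads_le, hrec⟩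
        (by simp only [Tally.addNCG, List.length_cons]; omega)
      refine ⟨y, t', ?_, hrest⟩
      rw [PFun.mem_fix_iff] at hmem ⊢
      rwa [hFF]
  refine key N x₀ (Tally.zero d) 0 0 0 0 ⟨by rw [hX]; rfl, by simp [Tally.zero], by simp,
    by omega, fun _ => le_rfl, fun h => absurd h (by omega), by simp, by simp [Tally.zero],
    by simp [Tally.zero], by simp [Tally.zero]⟩ (by simp [Tally.zero])

end Run

/-! ### Complexity bounds -/

section Bounds

/-- The outer iteration bound is at least `1 + Δ / a + Δ / b`, where `a` and `b` are the decreases of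
`f` that an iteration guarantees, and has the order of the claimed number of NCG steps. -/
theorem exists_outerBound_le {L₁ L₂ Δ : ℝ} (hL₁ : 0 < L₁) (hL₂ : 0 < L₂) (hΔ : 0 ≤ Δ) :
    ∃ C : ℝ, 2 ≤ C ∧ ∀ ε₁ ε₂ : ℝ, 0 < ε₁ → ε₁ ≤ ε₂ → ε₂ ≤ 1 →
      1 + (Δ / (ε₂ ^ 3 / max (12 * L₂ ^ 2) (2 * L₁)) + Δ / (ε₁ * ε₂ / (2 * √10 * L₂)))
        ≤ outerBound L₁ L₂ Δ ε₁ ε₂ ∧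
      outerBound L₁ L₂ Δ ε₁ ε₂ + Δ / (ε₂ ^ 3 / max (12 * L₂ ^ 2) (2 * L₁))
        ≤ C * (1 / ε₂ ^ 3 + 1 / (ε₁ * ε₂)) := by
  set M := max (12 * L₂ ^ 2) (2 * L₁) with hM
  have hM0 : 0 < M := lt_max_of_lt_right (by positivity)
  refine ⟨2 + 2 * Δ * M + 2 * √10 * L₂ * Δ, ?_, fun ε₁ ε₂ h1 h12 h2 => ?_⟩
  · have : 0 ≤ 2 * Δ * M + 2 * √10 * L₂ * Δ := by positivity
    linarith
  have h0 : 0 < ε₂ := h1.trans_le h12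
  have hA : Δ / (ε₂ ^ 3 / M) = Δ * M * (1 / ε₂ ^ 3) := by field_simp
  have hB : Δ / (ε₁ * ε₂ / (2 * √10 * L₂)) = 2 * √10 * L₂ * Δ * (1 / (ε₁ * ε₂)) := by field_simp
  have hsum : 1 + Δ * (M / ε₂ ^ 3 + 2 * √10 * L₂ / (ε₁ * ε₂))
      = 1 + (Δ * M * (1 / ε₂ ^ 3) + 2 * √10 * L₂ * Δ * (1 / (ε₁ * ε₂))) := by ring
  rw [hA, hB, outerBound, ← hM, hsum]
  set u := 1 / ε₂ ^ 3 with hu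
  set w := 1 / (ε₁ * ε₂) with hw
  have hu1 : 1 ≤ u := by
    rw [hu, le_div_iff₀ (by positivity), one_mul]
    exact pow_le_one₀ h0.le h2
  have hw0 : 0 ≤ w := by positivity
  refine ⟨Nat.le_ceil _, ?_⟩
  have hceil := Nat.ceil_lt_add_one
    (a := 1 + (Δ * M * u + 2 * √10 * L₂ * Δ * w)) (by positivity)
  have e1 : 0 ≤ 2 * Δ * M * w := by positivity
  have e2 : 0 ≤ 2 * √10 * L₂ * Δ * u := by positivity
  linarith

/-- The logarithm of the dimension over the failure probability is `O(log τ)`. -/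
theorem exists_log_le {L₁ L₂ Δ : ℝ} (hL₁ : 0 < L₁) (hL₂ : 0 < L₂) (hΔ : 0 ≤ Δ) :
    ∃ C : ℝ, 0 ≤ C ∧ ∀ (ε₁ ε₂ δ τ : ℝ) (d : ℕ), 0 < ε₁ → ε₁ ≤ ε₂ → ε₂ ≤ 1 → 0 < δ → 0 < d →
      1 / ε₁ ≤ τ → 1 / δ ≤ τ → d ≤ τ → 1 ≤ Real.log τ →
      Real.log (d / (δ / outerBound L₁ L₂ Δ ε₁ ε₂)) ≤ C * Real.log τ := by
  obtain ⟨C, hC, hK⟩ := exists_outerBound_le hL₁ hL₂ hΔ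
  have hlogC : 0 ≤ Real.log (2 * C) := Real.log_nonneg (by linarith)
  refine ⟨5 + Real.log (2 * C), by linarith, fun ε₁ ε₂ δ τ d h1 h12 h2 hδ hd hτ1 hτ2 hτ3 hτ => ?_⟩
  have h0 : 0 < ε₂ := h1.trans_le h12
  have hd' : (0 : ℝ) < d := by exact_mod_cast hd
  obtain ⟨hK1, hK2⟩ := hK ε₁ ε₂ h1 h12 h2
  set K := (outerBound L₁ L₂ Δ ε₁ ε₂ : ℝ)
  have hA : 0 ≤ Δ / (ε₂ ^ 3 / max (12 * L₂ ^ 2) (2 * L₁)) := by positivity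
  have hB : 0 ≤ Δ / (ε₁ * ε₂ / (2 * √10 * L₂)) := by positivity
  have hK0 : 0 < K := by linarith
  have hK3 : K ≤ 2 * C * (1 / ε₁) ^ 3 := by
    have e1 : 1 / ε₂ ^ 3 ≤ (1 / ε₁) ^ 3 := by
      rw [one_div_pow]; gcongr
    have e2 : 1 / (ε₁ * ε₂) ≤ (1 / ε₁) ^ 3 := by
      rw [one_div_pow]
      refine one_div_le_one_div_of_le (by positivity) ?_
      calc ε₁ ^ 3 = ε₁ * ε₁ * ε₁ := by ring
        _ ≤ ε₁ * ε₁ * 1 := by gcongr; linarith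
        _ ≤ ε₁ * ε₂ := by rw [mul_one]; gcongr
    have e3 : C * (1 / ε₂ ^ 3 + 1 / (ε₁ * ε₂)) ≤ C * ((1 / ε₁) ^ 3 + (1 / ε₁) ^ 3) := by gcongr
    linarith
  have e : (d : ℝ) / (δ / K) = d * (1 / δ) * K := by field_simp
  have hlogK : Real.log K ≤ Real.log (2 * C) + 3 * Real.log τ := by
    refine (Real.log_le_log hK0 hK3).trans ?_
    rw [Real.log_mul (by positivity) (by positivity), Real.log_pow]
    push_cast
    linarith [Real.log_le_log (by positivity) hτ1]
  rw [e, Real.log_mul (by positivity) hK0.ne', Real.log_mul hd'.ne' (by positivity)]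
  have e1 := Real.log_le_log hd' hτ3
  have e2 := Real.log_le_log (by positivity) hτ2
  have e3 : Real.log (2 * C) ≤ Real.log (2 * C) * Real.log τ := le_mul_of_one_le_right hlogC hτ
  linarith

/-- A number of gradient steps that suffices for each call of the accelerated method. -/
theorem exists_agdSteps_le {L₁ Δ : ℝ} (hL₁ : 0 < L₁) (hΔ : 0 ≤ Δ) :
    ∃ C : ℝ, 0 ≤ C ∧ ∀ ε₁ ε₂ τ : ℝ, 0 < ε₁ → ε₁ ≤ ε₂ → ε₂ ≤ 1 → 1 / ε₁ ≤ τ → 1 ≤ Real.log τ →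
      ∃ S : ℕ, 4 * (5 * L₁) * Δ * Real.exp (-(S / √(5 * L₁ / (3 * ε₂))))
        ≤ innerAccuracy (ε₁ / 2) (3 * ε₂) (5 * L₁) ^ 2 ∧ S ≤ C / √ε₂ * Real.log τ := by
  set D := 4000 * L₁ * Δ * (5 * L₁ + 6) with hD
  have hD0 : 0 ≤ D := by positivity
  refine ⟨1 + √(5 * L₁ / 3) * (3 + D), by positivity, fun ε₁ ε₂ τ h1 h12 h2 hτ1 hτ => ?_⟩
  have h0 : 0 < ε₂ := h1.trans_le h12
  set I := innerAccuracy (ε₁ / 2) (3 * ε₂) (5 * L₁) ^ 2 with hI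
  have hI' : I = (ε₁ / 2) ^ 2 * (3 * ε₂ / (50 * (5 * L₁ + 2 * (3 * ε₂)))) := by
    rw [hI, innerAccuracy, mul_pow, Real.sq_sqrt (by positivity)]
  have hI0 : 0 < I := by rw [hI']; positivity
  set X := 4 * (5 * L₁) * Δ / I with hX
  have hX0 : 0 ≤ X := by positivity
  set q := √(5 * L₁ / (3 * ε₂)) with hq
  have hq0 : 0 < q := Real.sqrt_pos.2 (by positivity)
  have hq' : q = √(5 * L₁ / 3) / √ε₂ := by
    rw [hq, ← Real.sqrt_div (by positivity)]
    congr 1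
    field_simp
  have hXle : 1 + X ≤ (1 + D) * (1 / ε₁) ^ 3 := by
    have e1 : 1 ≤ (1 / ε₁) ^ 3 := by
      refine one_le_pow₀ ?_
      rw [le_div_iff₀ h1]
      linarith
    have e2 : X ≤ D * (1 / ε₁) ^ 3 := by
      have e3 : X = 4000 / 3 * L₁ * Δ * (5 * L₁ + 6 * ε₂) * (1 / (ε₁ ^ 2 * ε₂)) := by
        rw [hX, hI']
        field_simp
        ring
      rw [e3, hD, one_div_pow]
      gcongr
      · norm_num
      · linarith
      · calc ε₁ ^ 3 = ε₁ ^ 2 * ε₁ := by ring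
          _ ≤ ε₁ ^ 2 * ε₂ := by gcongr
    linarith
  have hlog : Real.log (1 + X) ≤ (3 + D) * Real.log τ := by
    have e1 := Real.log_le_log (by positivity) hXle
    rw [Real.log_mul (by positivity) (by positivity), Real.log_pow] at e1
    have e2 := Real.log_le_log (by positivity) hτ1
    have e3 := Real.log_le_sub_one_of_pos (by positivity : 0 < 1 + D)
    have e4 : D ≤ D * Real.log τ := le_mul_of_one_le_right hD0 hτ
    push_cast at e1
    linarith
  refine ⟨⌈q * Real.log (1 + X)⌉₊, ?_, ?_⟩
  · have e1 : Real.log (1 + X) ≤ ⌈q * Real.log (1 + X)⌉₊ / q := by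
      rw [le_div_iff₀ hq0, mul_comm]
      exact Nat.le_ceil _
    have e2 : Real.exp (-(⌈q * Real.log (1 + X)⌉₊ / q)) ≤ (1 + X)⁻¹ := by
      rw [← Real.exp_log (by positivity : 0 < 1 + X), ← Real.exp_neg, Real.exp_log (by positivity)]
      gcongr
    calc 4 * (5 * L₁) * Δ * Real.exp (-(⌈q * Real.log (1 + X)⌉₊ / q))
        ≤ 4 * (5 * L₁) * Δ * (1 + X)⁻¹ := by gcongr
      _ = I * (X * (1 + X)⁻¹) := by rw [hX]; field_simp
      _ ≤ I * 1 := by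
          gcongr
          rw [← div_eq_mul_inv, div_le_one (by positivity)]
          linarith
      _ = I := mul_one I
  · have e1 := (Nat.ceil_lt_add_one
      (mul_nonneg hq0.le (Real.log_nonneg (by linarith : 1 ≤ 1 + X)))).le
    have e2 : 1 ≤ 1 / √ε₂ * Real.log τ := by
      refine one_le_mul_of_one_le_of_one_le ?_ hτ
      rw [le_div_iff₀ (Real.sqrt_pos.2 h0), one_mul]
      exact Real.sqrt_le_one.2 h2
    have e3 : q * Real.log (1 + X) ≤ q * ((3 + D) * Real.log τ) := by gcongr
    have e4 : (1 + √(5 * L₁ / 3) * (3 + D)) / √ε₂ * Real.log τ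
        = 1 / √ε₂ * Real.log τ + q * ((3 + D) * Real.log τ) := by rw [hq']; ring
    linarith

variable {d : ℕ} {f : Vec d → ℝ} {x₀ : Vec d} {L₁ L₂ Δ : ℝ}

/-- The division of the failure probability by `1 + A` in NCG-A2 costs a factor two only, as
`1 + A` is at most the number of outer iterations of NCG-B2. -/
theorem ncgRecord_time_le (hd : 0 < d) (hL₁ : 0 < L₁) {ε₂ δ' A Tg Th : ℝ} (hε₂ : 0 < ε₂)
    (hδ' : 0 < δ') (hA : 0 ≤ A) (hA' : 1 + A ≤ d / δ') (hTg : 0 ≤ Tg) (hTh : Tg ≤ Th) (y : Vec d) :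
    (ncgRecord L₁ y (max ε₂ (‖gradient f y‖ ^ (2 / 3 : ℝ)) / 2) (δ' / (1 + A))).time Tg Th
      ≤ 10 * Th * max 1 (stepBound f L₁ ε₂ δ' y) := by
  have hd' : (0 : ℝ) < d := by exact_mod_cast hd
  set B := stepBound f L₁ ε₂ δ' y with hB
  rw [stepBound] at hB
  set m := max ε₂ (‖gradient f y‖ ^ (2 / 3 : ℝ)) with hm
  have hm0 : 0 < m := lt_max_of_lt_left hε₂
  have hl0 : 0 ≤ Real.log (d / δ') := Real.log_nonneg (by linarith)
  have hB0 : 0 ≤ B := by rw [hB]; positivity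
  have hlog : Real.log (d / (δ' / (1 + A))) ≤ 2 * Real.log (d / δ') := by
    have e : (d : ℝ) / (δ' / (1 + A)) = d / δ' * (1 + A) := by field_simp
    rw [e, Real.log_mul (by positivity) (by positivity)]
    linarith [Real.log_le_log (by positivity) hA']
  have hsqrt : √(L₁ / (m / 2)) ≤ 3 / 2 * (√L₁ / √m) := by
    have e : L₁ / (m / 2) = 2 * (L₁ / m) := by field_simp
    rw [e, Real.sqrt_mul (by norm_num), Real.sqrt_div hL₁.le]
    gcongr
    rw [Real.sqrt_le_left (by norm_num)]
    norm_num
  have hprod : 2 * √(L₁ / (m / 2)) * Real.log (d / (δ' / (1 + A))) ≤ 6 * B := by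
    calc 2 * √(L₁ / (m / 2)) * Real.log (d / (δ' / (1 + A)))
        ≤ 2 * √(L₁ / (m / 2)) * (2 * Real.log (d / δ')) := by gcongr
      _ ≤ 2 * (3 / 2 * (√L₁ / √m)) * (2 * Real.log (d / δ')) := by gcongr
      _ = 6 * B := by rw [hB]; ring
  have hiters : (lanczosIters L₁ d (m / 2) (δ' / (1 + A)) : ℝ) ≤ 2 + 6 * B := by
    have e1 : lanczosIters L₁ d (m / 2) (δ' / (1 + A)) ≤ 1 + ⌈6 * B⌉₊ :=
      (min_le_right _ _).trans (by gcongr)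
    have e2 : (lanczosIters L₁ d (m / 2) (δ' / (1 + A)) : ℝ) ≤ 1 + ⌈6 * B⌉₊ := by
      exact_mod_cast e1
    linarith [Nat.ceil_lt_add_one (by positivity : 0 ≤ 6 * B)]
  have hmax1 := le_max_left 1 B
  have hmax2 := le_max_right 1 B
  have hTh0 : 0 ≤ Th := hTg.trans hTh
  rw [NCGRecord.time, ncgRecord]
  push_cast
  calc Th * ((lanczosIters L₁ d (m / 2) (δ' / (1 + A)) : ℝ) + 1) + Tg * 1
      ≤ Th * ((2 + 6 * B) + 1) + Th * 1 := by gcongr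
    _ = Th * (4 + 6 * B) := by ring
    _ ≤ Th * (10 * max 1 B) := by gcongr; linarith
    _ = 10 * Th * max 1 B := by ring

/-- In dimension at least two the bound on the time of an NCG step is bounded below, since the
gradient is bounded on the sublevel set of `x₀`. -/
theorem exists_le_stepBound (hL₁ : 0 < L₁) (Δ : ℝ) :
    ∃ c : ℝ, 0 < c ∧ ∀ (d : ℕ) (f : Vec d → ℝ) (x₀ : Vec d) (L₂ : ℝ), 2 ≤ d →
      Admissible f x₀ L₁ L₂ Δ → ∀ ε₂ δ' : ℝ, 0 < ε₂ → ε₂ ≤ 1 → 0 < δ' → δ' ≤ 1 →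
      ∀ y, f y ≤ f x₀ → c ≤ stepBound f L₁ ε₂ δ' y := by
  set G := max 1 ((2 * L₁ * Δ) ^ (1 / 3 : ℝ)) with hG
  have hG0 : 0 < G := lt_max_of_lt_left one_pos
  have hlog2 : 0 < Real.log 2 := Real.log_pos (by norm_num)
  refine ⟨√L₁ / √G * Real.log 2, by positivity, fun d f x₀ L₂ hd h ε₂ δ' h0 h2 hδ hδ1 y hy => ?_⟩
  have hd' : (2 : ℝ) ≤ d := by exact_mod_cast hd
  rw [stepBound]
  have hm0 : 0 < max ε₂ (‖gradient f y‖ ^ (2 / 3 : ℝ)) := lt_max_of_lt_left h0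
  have hmG : max ε₂ (‖gradient f y‖ ^ (2 / 3 : ℝ)) ≤ G := by
    refine max_le_max h2 ?_
    have e : ‖gradient f y‖ ^ (2 / 3 : ℝ) = (‖gradient f y‖ ^ 2) ^ (1 / 3 : ℝ) := by
      rw [← Real.rpow_natCast, ← Real.rpow_mul (norm_nonneg _)]
      norm_num
    rw [e]
    exact Real.rpow_le_rpow (by positivity) (h.norm_gradient_sq_le hL₁ y hy) (by norm_num)
  gcongr
  rw [le_div_iff₀ hδ]
  nlinarith

theorem stepBound_le {ε₂ δ' : ℝ} (hε₂ : 0 < ε₂) (hl : 0 ≤ Real.log (d / δ')) (y : Vec d) :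
    stepBound f L₁ ε₂ δ' y ≤ √L₁ / √ε₂ * Real.log (d / δ') := by
  rw [stepBound]
  gcongr
  exact le_max_left _ _

theorem ncgA2Delta_eq {e ε₂ : ℝ} (hε₂ : 0 < ε₂) (heα : e ^ (2 / 3 : ℝ) = ε₂)
    (he2 : e ^ 2 = ε₂ ^ 3) (δ : ℝ) :
    ncgA2Delta L₁ L₂ Δ e (2 / 3) δ
      = δ / (1 + Δ / (ε₂ ^ 3 / max (12 * L₂ ^ 2) (2 * L₁))) := by
  rw [ncgA2Delta, heα, he2, max_div_div_right (by positivity)]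
  congr 2
  rw [div_div_eq_mul_div, mul_comm, mul_div_assoc]

/-- The union bound over all NCG steps: the failure probability per step is `δ / (K (1 + A))`, and
there are at most `K + A ≤ K (1 + A)` steps. -/
theorem floor_mul_ofReal_le {K A δ : ℝ} (hK : 1 ≤ K) (hA : 0 ≤ A) (hδ : 0 ≤ δ) :
    ⌊K + A⌋₊ * ENNReal.ofReal (δ / K / (1 + A)) ≤ ENNReal.ofReal δ := by
  rw [← ENNReal.ofReal_natCast, ← ENNReal.ofReal_mul (Nat.cast_nonneg _)]
  refine ENNReal.ofReal_le_ofReal ?_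
  calc (⌊K + A⌋₊ : ℝ) * (δ / K / (1 + A)) ≤ (K * (1 + A)) * (δ / K / (1 + A)) := by
        gcongr
        refine (Nat.floor_le (by positivity)).trans ?_
        nlinarith
    _ = δ := by field_simp

theorem Tally.time_le {Tg Th T : ℝ} (t : Tally d) (hT : ∀ r ∈ t.ncg, r.time Tg Th ≤ T) :
    t.time Tg Th ≤ t.ncg.length * T + Tg * t.grads := by
  rw [Tally.time]
  have h := List.sum_le_card_nsmul (t.ncg.map (NCGRecord.time Tg Th)) T (by
    intro x hx
    obtain ⟨r, hr, rfl⟩ := List.mem_map.1 hx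
    exact hT r hr)
  rw [List.length_map, nsmul_eq_mul] at h
  linarith

/-- Here `V * s` bounds the outer iterations, `U * s` the further calls of the accelerated method,
and `S` the steps per call. The factor `s = √ε₂` cancels against the condition number in `S`. -/
theorem agdSteps_le_of_le {s V U ℓ C₁ C₃ K S n : ℝ} (hs : 0 < s) (hV : 0 ≤ V) (hU : 0 ≤ U)
    (hℓ : 0 ≤ ℓ) (hC₁ : 0 ≤ C₁) (hC₃ : 0 ≤ C₃) (hΔ : 0 ≤ Δ) (hK : K ≤ C₁ * (V * s))
    (hS : S ≤ C₃ / s * ℓ) (hn : n ≤ (K + 60 * Δ * (U * s)) * S) (hS0 : 0 ≤ S) :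
    n ≤ C₃ * (C₁ + 60 * Δ) * (V + U) * ℓ :=
  calc n ≤ (K + 60 * Δ * (U * s)) * S := hn
    _ ≤ (C₁ * (V * s) + 60 * Δ * (U * s)) * (C₃ / s * ℓ) := by gcongr
    _ = C₃ * (C₁ * V + 60 * Δ * U) * ℓ := by field_simp
    _ ≤ C₃ * (C₁ * V + 60 * Δ * U + (C₁ * U + 60 * Δ * V)) * ℓ := by
        refine mul_le_mul_of_nonneg_right (mul_le_mul_of_nonneg_left ?_ hC₃) hℓ
        exact le_add_of_nonneg_right (by positivity)
    _ = C₃ * (C₁ + 60 * Δ) * (V + U) * ℓ := by ring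

/-- The gradients outside the NCG steps are of the order of the gradient steps. -/
theorem grads_le_of_le {s V U ℓ C₁ C₅ K n g : ℝ} (hs : s ≤ 1) (hU : 0 ≤ U) (hℓ : 1 ≤ ℓ)
    (hV1 : 1 ≤ V) (hC₁ : 0 ≤ C₁) (hΔ : 0 ≤ Δ) (hK : K ≤ C₁ * (V * s)) (hVs : V * s ≤ V)
    (hn : n ≤ C₅ * (V + U) * ℓ) (hg : g ≤ 2 * n + 2 * (K + 60 * Δ * (U * s)) + 2 * K + 1) :
    g ≤ (2 * C₅ + 4 * C₁ + 120 * Δ + 1) * (V + U) * ℓ := by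
  have hV : 0 ≤ V := by linarith
  have e1 : C₁ * (V * s) ≤ C₁ * (V + U) * ℓ := by
    calc C₁ * (V * s) ≤ C₁ * (V + U) := by gcongr; linarith
      _ ≤ C₁ * (V + U) * ℓ := le_mul_of_one_le_right (by positivity) hℓ
  have e2 : 60 * Δ * (U * s) ≤ 60 * Δ * (V + U) * ℓ := by
    calc 60 * Δ * (U * s) ≤ 60 * Δ * (V + U) := by
          gcongr
          exact (mul_le_of_le_one_right hU hs).trans (by linarith)
      _ ≤ 60 * Δ * (V + U) * ℓ := le_mul_of_one_le_right (by positivity) hℓ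
  have e3 : 1 ≤ (V + U) * ℓ := one_le_mul_of_one_le_of_one_le (by linarith) hℓ
  linarith

/-- As `Tg ≤ Th`, the part `V` of the number of gradients can be charged at the rate `Th`, which
leaves only `U` to be charged at the rate `Tg`. -/
theorem Tally.time_le_of_le {t : Tally d} {Tg Th s V U ℓ C₁ C₆ c : ℝ} (hs : 0 < s) (hV : 0 ≤ V)
    (hU : 0 ≤ U) (hℓ : 0 ≤ ℓ) (hC₁ : 0 ≤ C₁) (hC₆ : 0 ≤ C₆) (hc : 0 ≤ c) (hTg : 0 ≤ Tg)
    (hTh : Tg ≤ Th) (hstep : ∀ r ∈ t.ncg, r.time Tg Th ≤ 10 * Th * (c / s * ℓ))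
    (hlen : (t.ncg.length : ℝ) ≤ C₁ * (V * s)) (hgrads : (t.grads : ℝ) ≤ C₆ * (V + U) * ℓ) :
    t.time Tg Th ≤ (10 * C₁ * c + C₆) * ((V * Th + U * Tg) * ℓ) := by
  have hTh0 : 0 ≤ Th := hTg.trans hTh
  calc t.time Tg Th ≤ t.ncg.length * (10 * Th * (c / s * ℓ)) + Tg * t.grads := t.time_le hstep
    _ ≤ C₁ * (V * s) * (10 * Th * (c / s * ℓ)) + Tg * (C₆ * (V + U) * ℓ) := by gcongr
    _ = 10 * C₁ * c * (V * Th * ℓ) + C₆ * ((V * Tg + U * Tg) * ℓ) := by field_simp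
    _ ≤ 10 * C₁ * c * ((V * Th + U * Tg) * ℓ) + C₆ * ((V * Th + U * Tg) * ℓ) := by
        refine add_le_add (mul_le_mul_of_nonneg_left (mul_le_mul_of_nonneg_right ?_ hℓ)
          (by positivity)) (by gcongr)
        exact le_add_of_nonneg_right (by positivity)
    _ = (10 * C₁ * c + C₆) * ((V * Th + U * Tg) * ℓ) := by ring

end Bounds

end NegCurv

theorem theorem4 :
    ∃ c : ℝ, 0 < c ∧
    ∀ L₁ L₂ Δ : ℝ, 0 < L₁ → 0 < L₂ → 0 ≤ Δ →
    ∃ C : ℝ, 0 < C ∧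
    ∀ (d : ℕ) (f : Vec d → ℝ) (x₀ : Vec d), 0 < d → Admissible f x₀ L₁ L₂ Δ →
    ∀ ε₁ α δ Tg Th : ℝ, 0 < ε₁ → ε₁ ≤ 1 → 0 < α → α ≤ 1 → 0 < δ → δ < 1 →
      0 ≤ Tg → Tg ≤ Th →
    ∀ ε₂ δ' τ : ℝ, ε₂ = ε₁ ^ α → 3 * ε₂ ≤ L₁ →
      δ' = ncgB2Delta L₁ L₂ Δ ε₁ α δ →
      τ = 1 + 1 / ε₁ + 1 / δ + d + L₁ + L₂ + Δ →
    ∀ (Ω : Type*) [MeasurableSpace Ω] (P : Measure Ω) [IsProbabilityMeasure P]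
      (ξ : ℕ → Ω → Metric.sphere (0 : Vec d) 1),
      (∀ n, Measurable (ξ n)) → iIndepFun ξ P → (∀ n, P.map (ξ n) = uniformSphere d) →
    P {ω | ¬ ∃ (x : Vec d) (t : Tally d),
        (x, t) ∈ ncgB2 f L₁ L₂ Δ (fun n => (ξ n ω : Vec d)) ε₁ α δ x₀ ∧
        ‖gradient f x‖ ≤ ε₁ ∧
        -ε₂ ≤ lambdaMin (hess f x : Module.End ℝ (Vec d)) ∧
        (t.ncg.length : ℝ) ≤ C * (1 / ε₂ ^ 3 + 1 / (ε₁ * ε₂)) ∧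
        (t.agdSteps : ℝ) ≤
          C * (1 / ε₂ ^ (7 / 2 : ℝ) + 1 / (ε₁ * ε₂ ^ (3 / 2 : ℝ))
            + ε₂ ^ (1 / 2 : ℝ) / ε₁ ^ 2) * Real.log τ ∧
        (∀ r ∈ t.ncg, r.time Tg Th ≤ c * Th * max 1 (stepBound f L₁ ε₂ δ' r.point)) ∧
        (2 ≤ d → ∀ r ∈ t.ncg, r.time Tg Th ≤ C * Th * stepBound f L₁ ε₂ δ' r.point) ∧
        t.time Tg Th ≤
          C * ((1 / (ε₁ * ε₂ ^ (3 / 2 : ℝ)) + 1 / ε₂ ^ (7 / 2 : ℝ)) * Th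
            + ε₂ ^ (1 / 2 : ℝ) / ε₁ ^ 2 * Tg) * Real.log τ}
      ≤ ENNReal.ofReal δ := by
  refine ⟨10, by norm_num, fun L₁ L₂ Δ hL₁ hL₂ hΔ => ?_⟩
  obtain ⟨C₁, hC₁, hK⟩ := exists_outerBound_le hL₁ hL₂ hΔ
  obtain ⟨C₂, hC₂, hlog⟩ := exists_log_le hL₁ hL₂ hΔ
  obtain ⟨C₃, hC₃, hsteps⟩ := exists_agdSteps_le hL₁ hΔ
  obtain ⟨c₄, hc₄, hlow⟩ := exists_le_stepBound hL₁ Δ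
  -- The constants for the gradient steps, the gradients, the time of the NCG steps, and of one
  -- NCG step in terms of its lower bound.
  obtain ⟨C₅, hC₅⟩ : ∃ C₅, C₅ = C₃ * (C₁ + 60 * Δ) := ⟨_, rfl⟩
  obtain ⟨C₆, hC₆⟩ : ∃ C₆, C₆ = 2 * C₅ + 4 * C₁ + 120 * Δ + 1 := ⟨_, rfl⟩
  obtain ⟨C₇, hC₇⟩ : ∃ C₇, C₇ = 10 * C₁ * (1 + √L₁ * C₂) := ⟨_, rfl⟩
  obtain ⟨C₈, hC₈⟩ : ∃ C₈, C₈ = 10 * (1 / c₄ + 1) := ⟨_, rfl⟩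
  have hC₁0 : 0 ≤ C₁ := by linarith
  have hC₅0 : 0 ≤ C₅ := by rw [hC₅]; positivity
  have hC₆0 : 0 ≤ C₆ := by rw [hC₆]; positivity
  have hC₇0 : 0 ≤ C₇ := by rw [hC₇]; positivity
  have hC₈0 : 0 ≤ C₈ := by rw [hC₈]; positivity
  refine ⟨C₁ + C₅ + C₆ + C₇ + C₈, by positivity, ?_⟩
  intro d f x₀ hd h ε₁ α δ Tg Th hε₁ hε₁' hα hα' hδ hδ1 hTg hTh ε₂ δ' τ hε₂ hε₂L hδ' hτ
    Ω _ P _ ξ hξ hind hU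
  have hd1 : (1 : ℝ) ≤ d := by exact_mod_cast hd
  have hε₂0 : 0 < ε₂ := by rw [hε₂]; positivity
  have h12 : ε₁ ≤ ε₂ := by
    rw [hε₂]
    simpa using Real.rpow_le_rpow_of_exponent_ge hε₁ hε₁' hα'
  have hε₂1 : ε₂ ≤ 1 := by rw [hε₂]; exact Real.rpow_le_one hε₁.le hε₁' hα.le
  have hTh0 : 0 ≤ Th := hTg.trans hTh
  have hinvε : 1 ≤ 1 / ε₁ := by rw [le_div_iff₀ hε₁]; linarith
  have hinvδ : 1 ≤ 1 / δ := by rw [le_div_iff₀ hδ]; linarith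
  have hlogτ : 1 ≤ Real.log τ := by
    rw [Real.le_log_iff_exp_le (by linarith)]
    linarith [Real.exp_one_lt_d9]
  obtain ⟨hK1, hK2⟩ := hK ε₁ ε₂ hε₁ h12 hε₂1
  have hlogd := hlog ε₁ ε₂ δ τ d hε₁ h12 hε₂1 hδ hd (by linarith) (by linarith) (by linarith) hlogτ
  obtain ⟨S, hS, hS'⟩ := hsteps ε₁ ε₂ τ hε₁ h12 hε₂1 (by linarith) hlogτ
  have hlow' := fun hd2 : 2 ≤ d => hlow d f x₀ L₂ hd2 h ε₂ δ' hε₂0 hε₂1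
  set K := outerBound L₁ L₂ Δ ε₁ ε₂ with hKdef
  have hδK : δ' = δ / K := by rw [hδ', ncgB2Delta, ← hε₂]
  obtain ⟨e, he⟩ : ∃ e, e = ε₁ ^ (3 * α / 2) := ⟨_, rfl⟩
  have he0 : 0 < e := by rw [he]; positivity
  have heα : e ^ (2 / 3 : ℝ) = ε₂ := by
    rw [he, hε₂, ← Real.rpow_mul hε₁.le]
    congr 1
    ring
  have he2 : e ^ 2 = ε₂ ^ 3 := by
    rw [he, hε₂, ← Real.rpow_natCast, ← Real.rpow_natCast, ← Real.rpow_mul hε₁.le,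
      ← Real.rpow_mul hε₁.le]
    congr 1
    push_cast
    ring
  obtain ⟨a, ha⟩ : ∃ a, a = ε₂ ^ 3 / max (12 * L₂ ^ 2) (2 * L₁) := ⟨_, rfl⟩
  obtain ⟨b, hb⟩ : ∃ b, b = ε₁ * ε₂ / (2 * √10 * L₂) := ⟨_, rfl⟩
  obtain ⟨A, hA⟩ : ∃ A, A = Δ / a := ⟨_, rfl⟩
  have hδs : δ' / (1 + A) = ncgA2Delta L₁ L₂ Δ e (2 / 3) δ' := by
    rw [ncgA2Delta_eq hε₂0 heα he2, hA, ha]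
  rw [← ha, ← hb] at hK1
  rw [← ha, ← hA] at hK2
  have ha0 : 0 < a := by
    rw [ha]; exact div_pos (by positivity) (lt_max_of_lt_right (by positivity))
  have hA0 : 0 ≤ A := by rw [hA]; positivity
  have hAK : 1 + A ≤ K := by
    have : 0 ≤ Δ / b := by rw [hb]; positivity
    rw [hA]; linarith
  have hK0 : (1 : ℝ) ≤ K := by linarith
  have hδ'0 : 0 < δ' := by rw [hδK]; positivity
  have hδ'δ : δ' ≤ δ := by rw [hδK]; exact div_le_self hδ.le hK0
  have hδs0 : 0 < δ' / (1 + A) := by positivity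
  have hδs1 : δ' / (1 + A) < 1 := (div_le_self hδ'0.le (by linarith)).trans_lt (by linarith)
  have hAd : 1 + A ≤ d / δ' := by
    rw [le_div_iff₀ hδ'0, hδK]
    calc (1 + A) * (δ / K) ≤ K * (δ / K) := by gcongr
      _ = δ := by field_simp
      _ ≤ d := by linarith
  have hbad := h.measure_exists_lanczosFails_le hd hL₁ (α := 2 / 3) he0 hδs0 hδs1 ε₁ ε₂ hξ hind hU
    ⌊K + A⌋₊
  refine le_trans (measure_mono fun ω hω => ?_)
    (hbad.trans (hδK ▸ floor_mul_ofReal_le hK0 hA0 hδ.le))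
  by_contra hgood
  simp only [Set.mem_ofPred_eq, not_exists, not_and] at hgood
  refine hω ?_
  obtain ⟨x, t, hmem, hgrad, hlam, hlen, hagd, hgrads, hrec⟩ :=
    h.exists_mem_fix_b2Body hd hL₁ hL₂ hΔ hε₁ hε₂0 hε₂L he0 (by norm_num) heα he2 hS ha hb rfl hK1
      (by rw [hA]) hδs (ξ := fun n => (ξ n ω : Vec d)) (fun n => by simp) rfl hgood
  have hrec1 : ∀ r ∈ t.ncg, f r.point ≤ f x₀ ∧
      r.time Tg Th ≤ 10 * Th * max 1 (stepBound f L₁ ε₂ δ' r.point) := by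
    intro r hr
    obtain ⟨y, hy, rfl⟩ := hrec r hr
    refine ⟨hy, ?_⟩
    rw [a2Noise, heα]
    exact ncgRecord_time_le hd hL₁ hε₂0 hδ'0 hA0 hAd hTg hTh y
  -- In terms of the square root `s` of `ε₂` all exponents are integral.
  obtain ⟨s, hs⟩ : ∃ s, s = √ε₂ := ⟨_, rfl⟩
  have hs0 : 0 < s := by rw [hs]; positivity
  have hs1 : s ≤ 1 := by rw [hs]; exact Real.sqrt_le_one.2 hε₂1
  have hε₂s : ε₂ = s ^ 2 := by rw [hs, Real.sq_sqrt hε₂0.le]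
  have hpow : ∀ n : ℕ, ε₂ ^ (n / 2 : ℝ) = s ^ n := fun n => by
    rw [hs, Real.sqrt_eq_rpow, ← Real.rpow_natCast, ← Real.rpow_mul hε₂0.le]
    congr 1
    ring
  have h7 : ε₂ ^ (7 / 2 : ℝ) = s ^ 7 := by simpa using hpow 7
  have h3 : ε₂ ^ (3 / 2 : ℝ) = s ^ 3 := by simpa using hpow 3
  have h1 : ε₂ ^ (1 / 2 : ℝ) = s := by simpa using hpow 1
  obtain ⟨V, hV⟩ : ∃ V, V = 1 / s ^ 7 + 1 / (ε₁ * s ^ 3) := ⟨_, rfl⟩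
  obtain ⟨U, hUdef⟩ : ∃ U, U = s / ε₁ ^ 2 := ⟨_, rfl⟩
  obtain ⟨W, hW⟩ : ∃ W, W = 1 / ε₂ ^ 3 + 1 / (ε₁ * ε₂) := ⟨_, rfl⟩
  have hV0 : 0 < V := by rw [hV]; positivity
  have hU0 : 0 < U := by rw [hUdef]; positivity
  have hW0 : 0 < W := by rw [hW]; positivity
  have hWV : W = V * s := by rw [hW, hV, hε₂s]; field_simp
  have hW1 : 1 ≤ W := by
    have e1 : 1 ≤ 1 / ε₂ ^ 3 := by
      rw [le_div_iff₀ (by positivity), one_mul]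
      exact pow_le_one₀ hε₂0.le hε₂1
    have e2 : 0 ≤ 1 / (ε₁ * ε₂) := by positivity
    linarith
  have hWleV : W ≤ V := by rw [hWV]; exact mul_le_of_le_one_right hV0.le hs1
  have hjU : 60 * ε₂ / ε₁ ^ 2 * Δ = 60 * Δ * (U * s) := by rw [hUdef, hε₂s]; ring
  rw [h7, h3, h1, add_comm (1 / (ε₁ * s ^ 3)), ← hV, ← hUdef, ← hW]
  rw [← hW] at hK2
  rw [← hs] at hS'
  rw [hjU] at hagd hgrads
  obtain ⟨ℓ, hℓ⟩ : ∃ ℓ, ℓ = Real.log τ := ⟨_, rfl⟩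
  rw [← hℓ] at hS' hlogd hlogτ ⊢
  have hKW : (K : ℝ) ≤ C₁ * W := by linarith
  have hlenW : (t.ncg.length : ℝ) ≤ C₁ * W :=
    ((Nat.cast_le.2 hlen).trans (Nat.floor_le (by positivity))).trans hK2
  rw [hWV] at hKW hlenW hWleV hW1
  have hagd' : (t.agdSteps : ℝ) ≤ C₅ * (V + U) * ℓ :=
    hC₅ ▸ agdSteps_le_of_le hs0 hV0.le hU0.le (by linarith) hC₁0 hC₃ hΔ hKW hS' hagd
      (Nat.cast_nonneg _)
  have hgrads' : (t.grads : ℝ) ≤ C₆ * (V + U) * ℓ :=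
    hC₆ ▸ grads_le_of_le hs1 hU0.le hlogτ (by linarith) hC₁0 hΔ hKW hWleV hagd' hgrads
  have hCV : ∀ {C' : ℝ}, C' ≤ C₁ + C₅ + C₆ + C₇ + C₈ → ∀ {z : ℝ}, 0 ≤ z →
      C' * z ≤ (C₁ + C₅ + C₆ + C₇ + C₈) * z := fun hC' z hz => mul_le_mul_of_nonneg_right hC' hz
  have hl0 : 0 ≤ Real.log (d / δ') := Real.log_nonneg (by linarith)
  rw [← hδK] at hlogd
  refine ⟨x, t, ?_, hgrad, hlam, ?_, ?_, fun r hr => (hrec1 r hr).2, fun hd2 r hr => ?_, ?_⟩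
  · rw [hδ', he, hε₂] at hmem
    exact hmem
  · exact (hWV ▸ hlenW).trans (hCV (by linarith) hW0.le)
  · rw [mul_assoc] at hagd' ⊢
    exact hagd'.trans (hCV (by linarith) (by positivity))
  · have hB := hlow' hd2 hδ'0 (by linarith) r.point (hrec1 r hr).1
    set B := stepBound f L₁ ε₂ δ' r.point
    have hB0 : 0 ≤ B := hc₄.le.trans hB
    have hmax : max 1 B ≤ (1 / c₄ + 1) * B := by
      have e1 : 1 ≤ 1 / c₄ * B := by rw [one_div_mul_eq_div, le_div_iff₀ hc₄]; linarith
      exact max_le (by linarith) (by linarith)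
    calc r.time Tg Th ≤ 10 * Th * max 1 B := (hrec1 r hr).2
      _ ≤ 10 * Th * ((1 / c₄ + 1) * B) := by gcongr
      _ = C₈ * (Th * B) := by rw [hC₈]; ring
      _ ≤ _ := by rw [mul_assoc]; exact hCV (by linarith) (by positivity)
  · have hstep : ∀ r ∈ t.ncg, r.time Tg Th ≤ 10 * Th * ((1 + √L₁ * C₂) / s * ℓ) := by
      intro r hr
      refine (hrec1 r hr).2.trans ?_
      have e1 : 1 ≤ 1 / s * ℓ :=
        one_le_mul_of_one_le_of_one_le (by rw [le_div_iff₀ hs0]; linarith) hlogτ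
      have e2 := (stepBound_le (f := f) (L₁ := L₁) hε₂0 hl0 r.point).trans
        (mul_le_mul_of_nonneg_left hlogd (by positivity))
      rw [← hs] at e2
      have e3 : (1 + √L₁ * C₂) / s * ℓ = 1 / s * ℓ + √L₁ / s * (C₂ * ℓ) := by ring
      have e4 : 0 ≤ √L₁ / s * (C₂ * ℓ) := by positivity
      gcongr
      exact max_le (by linarith) (by linarith)
    refine (Tally.time_le_of_le hs0 hV0.le hU0.le (by linarith) hC₁0 hC₆0 (by positivity) hTg hTh
      hstep hlenW hgrads').trans ?_
    rw [mul_assoc _ (V * Th + U * Tg), ← hC₇]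
    exact hCV (by linarith) (by positivity)
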